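/- Let $X_1,X_2,\dots$ be i.i.d. positive random variables whose common distribution function $F$ has a density $f$, with finite entropy, $\int f\,|\ln f|\,dx<\infty$, and with $E[(\ln X_1)^2]<\infty$. Let $F^{-1}(p)=\inf\{x:F(x)\ge p\}$ for $0<p<1$. For $n\ge 1$ let $x_{(1:n)}\le\dots\le x_{(n:n)}$ be the order statistics of $X_1,\dots,X_n$. For positive integers $m,r$ with $2m<r<n$ (Type-II censoring: only the first $r$ order statistics are observed) put $x_{(i:n)}=x_{(1:n)}$ for $i<1$ and replace $x_{(i:n)}$ by $x_{(r:n)}$ for $i>r$. For $1\le i\le r$ let $\bar x^h_{i-1+m}$ be the harmonic mean of the $m$ numbers $x_{(i:n)},\dots,x_{(i-1+m:n)}$ and let $\bar x^h_{i-1-m}$ be the harmonic mean of the $m+2$ numbers $x_{(i-1-m:n)},\dots,x_{(i:n)}$. Define $$\bar H^{(1)}_{m,n,r}=\frac1n\sum_{i=1}^{r}\ln\left(\frac{\bar x^h_{i-1+m}-\bar x^h_{i-1-m}}{m/n}\right)-\Big(1-\frac rn\Big)\ln\Big(1-\frac rn\Big).$$ With $U_{(r:n-1)}$ the $r$-th order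 statistic of $n-1$ independent uniform random variables on $[0,1]$, let $$\bar H_{1\cdots r:n}=E\left(\int_0^{U_{(r:n-1)}}\ln\Big(\frac{dF^{-1}(p)}{dp}\Big)dp\right)-E\Big(\big(1-U_{(r:n-1)}\big)\ln\big(1-U_{(r:n-1)}\big)\Big),$$ the normalized part of the joint entropy $H_{1\cdots r:n}=-\ln\frac{n!}{(n-r)!}+n\bar H_{1\cdots r:n}$ of the first $r$ order statistics. Then $\int_0^1\left|\ln\frac{dF^{-1}(p)}{dp}\right|dp<\infty$ (so that $\bar H_{1\cdots r:n}$ is well defined), and $\bar H^{(1)}_{m,n,r}$ is a consistent estimator of $\bar H_{1\cdots r:n}$ as $m,n\to\infty$ with $m/n\to0$, in the following sense. For all sequences of positive integers $m_k,n_k,r_k$ with $2m_k<r_k<n_k$, $m_k\to\infty$, $n_k\to\infty$ and $m_k/n_k\to0$, the random variable $\bar H^{(1)}_{m_k,n_k,r_k}$ has a finite second moment for all large $k$, and $$E\big[\bar H^{(1)}_{m_k,n_k,r_k}\big]-\bar H_{1\cdots r_k:n_k}\to0,\qquad \mathrm{Var}\big[\bar H^{(1)}_{m_k,n_k,r_k}\big]\to0\qquad(k\to\infty).$$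 -/

import Mathlib

open MeasureTheory ProbabilityTheory Filter Topology

noncomputable section

/-- The `j`-th smallest value `x_(j:n)`, `1 ≤ j ≤ n`, of a sample `x` of size `n`
(the value `0` for other `j` is never used below). -/
def orderStat {n : ℕ} (x : Fin n → ℝ) (j : ℕ) : ℝ :=
  if h : 1 ≤ j ∧ j ≤ n then x (Tuple.sort x ⟨j - 1, by omega⟩) else 0

/-- The order statistics of the sample censored at `r`, indexed by all integers:
`x_(i:n)` for `1 ≤ i ≤ r`, `x_(1:n)` for `i < 1` and `x_(r:n)` for `i > r`. -/
def censoredStat {n : ℕ} (x : Fin n → ℝ) (r : ℕ) (i : ℤ) : ℝ :=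
  orderStat x (max 1 (min i (r : ℤ))).toNat

/-- The harmonic mean of the numbers `a j`, `j ∈ s`, counted with multiplicity. -/
def harmonicMean (s : Finset ℤ) (a : ℤ → ℝ) : ℝ :=
  (s.card : ℝ) / ∑ j ∈ s, (a j)⁻¹

/-- The harmonic mean of `x_(i:n), …, x_(i-1+m:n)`. -/
def upperMean {n : ℕ} (x : Fin n → ℝ) (m r : ℕ) (i : ℤ) : ℝ :=
  harmonicMean (Finset.Icc i (i - 1 + m)) (censoredStat x r)

/-- The harmonic mean of `x_(i-1-m:n), …, x_(i:n)`. -/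
def lowerMean {n : ℕ} (x : Fin n → ℝ) (m r : ℕ) (i : ℤ) : ℝ :=
  harmonicMean (Finset.Icc (i - 1 - m) i) (censoredStat x r)

/-- The harmonic-mean based entropy estimator with window size `m`, computed from the first `r`
order statistics of the sample `x` of size `n`. -/
def entropyEstimator {n : ℕ} (x : Fin n → ℝ) (m r : ℕ) : ℝ :=
  (1 / (n : ℝ)) * ∑ i ∈ Finset.Icc (1 : ℤ) r,
      Real.log ((upperMean x m r i - lowerMean x m r i) / ((m : ℝ) / n))
    - (1 - (r : ℝ) / n) * Real.log (1 - (r : ℝ) / n)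

/-- The quantile function `F⁻¹` of a distribution `μ` on the line (used for `0 < p < 1`). -/
def quantile (μ : Measure ℝ) (p : ℝ) : ℝ :=
  sInf {x : ℝ | p ≤ cdf μ x}

/-- The law of `k` independent random variables that are uniform on `[0, 1]`. -/
def uniformSample (k : ℕ) : Measure (Fin k → ℝ) :=
  Measure.pi fun _ => volume.restrict (Set.Icc (0 : ℝ) 1)

/-- The normalized part of the joint entropy of the first `r` order statistics of a sample of
size `n` from `μ`, where `1 ≤ r ≤ n - 1`: with `U` the `r`-th order statistic of `n - 1`
independent uniform random variables,
`E ∫₀^U ln (dF⁻¹(p)/dp) dp - E ((1 - U) ln (1 - U))`. -/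
def normalizedEntropy (μ : Measure ℝ) (r n : ℕ) : ℝ :=
  (∫ u, (∫ p in (0 : ℝ)..(orderStat u r), Real.log (deriv (quantile μ) p))
      ∂(uniformSample (n - 1)))
    - ∫ u, (1 - orderStat u r) * Real.log (1 - orderStat u r) ∂(uniformSample (n - 1))

end

/-!
The quantile transform turns the sample into `Q` of a uniform sample, where `Q = quantile μ`
(`map_sample_eq`), and the assertion becomes convergence to zero in mean square (`L2Null`) of
functions of uniform order statistics. Let `A < B` be the means of the reciprocals `1 / Q` over the
upper and the lower window of the index `i`. The two harmonic means are `1 / A` and `1 / B`, so the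
`i`-th logarithm of the estimator is `log (B - A) - log A - log B - log (m / n)`. The last two means
may be replaced by values of `1 / Q` at nearby order statistics, up to a monotonicity error of the
right sign, and contribute the integral of `2 log Q` by a law of large numbers. The drop `B - A`
(`gap`) is an average of increments of `-1 / Q`, and it remains to compare the average of
`log (B - A) - log (m / n)` with the integral of `φ = logDerivInv μ f`, the logarithm of the
derivative of `-1 / Q`; indeed `φ + 2 log Q` is almost everywhere the logarithm of the derivative of
`Q`. The function `φ` is only integrable, and neither regularity nor boundedness of the density is
available, so both bounds use convexity.

Lower bound (`QuantileData.exists_l2Null_lower`). By Jensen's inequality, used in tangent line form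
(`exp_mul_le_sub_inv_quantile`, `gap_mul_exp_kerAvg_le`), the logarithm of the drop is at least the
logarithm of the length of the window plus the average of `φ` over it. A variance computation for a
kernel density estimate shows that most windows have almost their typical length (`l2Null_defect`).
For these, averaging over windows is bounded in `L¹` (`sum_abs_kerAvg_le`), so that by approximation
with continuous functions the averages of `φ` recover its integral (`l2Null_kerAvg`). The remaining
windows, at the ends or too short, are few, and a maximal inequality shows that they are negligible:
that many points of a uniform sample lie close together is so unlikely that averages of integrable
functions over short windows are bounded in mean square (`exists_lintegral_winKer_sq_le`,
`l2Null_weighted_winAvg`, `l2Null_weighted_log_spacing`).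

Upper bound (`QuantileData.exists_l2Null_upper`). In `log w ≤ w * γ - 1 - log γ`, where `w` is the
rescaled drop, `γ` is chosen from a continuous approximation `β` of the density in the coordinate
`x / (1 + x)`, clamped away from `0` and `∞` (`exists_isDensityApprox`). Then `w * γ` is at most the
rescaled drop of the primitive of `β` (`IsDensityApprox.mul_gap_le`); these drops add up
telescopically (`sum_gap_le`) and nearly cancel the terms `- 1`, while the average of `- log γ`
converges to the integral of `φ` up to `ε`. The windows at the ends cost at most a multiple of
`(m / n) log (n / m)`.

Finally `l2Null_orderStat_sub`, the concentration of order statistics, lets `r / n`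
take the place of `U_(r:n-1)` in the normalized entropy (`tendsto_normalizedEntropy_sub`).
-/

noncomputable section

/-! ### Order statistics -/

theorem orderStat_eq {n : ℕ} (x : Fin n → ℝ) {j : ℕ} (h1 : 1 ≤ j) (hn : j ≤ n) :
    orderStat x j = (x ∘ Tuple.sort x) ⟨j - 1, by omega⟩ := by
  simp [orderStat, h1, hn]

/-- The event `x_(j) ≤ t` in terms of the number of sample points at most `t`. -/
theorem orderStat_le_iff {n : ℕ} (x : Fin n → ℝ) {j : ℕ} (h1 : 1 ≤ j) (hn : j ≤ n) (t : ℝ) :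
    orderStat x j ≤ t ↔ j ≤ (Finset.univ.filter fun a => x a ≤ t).card := by
  rw [orderStat_eq x h1 hn,
    ← Tuple.lt_card_le_iff_apply_le_of_monotone (Tuple.monotone_sort x)]
  have : (Finset.univ.filter fun i => (x ∘ Tuple.sort x) i ≤ t).card
      = (Finset.univ.filter fun a => x a ≤ t).card := by
    rw [← Fintype.card_subtype, ← Fintype.card_subtype]
    exact Fintype.card_congr ((Tuple.sort x).subtypeEquiv fun a => by simp)
  rw [this]
  simp only
  omega

theorem orderStat_mono {n : ℕ} (x : Fin n → ℝ) {i j : ℕ} (h1 : 1 ≤ i) (hij : i ≤ j)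
    (hn : j ≤ n) : orderStat x i ≤ orderStat x j := by
  rw [orderStat_eq x h1 (hij.trans hn), orderStat_eq x (h1.trans hij) hn]
  exact Tuple.monotone_sort x (by simp only [Fin.le_def]; omega)

theorem orderStat_strictMono {n : ℕ} {x : Fin n → ℝ} (hx : Function.Injective x) {i j : ℕ}
    (h1 : 1 ≤ i) (hij : i < j) (hn : j ≤ n) : orderStat x i < orderStat x j := by
  refine lt_of_le_of_ne (orderStat_mono x h1 hij.le hn) fun h => ?_
  rw [orderStat_eq x h1 (hij.le.trans hn), orderStat_eq x (h1.trans hij.le) hn] at h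
  have := (hx.comp (Tuple.sort x).injective) h
  simp only [Fin.mk.injEq] at this
  omega

theorem orderStat_mem {n : ℕ} (x : Fin n → ℝ) {j : ℕ} (h1 : 1 ≤ j) (hn : j ≤ n) :
    ∃ a, orderStat x j = x a := by
  rw [orderStat_eq x h1 hn]; exact ⟨_, rfl⟩

theorem sum_orderStat {n : ℕ} (x : Fin n → ℝ) (ψ : ℝ → ℝ) :
    ∑ j ∈ Finset.Icc 1 n, ψ (orderStat x j) = ∑ a, ψ (x a) := by
  rw [← Equiv.sum_comp (Tuple.sort x)]
  rw [Finset.sum_fin_eq_sum_range, Finset.range_eq_Ico,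
    ← Finset.sum_Ico_add_right_sub_eq 0 n 1]
  refine Finset.sum_congr (by ext; simp) fun j hj => ?_
  simp only [Finset.mem_Ico] at hj
  rw [orderStat_eq x (by omega) (by omega), dif_pos (by omega)]
  rfl

/-- A monotone transformation of the sample transforms the order statistics. -/
theorem orderStat_comp {n : ℕ} {g : ℝ → ℝ} {s : Set ℝ} (hg : MonotoneOn g s) {x : Fin n → ℝ}
    (hx : ∀ a, x a ∈ s) {j : ℕ} (h1 : 1 ≤ j) (hn : j ≤ n) :
    orderStat (fun a => g (x a)) j = g (orderStat x j) := by
  rw [orderStat_eq _ h1 hn, orderStat_eq _ h1 hn]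
  have h : (fun a => g (x a)) ∘ Tuple.sort x
      = (fun a => g (x a)) ∘ Tuple.sort (fun a => g (x a)) := by
    rw [Tuple.comp_sort_eq_comp_iff_monotone]
    exact fun a b hab => hg (hx _) (hx _) (Tuple.monotone_sort x hab)
  rw [← h]; rfl

theorem measurable_card_filter_le {n : ℕ} (p : ℝ → Prop) (hp : MeasurableSet {x | p x})
    [DecidablePred p] :
    Measurable fun x : Fin n → ℝ => (Finset.univ.filter fun a => p (x a)).card := by
  simp only [Finset.card_filter]
  refine Finset.measurable_sum _ fun a _ => ?_
  exact Measurable.ite (measurable_pi_apply a hp) measurable_const measurable_const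

theorem measurable_orderStat {n : ℕ} (j : ℕ) :
    Measurable fun x : Fin n → ℝ => orderStat x j := by
  by_cases h : 1 ≤ j ∧ j ≤ n
  · refine measurable_of_Iic fun t => ?_
    have : (fun x : Fin n → ℝ => orderStat x j) ⁻¹' Set.Iic t
        = {x | j ≤ (Finset.univ.filter fun a => x a ≤ t).card} := by
      ext x; simp [orderStat_le_iff x h.1 h.2]
    rw [this]
    exact measurableSet_le measurable_const (measurable_card_filter_le (· ≤ t) measurableSet_Iic)
  · simp only [orderStat, dif_neg h]
    exact measurable_const

theorem measurable_censoredStat {n : ℕ} (r : ℕ) (i : ℤ) :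
    Measurable fun x : Fin n → ℝ => censoredStat x r i := measurable_orderStat _

theorem censoredStat_mono {n : ℕ} (x : Fin n → ℝ) {r : ℕ} (h1 : 1 ≤ r) (hr : r ≤ n) :
    Monotone (censoredStat x r) := by
  intro i j hij
  exact orderStat_mono x (by omega) (by omega) (by omega)

theorem censoredStat_clamp {n : ℕ} (x : Fin n → ℝ) {r : ℕ} (h1 : 1 ≤ r) (i : ℤ) :
    censoredStat x r i = censoredStat x r (max 1 (min i r)) := by
  simp only [censoredStat]; congr 1; omega

theorem censoredStat_of_mem {n : ℕ} (x : Fin n → ℝ) {r : ℕ} {i : ℤ} (h1 : 1 ≤ i) (hr : i ≤ r) :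
    censoredStat x r i = orderStat x i.toNat := by
  simp only [censoredStat]; congr 1; omega

theorem censoredStat_lt {n : ℕ} {x : Fin n → ℝ} (hx : Function.Injective x) {r : ℕ}
    (hrn : r ≤ n) {i j : ℤ} (h1 : 1 ≤ i) (hij : i < j) (hr : j ≤ r) :
    censoredStat x r i < censoredStat x r j := by
  rw [censoredStat_of_mem x h1 (by omega), censoredStat_of_mem x (by omega) hr]
  exact orderStat_strictMono hx (by omega) (by omega) (by omega)

theorem censoredStat_mem {n : ℕ} (x : Fin n → ℝ) {r : ℕ} (h1 : 1 ≤ r) (hr : r ≤ n) (i : ℤ) :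
    ∃ a, censoredStat x r i = x a := orderStat_mem x (by omega) (by omega)

theorem censoredStat_comp {n : ℕ} {g : ℝ → ℝ} {s : Set ℝ} (hg : MonotoneOn g s) {x : Fin n → ℝ}
    (hx : ∀ a, x a ∈ s) {r : ℕ} (h1 : 1 ≤ r) (hr : r ≤ n) (i : ℤ) :
    censoredStat (fun a => g (x a)) r i = g (censoredStat x r i) :=
  orderStat_comp hg hx (by omega) (by omega)

theorem sum_censoredStat_le {n : ℕ} (x : Fin n → ℝ) {r : ℕ} (hr : r ≤ n) {ψ : ℝ → ℝ}
    (hψ : ∀ t, 0 ≤ ψ t) :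
    ∑ i ∈ Finset.Icc (1 : ℤ) r, ψ (censoredStat x r i) ≤ ∑ a, ψ (x a) := by
  rw [← sum_orderStat]
  calc ∑ i ∈ Finset.Icc (1 : ℤ) r, ψ (censoredStat x r i)
      = ∑ j ∈ Finset.Icc 1 r, ψ (orderStat x j) := by
        refine Finset.sum_nbij' (fun i => i.toNat) (fun j => (j : ℤ)) ?_ ?_ ?_ ?_ ?_
        · intro i hi; simp at hi ⊢; omega
        · intro i hi; simp at hi ⊢; omega
        · intro i hi; simp at hi ⊢; omega
        · intro i hi; simp
        · intro i hi
          simp only [Finset.mem_Icc] at hi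
          rw [censoredStat_of_mem x hi.1 hi.2]
    _ ≤ _ := Finset.sum_le_sum_of_subset_of_nonneg
        (Finset.Icc_subset_Icc le_rfl hr) fun _ _ _ => hψ _

end

noncomputable section

/-! ### The quantile function -/

section Quantile

variable {μ : Measure ℝ}

theorem continuous_cdf [IsProbabilityMeasure μ] (h : μ ≪ volume) : Continuous (cdf μ) := by
  refine continuous_iff_continuousAt.2 fun x => ?_
  rw [(cdf μ).mono.continuousAt_iff_leftLim_eq_rightLim, StieltjesFunction.rightLim_eq]
  have h0 : (cdf μ).measure {x} = 0 := by rw [measure_cdf]; exact h (by simp)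
  rw [StieltjesFunction.measure_singleton, ENNReal.ofReal_eq_zero] at h0
  exact le_antisymm ((cdf μ).mono.leftLim_le le_rfl) (by linarith)

theorem quantile_le_iff {p : ℝ} (hp : p ∈ Set.Ioo (0 : ℝ) 1) (x : ℝ) :
    quantile μ p ≤ x ↔ p ≤ cdf μ x := by
  have hbdd : BddBelow {x : ℝ | p ≤ cdf μ x} := by
    obtain ⟨a, ha⟩ := ((tendsto_cdf_atBot μ).eventually (gt_mem_nhds hp.1)).exists_forall_of_atBot
    refine ⟨a, fun y hy => ?_⟩
    by_contra! hlt
    exact absurd (ha y hlt.le) (not_lt.2 hy)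
  have hne : {x : ℝ | p ≤ cdf μ x}.Nonempty := by
    obtain ⟨a, ha⟩ := ((tendsto_cdf_atTop μ).eventually (lt_mem_nhds hp.2)).exists
    exact ⟨a, ha.le⟩
  have hup : ∀ y, quantile μ p < y → p ≤ cdf μ y := fun y hy => by
    obtain ⟨z, hz, hzy⟩ := exists_lt_of_csInf_lt hne hy
    exact hz.trans ((cdf μ).mono hzy.le)
  refine ⟨fun h => ?_, fun h => csInf_le hbdd h⟩
  have hr : Tendsto (cdf μ) (𝓝[>] x) (𝓝 (cdf μ x)) :=
    ((cdf μ).right_continuous x).tendsto.mono_left (nhdsWithin_mono _ Set.Ioi_subset_Ici_self)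
  refine ge_of_tendsto hr ?_
  filter_upwards [self_mem_nhdsWithin] with y hy
  exact hup y (h.trans_lt hy)

theorem cdf_quantile [IsProbabilityMeasure μ] (h : μ ≪ volume) {p : ℝ}
    (hp : p ∈ Set.Ioo (0 : ℝ) 1) :
    cdf μ (quantile μ p) = p := by
  refine le_antisymm ?_ ((quantile_le_iff hp _).1 le_rfl)
  have hl : Tendsto (cdf μ) (𝓝[<] (quantile μ p)) (𝓝 (cdf μ (quantile μ p))) :=
    (continuous_cdf h).continuousAt.tendsto.mono_left nhdsWithin_le_nhds
  refine le_of_tendsto hl ?_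
  filter_upwards [self_mem_nhdsWithin] with y hy
  by_contra! hlt
  exact absurd ((quantile_le_iff hp y).2 hlt.le) (not_le.2 hy)

theorem quantile_strictMonoOn [IsProbabilityMeasure μ] (h : μ ≪ volume) :
    StrictMonoOn (quantile μ) (Set.Ioo (0 : ℝ) 1) := by
  intro p hp q hq hpq
  by_contra! hle
  have := (quantile_le_iff hq _).1 hle
  rw [cdf_quantile h hp] at this
  linarith

theorem measurable_quantile : Measurable (quantile μ) := by
  have h0 : ∀ p ≤ (0 : ℝ), quantile μ p = 0 := fun p hp => by
    have : {x : ℝ | p ≤ cdf μ x} = Set.univ := by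
      ext x; simpa using hp.trans (cdf_nonneg μ x)
    simp [quantile, this]
  have h1 : ∀ p > (1 : ℝ), quantile μ p = 0 := fun p hp => by
    have : {x : ℝ | p ≤ cdf μ x} = ∅ := by
      ext x; simpa using (cdf_le_one μ x).trans_lt hp
    simp [quantile, this]
  refine measurable_of_Iic fun x => ?_
  have : quantile μ ⁻¹' Set.Iic x = (Set.Ioo (0 : ℝ) 1 ∩ Set.Iic (cdf μ x))
      ∪ ((Set.Iic 0 ∪ Set.Ioi 1) ∩ {_p | 0 ≤ x}) ∪ ({1} ∩ {_p | quantile μ 1 ≤ x}) := by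
    ext p
    simp only [Set.mem_preimage, Set.mem_Iic, Set.mem_union, Set.mem_inter_iff, Set.mem_ofPred_eq,
      Set.mem_Ioi, Set.mem_singleton_iff]
    rcases le_or_gt p 0 with hp | hp
    · rw [h0 p hp]
      have : ¬ p ∈ Set.Ioo (0 : ℝ) 1 := fun h => by linarith [h.1]
      have h' : ¬ p = 1 := by intro h; linarith
      simp [this, hp, h']
    rcases lt_trichotomy p 1 with hp1 | hp1 | hp1
    · rw [quantile_le_iff ⟨hp, hp1⟩]
      simp [hp, hp1, hp1.ne, not_le.2 hp, not_lt.2 hp1.le]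
    · subst hp1; simp
    · rw [h1 p hp1]
      simp [hp1, not_lt.2 hp1.le, hp1.ne', not_le.2 hp]
  rw [this]
  refine ((measurableSet_Ioo.inter measurableSet_Iic).union ?_).union ?_
  · exact (measurableSet_Iic.union measurableSet_Ioi).inter (MeasurableSet.const _)
  · exact (measurableSet_singleton _).inter (MeasurableSet.const _)

theorem ae_mem_Ioo : ∀ᵐ p ∂(volume.restrict (Set.Icc (0 : ℝ) 1)), p ∈ Set.Ioo (0 : ℝ) 1 := by
  rw [← restrict_Ioo_eq_restrict_Icc]
  exact ae_restrict_mem measurableSet_Ioo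

instance : IsProbabilityMeasure (volume.restrict (Set.Icc (0 : ℝ) 1)) :=
  ⟨by simp⟩

instance (k : ℕ) : IsProbabilityMeasure (uniformSample k) := by
  unfold uniformSample; infer_instance

/-- The quantile function carries the uniform distribution to `μ`. -/
theorem measurePreserving_quantile [IsProbabilityMeasure μ] :
    MeasurePreserving (quantile μ) (volume.restrict (Set.Icc (0 : ℝ) 1)) μ := by
  refine ⟨measurable_quantile, ?_⟩
  have : IsProbabilityMeasure ((volume.restrict (Set.Icc (0 : ℝ) 1)).map (quantile μ)) :=
    Measure.isProbabilityMeasure_map measurable_quantile.aemeasurable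
  refine Measure.eq_of_cdf _ _ ?_
  ext x
  rw [cdf_eq_real, map_measureReal_apply measurable_quantile measurableSet_Iic]
  have : (quantile μ ⁻¹' Set.Iic x) =ᵐ[volume.restrict (Set.Icc (0 : ℝ) 1)]
      Set.Iic (cdf μ x) := by
    filter_upwards [ae_mem_Ioo] with p hp
    exact propext (quantile_le_iff hp x)
  rw [measureReal_congr this, measureReal_restrict_apply measurableSet_Iic]
  have h2 : Set.Iic (cdf μ x) ∩ Set.Icc (0 : ℝ) 1 = Set.Icc 0 (cdf μ x) := by
    ext p; simp only [Set.mem_inter_iff, Set.mem_Iic, Set.mem_Icc]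
    have := cdf_le_one μ x
    constructor
    · rintro ⟨h1, h2, h3⟩; exact ⟨h2, h1⟩
    · rintro ⟨h1, h2⟩; exact ⟨h2, h1, h2.trans this⟩
  rw [h2, Real.volume_real_Icc_of_le (cdf_nonneg μ x), sub_zero]

theorem quantile_pos [IsProbabilityMeasure μ] (hpos : ∀ᵐ x ∂μ, 0 < x) {p : ℝ}
    (hp : p ∈ Set.Ioo (0 : ℝ) 1) : 0 < quantile μ p := by
  by_contra! hle
  have h1 := (quantile_le_iff hp 0).1 hle
  have h2 : cdf μ 0 = 0 := by
    rw [cdf_eq_real, measureReal_def]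
    have : μ (Set.Iic 0) = 0 := by
      rw [← compl_compl (Set.Iic (0 : ℝ)), Set.compl_Iic]; exact hpos
    simp [this]
  linarith [hp.1]

variable {f : ℝ → ℝ}

theorem absolutelyContinuous_of_density
    (hf : μ = volume.withDensity (fun x => ENNReal.ofReal (f x))) : μ ≪ volume := by
  rw [hf]; exact withDensity_absolutelyContinuous _ _

/-- The derivative of the quantile function is the reciprocal of the density. -/
theorem ae_deriv_quantile [IsProbabilityMeasure μ] (hf_meas : Measurable f)
    (hf_nonneg : ∀ x, 0 ≤ f x)
    (hf : μ = volume.withDensity (fun x => ENNReal.ofReal (f x))) :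
    ∀ᵐ p ∂(volume.restrict (Set.Icc (0 : ℝ) 1)), f (quantile μ p) * deriv (quantile μ) p = 1 := by
  have hac := absolutelyContinuous_of_density hf
  have h1 : ∀ᵐ x, HasDerivAt (cdf μ) (f x) x := by
    have h2 := (cdf μ).ae_hasDerivAt
    rw [measure_cdf] at h2
    have h3 : μ.rnDeriv volume =ᵐ[volume] fun x => ENNReal.ofReal (f x) := by
      conv_lhs => rw [hf]
      exact Measure.rnDeriv_withDensity _ hf_meas.ennreal_ofReal
    filter_upwards [h2, h3] with x hx hx3
    rw [hx3, ENNReal.toReal_ofReal (hf_nonneg x)] at hx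
    exact hx
  have h4 : ∀ᵐ p ∂(volume.restrict (Set.Icc (0 : ℝ) 1)),
      HasDerivAt (cdf μ) (f (quantile μ p)) (quantile μ p) :=
    measurePreserving_quantile.quasiMeasurePreserving.ae (hac.ae_le h1)
  have h5 := (quantile_strictMonoOn hac).monotoneOn.ae_differentiableWithinAt measurableSet_Ioo
  rw [restrict_Ioo_eq_restrict_Icc] at h5
  filter_upwards [h4, h5, ae_mem_Ioo] with p hp4 hp5 hp
  have hd := (hp5.differentiableAt (isOpen_Ioo.mem_nhds hp)).hasDerivAt
  have hc := hp4.comp p hd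
  have hid : HasDerivAt (cdf μ ∘ quantile μ) 1 p := by
    refine (hasDerivAt_id p).congr_of_eventuallyEq ?_
    filter_upwards [isOpen_Ioo.mem_nhds hp] with q hq
    exact cdf_quantile hac hq
  exact hc.unique hid

theorem lintegral_density_inv_le [IsProbabilityMeasure μ] (hf_meas : Measurable f)
    (hf_nonneg : ∀ x, 0 ≤ f x)
    (hf : μ = volume.withDensity (fun x => ENNReal.ofReal (f x))) (hpos : ∀ᵐ x ∂μ, 0 < x)
    {p q : ℝ} (hp : p ∈ Set.Ioo (0 : ℝ) 1) (hq : q ∈ Set.Ioo (0 : ℝ) 1) (hpq : p ≤ q) :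
    ∫⁻ u in Set.Ioc p q, ENNReal.ofReal (1 / (f (quantile μ u) * quantile μ u ^ 2))
      ≤ ENNReal.ofReal ((quantile μ p)⁻¹ - (quantile μ q)⁻¹) := by
  have hac := absolutelyContinuous_of_density hf
  set a := quantile μ p
  set b := quantile μ q
  have ha : 0 < a := quantile_pos hpos hp
  have hab : a ≤ b := (quantile_strictMonoOn hac).monotoneOn hp hq hpq
  have hsub : Set.Ioc p q ⊆ Set.Ioo 0 1 := fun u hu => ⟨hp.1.trans hu.1, hu.2.trans_lt hq.2⟩
  have hm : Measurable fun x => ENNReal.ofReal (1 / (f x * x ^ 2)) := by fun_prop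
  calc ∫⁻ u in Set.Ioc p q, ENNReal.ofReal (1 / (f (quantile μ u) * quantile μ u ^ 2))
      = ∫⁻ u in Set.Ioc p q, (Set.Ioc a b).indicator
          (fun x => ENNReal.ofReal (1 / (f x * x ^ 2))) (quantile μ u) := by
        refine setLIntegral_congr_fun measurableSet_Ioc fun u hu => ?_
        have hu' := hsub hu
        rw [Set.indicator_of_mem]
        exact ⟨quantile_strictMonoOn hac hp hu' hu.1,
          (quantile_strictMonoOn hac).monotoneOn hu' hq hu.2⟩
    _ ≤ ∫⁻ u in Set.Icc 0 1, (Set.Ioc a b).indicator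
          (fun x => ENNReal.ofReal (1 / (f x * x ^ 2))) (quantile μ u) :=
        lintegral_mono_set (hsub.trans Set.Ioo_subset_Icc_self)
    _ = ∫⁻ x, (Set.Ioc a b).indicator (fun x => ENNReal.ofReal (1 / (f x * x ^ 2))) x ∂μ :=
        measurePreserving_quantile.lintegral_comp (hm.indicator measurableSet_Ioc)
    _ = ∫⁻ x in Set.Ioc a b, ENNReal.ofReal (f x) * ENNReal.ofReal (1 / (f x * x ^ 2)) := by
        rw [lintegral_indicator measurableSet_Ioc]
        conv_lhs => rw [hf]
        rw [setLIntegral_withDensity_eq_setLIntegral_mul _ hf_meas.ennreal_ofReal hm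
          measurableSet_Ioc]
        rfl
    _ ≤ ∫⁻ x in Set.Ioc a b, ENNReal.ofReal (x ^ (-2 : ℤ)) := by
        refine setLIntegral_mono_ae (by fun_prop) (Eventually.of_forall fun x hx => ?_)
        rw [← ENNReal.ofReal_mul (hf_nonneg x)]
        refine ENNReal.ofReal_le_ofReal ?_
        have hx0 : 0 < x := ha.trans hx.1
        rcases (hf_nonneg x).eq_or_lt with h | h
        · rw [← h, zero_mul]; positivity
        · refine le_of_eq ?_
          rw [zpow_neg, zpow_ofNat]
          field_simp
    _ = ENNReal.ofReal (a⁻¹ - b⁻¹) := by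
        have h0 : (0 : ℝ) ∉ Set.uIcc a b := by
          rw [Set.uIcc_of_le hab]; exact fun h => absurd h.1 (not_le.2 ha)
        rw [← ofReal_integral_eq_lintegral_ofReal, ← intervalIntegral.integral_of_le hab,
          integral_zpow]
        · congr 1; norm_num; ring
        · exact Or.inr ⟨by norm_num, h0⟩
        · exact (intervalIntegrable_iff_integrableOn_Ioc_of_le hab).1
            (intervalIntegral.intervalIntegrable_zpow (Or.inr h0))
        · exact Eventually.of_forall fun x => by positivity

end Quantile
end

noncomputable section

/-! ### Window averages of monotone sequences -/

/-- The mean of the `m` terms `a i, …, a (i + m - 1)`. -/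
def upAvg (m : ℕ) (a : ℤ → ℝ) (i : ℤ) : ℝ := (∑ s ∈ Finset.range m, a (i + s)) / m

/-- The mean of the `m + 2` terms `a (i - m - 1), …, a i`. -/
def loAvg (m : ℕ) (a : ℤ → ℝ) (i : ℤ) : ℝ := (∑ t ∈ Finset.range (m + 2), a (i - t)) / (m + 2)

/-- The drop of the sequence `a` between its two window means at `i`. -/
def gap (m : ℕ) (a : ℤ → ℝ) (i : ℤ) : ℝ := loAvg m a i - upAvg m a i

theorem upperMean_eq {n : ℕ} (x : Fin n → ℝ) (m r : ℕ) (i : ℤ) :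
    upperMean x m r i = (upAvg m (fun j => (censoredStat x r j)⁻¹) i)⁻¹ := by
  have hs : ∑ j ∈ Finset.Icc i (i - 1 + m), (censoredStat x r j)⁻¹
      = ∑ s ∈ Finset.range m, (censoredStat x r (i + s))⁻¹ := by
    refine Finset.sum_nbij' (fun j => (j - i).toNat) (fun s => i + s) ?_ ?_ ?_ ?_ ?_ <;>
      intro j hj <;> simp only [Finset.mem_Icc, Finset.mem_range] at * <;> try omega
    congr 2; omega
  have hc : (Finset.Icc i (i - 1 + m)).card = m := by simp; omega
  rw [upperMean, harmonicMean, hs, hc, upAvg, inv_div]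

theorem lowerMean_eq {n : ℕ} (x : Fin n → ℝ) (m r : ℕ) (i : ℤ) :
    lowerMean x m r i = (loAvg m (fun j => (censoredStat x r j)⁻¹) i)⁻¹ := by
  have hs : ∑ j ∈ Finset.Icc (i - 1 - m) i, (censoredStat x r j)⁻¹
      = ∑ t ∈ Finset.range (m + 2), (censoredStat x r (i - t))⁻¹ := by
    refine Finset.sum_nbij' (fun j => (i - j).toNat) (fun s => i - s) ?_ ?_ ?_ ?_ ?_ <;>
      intro j hj <;> simp only [Finset.mem_Icc, Finset.mem_range] at * <;> try omega
    congr 2; omega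
  have hc : (Finset.Icc (i - 1 - m) i).card = m + 2 := by simp; omega
  rw [lowerMean, harmonicMean, hs, hc, loAvg, inv_div]; push_cast; rfl

/-- The drop is an average of differences over all pairs of a lower and an upper index; bounds for
increments of `a` therefore carry over to the drop. -/
theorem gap_eq_sum {m : ℕ} (hm : 0 < m) (a : ℤ → ℝ) (i : ℤ) :
    gap m a i = (∑ s ∈ Finset.range m, ∑ t ∈ Finset.range (m + 2), (a (i - t) - a (i + s)))
      / (m * (m + 2)) := by
  have hm' : (0 : ℝ) < m := by exact_mod_cast hm
  simp only [gap, loAvg, upAvg, Finset.sum_sub_distrib, Finset.sum_const, Finset.card_range,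
    nsmul_eq_mul, ← Finset.mul_sum]
  push_cast
  field_simp

theorem gap_nonneg {m : ℕ} (hm : 0 < m) {a : ℤ → ℝ} (ha : Antitone a) (i : ℤ) :
    0 ≤ gap m a i := by
  rw [gap_eq_sum hm]
  refine div_nonneg (Finset.sum_nonneg fun s _ => Finset.sum_nonneg fun t _ => ?_) (by positivity)
  exact sub_nonneg.2 (ha (by omega))

/-- A comparison of increments of two sequences over the window passes to their drops. -/
theorem mul_gap_le {m : ℕ} (hm : 0 < m) {a b : ℤ → ℝ} {i : ℤ} {γ : ℝ}
    (h : ∀ k l : ℤ, i - 1 - m ≤ k → k ≤ l → l ≤ i - 1 + m → γ * (a k - a l) ≤ b k - b l) :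
    γ * gap m a i ≤ gap m b i := by
  rw [gap_eq_sum hm, gap_eq_sum hm, mul_div_assoc', Finset.mul_sum]
  refine div_le_div_of_nonneg_right (Finset.sum_le_sum fun s hs => ?_) (by positivity)
  rw [Finset.mul_sum]
  refine Finset.sum_le_sum fun t ht => ?_
  simp only [Finset.mem_range] at hs ht
  exact h _ _ (by omega) (by omega) (by omega)

theorem sum_shift_sub_le {a : ℤ → ℝ} {r : ℕ} (h1 : ∀ i, a i ≤ a 1) (hr : ∀ i, a r ≤ a i)
    (s t : ℕ) :
    ∑ i ∈ Finset.Icc (1 : ℤ) r, (a (i - t) - a (i + s)) ≤ (s + t) * (a 1 - a r) := by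
  have step : ∀ u : ℤ, ∑ i ∈ Finset.Icc (1 : ℤ) r, (a (i + u) - a (i + u + 1)) ≤ a 1 - a r := by
    intro u
    have : ∀ k : ℕ, ∑ i ∈ Finset.Icc (1 : ℤ) k, (a (i + u) - a (i + u + 1))
        = a (1 + u) - a (k + 1 + u) := by
      intro k
      induction k with
      | zero => simp
      | succ k ih =>
        have : Finset.Icc (1 : ℤ) ((k + 1 : ℕ) : ℤ) = insert ((k : ℤ) + 1) (Finset.Icc 1
            (k : ℤ)) := by
          ext; simp; omega
        rw [this, Finset.sum_insert (by simp), ih]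
        push_cast
        rw [show (k : ℤ) + 1 + u + 1 = k + 1 + 1 + u by ring]; ring
    rw [this]
    linarith [h1 (1 + u), hr (r + 1 + u)]
  have main : ∀ d : ℕ, ∑ i ∈ Finset.Icc (1 : ℤ) r, (a (i - t) - a (i - t + d))
      ≤ d * (a 1 - a r) := by
    intro d
    induction d with
    | zero => simp
    | succ d ih =>
      have h2 := step (-t + d)
      have : ∑ i ∈ Finset.Icc (1 : ℤ) r, (a (i - t) - a (i - t + (d + 1 : ℕ)))
          = ∑ i ∈ Finset.Icc (1 : ℤ) r, (a (i - t) - a (i - t + d))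
            + ∑ i ∈ Finset.Icc (1 : ℤ) r, (a (i + (-t + d)) - a (i + (-t + d) + 1)) := by
        rw [← Finset.sum_add_distrib]
        refine Finset.sum_congr rfl fun i _ => ?_
        rw [show i + (-(t : ℤ) + d) = i - t + d by ring]
        push_cast
        rw [show i - (t : ℤ) + ((d : ℤ) + 1) = i - t + d + 1 by ring]
        ring
      rw [this]; push_cast; linarith
  have := main (s + t)
  push_cast at this
  refine le_trans (le_of_eq (Finset.sum_congr rfl fun i _ => ?_)) this
  rw [show i - (t : ℤ) + (s + t) = i + s by ring]

/-- The two windows are placed so that the drops add up to exactly `m` times the total drop. -/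
theorem sum_gap_le {m : ℕ} (hm : 0 < m) {a : ℤ → ℝ} {r : ℕ} (h1 : ∀ i, a i ≤ a 1)
    (hr : ∀ i, a r ≤ a i) :
    ∑ i ∈ Finset.Icc (1 : ℤ) r, gap m a i ≤ m * (a 1 - a r) := by
  have hm' : (0 : ℝ) < m := by exact_mod_cast hm
  simp only [gap_eq_sum hm]
  rw [← Finset.sum_div, div_le_iff₀ (by positivity), Finset.sum_comm]
  have g1 : ∀ k : ℕ, ∑ s ∈ Finset.range k, (s : ℝ) = k * (k - 1) / 2 := by
    intro k
    induction k with
    | zero => simp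
    | succ k ih => rw [Finset.sum_range_succ, ih]; push_cast; ring
  calc ∑ s ∈ Finset.range m, ∑ i ∈ Finset.Icc (1 : ℤ) r,
        ∑ t ∈ Finset.range (m + 2), (a (i - t) - a (i + s))
      ≤ ∑ s ∈ Finset.range m, ∑ t ∈ Finset.range (m + 2), ((s : ℝ) + t) * (a 1 - a r) := by
        refine Finset.sum_le_sum fun s _ => ?_
        rw [Finset.sum_comm]
        exact Finset.sum_le_sum fun t _ => sum_shift_sub_le h1 hr s t
    _ = (∑ s ∈ Finset.range m, ∑ t ∈ Finset.range (m + 2), ((s : ℝ) + t)) * (a 1 - a r) := by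
        simp only [Finset.sum_mul]
    _ = m * (a 1 - a r) * (m * (m + 2)) := by
        simp only [Finset.sum_add_distrib, Finset.sum_const, Finset.card_range, nsmul_eq_mul, g1,
          ← Finset.mul_sum]
        push_cast; ring
    _ ≤ _ := le_rfl

theorem upAvg_le {m : ℕ} (hm : 0 < m) {a : ℤ → ℝ} (ha : Antitone a) (i : ℤ) :
    upAvg m a i ≤ a i := by
  have hm' : (0 : ℝ) < m := by exact_mod_cast hm
  rw [upAvg, div_le_iff₀ hm']
  refine (Finset.sum_le_card_nsmul _ _ (a i) fun s _ => ha (by omega)).trans ?_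
  simp [mul_comm]

theorem le_upAvg {m : ℕ} (hm : 0 < m) {a : ℤ → ℝ} (ha : Antitone a) (i : ℤ) :
    a (i - 1 + m) ≤ upAvg m a i := by
  have hm' : (0 : ℝ) < m := by exact_mod_cast hm
  rw [upAvg, le_div_iff₀ hm']
  refine le_trans (by simp [mul_comm]) (Finset.card_nsmul_le_sum _ _ (a (i - 1 + m)) fun s hs => ?_)
  simp only [Finset.mem_range] at hs
  exact ha (by omega)

theorem le_loAvg {m : ℕ} {a : ℤ → ℝ} (ha : Antitone a) (i : ℤ) : a i ≤ loAvg m a i := by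
  rw [loAvg, le_div_iff₀ (by positivity)]
  refine le_trans (by simp [mul_comm]) (Finset.card_nsmul_le_sum _ _ (a i) fun s hs => ?_)
  exact ha (by omega)

theorem loAvg_le {m : ℕ} {a : ℤ → ℝ} (ha : Antitone a) (i : ℤ) :
    loAvg m a i ≤ a (i - 1 - m) := by
  rw [loAvg, div_le_iff₀ (by positivity)]
  refine (Finset.sum_le_card_nsmul _ _ (a (i - 1 - m)) fun s hs => ?_).trans ?_
  · simp only [Finset.mem_range] at hs
    exact ha (by omega)
  · simp [mul_comm]

theorem half_le_sub_upAvg {m : ℕ} (hm : 0 < m) {a : ℤ → ℝ} (ha : Antitone a) (i : ℤ) :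
    (a i - a (i + (m / 2 : ℕ))) / 2 ≤ a i - upAvg m a i := by
  have hm' : (0 : ℝ) < m := by exact_mod_cast hm
  have h0 : 0 ≤ a i - a (i + (m / 2 : ℕ)) := sub_nonneg.2 (ha (by omega))
  have key : (m - (m / 2 : ℕ) : ℕ) * (a i - a (i + (m / 2 : ℕ)))
      ≤ ∑ s ∈ Finset.range m, (a i - a (i + s)) := by
    calc ((m - (m / 2 : ℕ) : ℕ) : ℝ) * (a i - a (i + (m / 2 : ℕ)))
        = ∑ s ∈ Finset.Ico (m / 2) m, (a i - a (i + (m / 2 : ℕ))) := by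
            rw [Finset.sum_const, Nat.card_Ico, nsmul_eq_mul]
      _ ≤ ∑ s ∈ Finset.Ico (m / 2) m, (a i - a (i + s)) :=
          Finset.sum_le_sum fun s hs => by
            simp only [Finset.mem_Ico] at hs
            exact sub_le_sub_left (ha (by omega)) _
      _ ≤ _ := Finset.sum_le_sum_of_subset_of_nonneg
          (fun s hs => by simp only [Finset.mem_Ico, Finset.mem_range] at *; omega)
          fun s _ _ => sub_nonneg.2 (ha (by omega))
  have h2 : a i - upAvg m a i = (∑ s ∈ Finset.range m, (a i - a (i + s))) / m := by
    simp only [upAvg, Finset.sum_sub_distrib, Finset.sum_const, Finset.card_range, nsmul_eq_mul]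
    field_simp
  rw [h2, le_div_iff₀ hm']
  refine le_trans ?_ key
  have h3 : (m : ℝ) / 2 ≤ (m - (m / 2 : ℕ) : ℕ) := by
    rw [div_le_iff₀ (by norm_num)]; exact_mod_cast (by omega)
  nlinarith

theorem half_le_loAvg_sub {m : ℕ} {a : ℤ → ℝ} (ha : Antitone a) (i : ℤ) :
    (a (i - (m / 2 : ℕ)) - a i) / 2 ≤ loAvg m a i - a i := by
  have h0 : 0 ≤ a (i - (m / 2 : ℕ)) - a i := sub_nonneg.2 (ha (by omega))
  have key : (m + 2 - (m / 2 : ℕ) : ℕ) * (a (i - (m / 2 : ℕ)) - a i)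
      ≤ ∑ s ∈ Finset.range (m + 2), (a (i - s) - a i) := by
    calc ((m + 2 - (m / 2 : ℕ) : ℕ) : ℝ) * (a (i - (m / 2 : ℕ)) - a i)
        = ∑ s ∈ Finset.Ico (m / 2) (m + 2), (a (i - (m / 2 : ℕ)) - a i) := by
            rw [Finset.sum_const, Nat.card_Ico, nsmul_eq_mul]
      _ ≤ ∑ s ∈ Finset.Ico (m / 2) (m + 2), (a (i - s) - a i) :=
          Finset.sum_le_sum fun s hs => by
            simp only [Finset.mem_Ico] at hs
            exact sub_le_sub_right (ha (by omega)) _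
      _ ≤ _ := Finset.sum_le_sum_of_subset_of_nonneg
          (fun s hs => by simp only [Finset.mem_Ico, Finset.mem_range] at *; omega)
          fun s _ _ => sub_nonneg.2 (ha (by omega))
  have h2 : loAvg m a i - a i = (∑ s ∈ Finset.range (m + 2), (a (i - s) - a i)) / (m + 2) := by
    simp only [loAvg, Finset.sum_sub_distrib, Finset.sum_const, Finset.card_range, nsmul_eq_mul]
    push_cast
    field_simp
  rw [h2, le_div_iff₀ (by positivity)]
  refine le_trans ?_ key
  have h3 : ((m : ℝ) + 2) / 2 ≤ (m + 2 - (m / 2 : ℕ) : ℕ) := by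
    rw [div_le_iff₀ (by norm_num)]; exact_mod_cast (by omega)
  nlinarith

/-- Only the first `d + 1` terms of the upper window are kept. -/
theorem mul_le_upAvg {m : ℕ} {a : ℤ → ℝ} (ha : Antitone a) (h0 : ∀ i, 0 ≤ a i) (i : ℤ) {d : ℕ}
    (hd : d < m) : ((d : ℝ) + 1) / m * a (i + d) ≤ upAvg m a i := by
  rw [upAvg, div_mul_eq_mul_div]
  refine div_le_div_of_nonneg_right ?_ (by positivity)
  calc ((d : ℝ) + 1) * a (i + d) = ∑ s ∈ Finset.range (d + 1), a (i + d) := by simp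
    _ ≤ ∑ s ∈ Finset.range (d + 1), a (i + s) := Finset.sum_le_sum fun s hs => by
        simp only [Finset.mem_range] at hs
        exact ha (by omega)
    _ ≤ _ := Finset.sum_le_sum_of_subset_of_nonneg (Finset.range_mono (by omega))
        fun s _ _ => h0 _

end

noncomputable section

/-! ### Convergence to zero in mean square along a sequence of samples -/

/-- The random variables `Y k`, functions of uniform samples of sizes `n k`, are measurable and
tend to `0` in mean square. -/
def L2Null (n : ℕ → ℕ) (Y : (k : ℕ) → (Fin (n k) → ℝ) → ℝ) : Prop :=
  (∀ k, Measurable (Y k)) ∧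
    Tendsto (fun k => eLpNorm (Y k) 2 (uniformSample (n k))) atTop (𝓝 0)

section L2Null

variable {n : ℕ → ℕ} {Y Z : (k : ℕ) → (Fin (n k) → ℝ) → ℝ}

theorem L2Null.add (hY : L2Null n Y) (hZ : L2Null n Z) :
    L2Null n (fun k v => Y k v + Z k v) := by
  refine ⟨fun k => (hY.1 k).add (hZ.1 k), ?_⟩
  refine tendsto_of_tendsto_of_tendsto_of_le_of_le tendsto_const_nhds
    (by simpa using hY.2.add hZ.2) (fun _ => zero_le) fun k => ?_
  exact eLpNorm_add_le (hY.1 k).aestronglyMeasurable (hZ.1 k).aestronglyMeasurable (by norm_num)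

theorem L2Null.const_mul (hY : L2Null n Y) (c : ℝ) : L2Null n (fun k v => c * Y k v) := by
  refine ⟨fun k => (hY.1 k).const_mul c, ?_⟩
  have : ∀ k, eLpNorm (fun v => c * Y k v) 2 (uniformSample (n k))
      = ‖c‖ₑ * eLpNorm (Y k) 2 (uniformSample (n k)) := fun k => eLpNorm_const_smul c (Y k) 2 _
  simp only [this]
  simpa using ENNReal.Tendsto.const_mul hY.2 (Or.inr enorm_ne_top)

theorem L2Null.abs (hY : L2Null n Y) : L2Null n (fun k v => |Y k v|) := by
  refine ⟨fun k => (hY.1 k).abs, ?_⟩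
  convert hY.2 using 2 with k
  exact eLpNorm_norm (Y k)

theorem L2Null.mono (hY : L2Null n Y) (hZ : ∀ k, Measurable (Z k))
    (h : ∀ᶠ k in atTop, ∀ᵐ v ∂(uniformSample (n k)), |Z k v| ≤ |Y k v|) : L2Null n Z := by
  refine ⟨hZ, ?_⟩
  refine tendsto_of_tendsto_of_tendsto_of_le_of_le' tendsto_const_nhds hY.2
    (Eventually.of_forall fun _ => zero_le) ?_
  filter_upwards [h] with k hk
  exact eLpNorm_mono_ae hk

theorem L2Null.of_eLpNorm_le {a : ℕ → ℝ} (hZ : ∀ k, Measurable (Z k))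
    (ha : Tendsto a atTop (𝓝 0))
    (h : ∀ᶠ k in atTop, eLpNorm (Z k) 2 (uniformSample (n k)) ≤ ENNReal.ofReal (a k)) :
    L2Null n Z := by
  refine ⟨hZ, ?_⟩
  refine tendsto_of_tendsto_of_tendsto_of_le_of_le' tendsto_const_nhds ?_
    (Eventually.of_forall fun _ => zero_le) h
  simpa using ENNReal.tendsto_ofReal ha

theorem L2Null.of_const {a : ℕ → ℝ} (ha : Tendsto a atTop (𝓝 0)) :
    L2Null n (fun k _ => a k) := by
  refine L2Null.of_eLpNorm_le (a := fun k => |a k|) (fun k => measurable_const)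
    (by simpa using ha.abs) (Eventually.of_forall fun k => ?_)
  rw [eLpNorm_const _ (by norm_num) (IsProbabilityMeasure.ne_zero _)]
  simp [Real.enorm_eq_ofReal_abs]

/-- It is enough to dominate up to errors that are small in mean square. -/
theorem L2Null.of_approx (hY : ∀ k, Measurable (Y k))
    (h : ∀ ε > 0, ∃ Z T : (k : ℕ) → (Fin (n k) → ℝ) → ℝ, L2Null n Z ∧ (∀ k, Measurable (T k)) ∧
      (∀ᶠ k in atTop, eLpNorm (T k) 2 (uniformSample (n k)) ≤ ENNReal.ofReal ε) ∧
      ∀ᶠ k in atTop, ∀ᵐ v ∂(uniformSample (n k)), |Y k v| ≤ |Z k v| + |T k v|) :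
    L2Null n Y := by
  refine ⟨hY, ?_⟩
  rw [ENNReal.tendsto_nhds_zero]
  intro ε hε
  obtain ⟨δ, hδ0, hδ⟩ : ∃ δ : ℝ, 0 < δ ∧ ENNReal.ofReal δ ≤ ε / 2 := by
    rcases eq_or_ne ε ⊤ with rfl | h
    · exact ⟨1, one_pos, by rw [ENNReal.top_div_of_ne_top (by norm_num)]; exact le_top⟩
    · refine ⟨(ε / 2).toReal, ENNReal.toReal_pos (by simpa using hε.ne') ?_, ?_⟩
      · exact (ENNReal.div_lt_top h (by norm_num)).ne
      · rw [ENNReal.ofReal_toReal (ENNReal.div_lt_top h (by norm_num)).ne]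
  obtain ⟨Z, T, hZ, hTm, hT, hb⟩ := h δ hδ0
  have hZ2 := (ENNReal.tendsto_nhds_zero.1 hZ.2) (ε / 2) (ENNReal.half_pos hε.ne')
  filter_upwards [hT, hb, hZ2] with k hTk hbk hZk
  calc eLpNorm (Y k) 2 (uniformSample (n k))
      ≤ eLpNorm ((fun v => |Z k v|) + fun v => |T k v|) 2 (uniformSample (n k)) :=
        eLpNorm_mono_ae_real hbk
    _ ≤ eLpNorm (fun v => |Z k v|) 2 (uniformSample (n k))
        + eLpNorm (fun v => |T k v|) 2 (uniformSample (n k)) :=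
        eLpNorm_add_le (hZ.1 k).abs.aestronglyMeasurable (hTm k).abs.aestronglyMeasurable
          (by norm_num)
    _ = eLpNorm (Z k) 2 (uniformSample (n k)) + eLpNorm (T k) 2 (uniformSample (n k)) := by
        have e1 := eLpNorm_norm (p := 2) (μ := uniformSample (n k)) (Z k)
        have e2 := eLpNorm_norm (p := 2) (μ := uniformSample (n k)) (T k)
        simp only [Real.norm_eq_abs] at e1 e2
        rw [e1, e2]
    _ ≤ ε / 2 + ε / 2 := add_le_add hZk (hTk.trans hδ)
    _ = ε := ENNReal.add_halves ε

end L2Null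

theorem eLpNorm_two_le_of_lintegral_sq_le {α : Type*} [MeasurableSpace α] {ν : Measure α}
    {Y : α → ℝ} {c : ℝ} (hc : 0 ≤ c)
    (h : ∫⁻ x, ENNReal.ofReal (Y x ^ 2) ∂ν ≤ ENNReal.ofReal (c ^ 2)) :
    eLpNorm Y 2 ν ≤ ENNReal.ofReal c := by
  rw [eLpNorm_eq_lintegral_rpow_enorm_toReal (by norm_num) (by norm_num)]
  have h1 : ∀ x, ‖Y x‖ₑ ^ (ENNReal.toReal 2) = ENNReal.ofReal (Y x ^ 2) := fun x => by
    rw [Real.enorm_eq_ofReal_abs, ← sq_abs, ENNReal.ofReal_pow (abs_nonneg _)]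
    simp
  simp only [h1]
  refine (ENNReal.rpow_le_rpow h (by norm_num)).trans (le_of_eq ?_)
  rw [ENNReal.ofReal_rpow_of_nonneg (by positivity) (by norm_num)]
  simp only [ENNReal.toReal_ofNat]
  rw [← Real.sqrt_eq_rpow, Real.sqrt_sq hc]

theorem lintegral_sq_eq_eLpNorm {α : Type*} [MeasurableSpace α] {ν : Measure α} (Y : α → ℝ) :
    ∫⁻ x, ENNReal.ofReal (Y x ^ 2) ∂ν = eLpNorm Y 2 ν ^ 2 := by
  rw [eLpNorm_eq_lintegral_rpow_enorm_toReal (by norm_num) (by norm_num)]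
  have h1 : ∀ x, ‖Y x‖ₑ ^ (ENNReal.toReal 2) = ENNReal.ofReal (Y x ^ 2) := fun x => by
    rw [Real.enorm_eq_ofReal_abs, ← sq_abs, ENNReal.ofReal_pow (abs_nonneg _)]
    simp
  simp only [h1]
  rw [← ENNReal.rpow_natCast, ← ENNReal.rpow_mul]
  norm_num

/-! ### Uniform samples -/

theorem ae_uniformSample_mem (N : ℕ) :
    ∀ᵐ v ∂(uniformSample N), ∀ a, v a ∈ Set.Ioo (0 : ℝ) 1 := by
  rw [ae_all_iff]
  intro a
  exact (measurePreserving_eval (fun _ : Fin N => volume.restrict (Set.Icc (0 : ℝ) 1))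
    a).quasiMeasurePreserving.ae ae_mem_Ioo

theorem ae_uniformSample_injective (N : ℕ) :
    ∀ᵐ v ∂(uniformSample N), Function.Injective v := by
  have : ∀ᵐ v ∂(uniformSample N), ∀ a b : Fin N, a ≠ b → v a ≠ v b := by
    rw [ae_all_iff]; intro a
    rw [ae_all_iff]; intro b
    by_cases hab : a = b
    · simp [hab]
    have hi := iIndepFun_pi (μ := fun _ : Fin N => volume.restrict (Set.Icc (0 : ℝ) 1))
      (X := fun _ => id) (fun _ => aemeasurable_id)
    have h2 := hi.indepFun hab
    have hlaw : (uniformSample N).map (fun v => (v a, v b))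
        = (volume.restrict (Set.Icc (0 : ℝ) 1)).prod (volume.restrict (Set.Icc (0 : ℝ) 1)) := by
      have h3 := (indepFun_iff_map_prod_eq_prod_map_map (measurable_pi_apply a).aemeasurable
        (measurable_pi_apply b).aemeasurable).1 h2
      have ha := (measurePreserving_eval (fun _ : Fin N => volume.restrict (Set.Icc
          (0 : ℝ) 1)) a).map_eq
      have hb := (measurePreserving_eval (fun _ : Fin N => volume.restrict (Set.Icc
          (0 : ℝ) 1)) b).map_eq
      unfold Function.eval at ha hb
      rw [ha, hb] at h3
      exact h3
    have h4 : ∀ᵐ z ∂((volume.restrict (Set.Icc (0 : ℝ) 1)).prod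
        (volume.restrict (Set.Icc (0 : ℝ) 1))), z.1 ≠ z.2 := by
      have h5 : MeasurableSet {z : ℝ × ℝ | z.1 ≠ z.2} :=
        (measurableSet_eq_fun measurable_fst measurable_snd).compl
      refine (Measure.ae_prod_iff_ae_ae (p := fun z : ℝ × ℝ => z.1 ≠ z.2) h5).2 ?_
      exact Eventually.of_forall fun x => by
        have : ∀ᵐ y ∂(volume.restrict (Set.Icc (0 : ℝ) 1)), y ≠ x :=
          compl_mem_ae_iff.2 (measure_singleton x)
        filter_upwards [this] with y hy using hy.symm
    rw [← hlaw] at h4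
    filter_upwards [ae_of_ae_map (by fun_prop) h4] with v hv _ using hv
  filter_upwards [this] with v hv a b hab
  by_contra h
  exact hv a b h hab

theorem eLpNorm_avg_abs_le {N : ℕ} (hN : 0 < N) {ψ : ℝ → ℝ} (hψ : Measurable ψ) :
    eLpNorm (fun v : Fin N → ℝ => (1 / (N : ℝ)) * ∑ a, |ψ (v a)|) 2 (uniformSample N)
      ≤ eLpNorm ψ 2 (volume.restrict (Set.Icc (0 : ℝ) 1)) := by
  have h1 : ∀ a : Fin N, eLpNorm (fun v : Fin N → ℝ => |ψ (v a)|) 2 (uniformSample N)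
      = eLpNorm ψ 2 (volume.restrict (Set.Icc (0 : ℝ) 1)) := fun a => by
    rw [← eLpNorm_norm ψ, ← eLpNorm_comp_measurePreserving (hψ.norm.aestronglyMeasurable)
      (measurePreserving_eval (fun _ : Fin N => volume.restrict (Set.Icc (0 : ℝ) 1)) a)]
    rfl
  have h2 : eLpNorm (fun v : Fin N → ℝ => (1 / (N : ℝ)) * ∑ a, |ψ (v a)|) 2 (uniformSample N)
      = ‖(1 / (N : ℝ))‖ₑ * eLpNorm (∑ a, fun v : Fin N → ℝ => |ψ (v a)|) 2 (uniformSample N) := by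
    rw [← eLpNorm_const_smul]
    congr 1; ext v; simp
  rw [h2]
  calc _ ≤ ‖(1 / (N : ℝ))‖ₑ * ∑ a : Fin N, eLpNorm (fun v : Fin N → ℝ => |ψ (v a)|) 2
        (uniformSample N) := by
        gcongr
        exact eLpNorm_sum_le (fun a _ => (by fun_prop : Measurable _).aestronglyMeasurable)
          (by norm_num)
    _ = eLpNorm ψ 2 (volume.restrict (Set.Icc (0 : ℝ) 1)) := by
        simp only [h1, Finset.sum_const, Finset.card_univ, Fintype.card_fin, nsmul_eq_mul]
        rw [← mul_assoc, Real.enorm_eq_ofReal (by positivity), ← ENNReal.ofReal_natCast,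
          ← ENNReal.ofReal_mul (by positivity), one_div_mul_cancel (by positivity)]
        simp

/-- The law of large numbers with a rate, for bounded functions of a uniform sample. -/
theorem eLpNorm_avg_sub_integral_le {N : ℕ} (hN : 0 < N) {g : ℝ → ℝ} (hg : Measurable g) {M : ℝ}
    (hM : ∀ x, |g x| ≤ M) :
    eLpNorm (fun v : Fin N → ℝ => (1 / (N : ℝ)) * ∑ a, g (v a) - ∫ x in Set.Icc (0 : ℝ) 1, g x) 2
      (uniformSample N) ≤ ENNReal.ofReal (M / √N) := by
  have hM0 : 0 ≤ M := (abs_nonneg _).trans (hM 0)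
  have hN' : (0 : ℝ) < N := by exact_mod_cast hN
  refine eLpNorm_two_le_of_lintegral_sq_le (by positivity) ?_
  set lam := volume.restrict (Set.Icc (0 : ℝ) 1)
  have hgL : MemLp g 2 lam := MemLp.of_bound hg.aestronglyMeasurable M (Eventually.of_forall hM)
  have hS : MemLp (∑ a : Fin N, fun v : Fin N → ℝ => g (v a)) 2 (uniformSample N) :=
    memLp_finsetSum' _ fun a _ => hgL.comp_measurePreserving
      (measurePreserving_eval (fun _ : Fin N => lam) a)
  have hint : ∫ v, (∑ a : Fin N, fun v : Fin N → ℝ => g (v a)) v ∂(uniformSample N)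
      = N * ∫ x, g x ∂lam := by
    simp only [Finset.sum_apply]
    rw [integral_finsetSum]
    · have : ∀ a : Fin N, ∫ v, g (v a) ∂(uniformSample N) = ∫ x, g x ∂lam := fun a => by
        exact integral_comp_eval (μ := fun _ : Fin N => lam) hg.aestronglyMeasurable
      simp [this]
    · intro a _
      exact ((hgL.comp_measurePreserving
        (measurePreserving_eval (fun _ : Fin N => lam) a)).integrable (by norm_num))
  have hvar : variance (∑ a : Fin N, fun v : Fin N → ℝ => g (v a)) (uniformSample N)
      ≤ N * M ^ 2 := by
    unfold uniformSample
    rw [variance_sum_pi (fun _ => hgL)]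
    have : variance g lam ≤ M ^ 2 := by
      refine (variance_le_expectation_sq hg.aestronglyMeasurable).trans ?_
      calc ∫ x, (g ^ 2) x ∂lam ≤ ∫ x, M ^ 2 ∂lam := by
            refine integral_mono hgL.integrable_sq (integrable_const _) fun x => ?_
            exact sq_le_sq' (neg_le_of_abs_le (hM x)) (le_of_abs_le (hM x))
        _ = M ^ 2 := by simp [lam]
    simpa using mul_le_mul_of_nonneg_left this hN'.le
  calc ∫⁻ v, ENNReal.ofReal (((1 / (N : ℝ)) * ∑ a, g (v a) - ∫ x, g x ∂lam) ^ 2) ∂uniformSample N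
      = ∫⁻ v, ENNReal.ofReal ((1 / (N : ℝ)) ^ 2) * ENNReal.ofReal
          (((∑ a : Fin N, fun v : Fin N → ℝ => g (v a)) v
            - ∫ v, (∑ a : Fin N, fun v : Fin N → ℝ => g (v a)) v ∂(uniformSample N)) ^ 2)
            ∂uniformSample N := by
        refine lintegral_congr fun v => ?_
        rw [← ENNReal.ofReal_mul (by positivity), hint]
        congr 1
        simp only [Finset.sum_apply]
        field_simp
    _ = ENNReal.ofReal ((1 / (N : ℝ)) ^ 2) * evariance (∑ a : Fin N, fun v : Fin N → ℝ => g (v a))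
          (uniformSample N) := by
        rw [lintegral_const_mul' _ _ (by simp), evariance_eq_lintegral_ofReal]
    _ = ENNReal.ofReal ((1 / (N : ℝ)) ^ 2 *
          variance (∑ a : Fin N, fun v : Fin N → ℝ => g (v a)) (uniformSample N)) := by
        rw [ENNReal.ofReal_mul (by positivity), hS.ofReal_variance_eq]
    _ ≤ _ := by
        refine ENNReal.ofReal_le_ofReal ?_
        rw [div_pow M, Real.sq_sqrt hN'.le]
        calc (1 / (N : ℝ)) ^ 2 * _ ≤ (1 / (N : ℝ)) ^ 2 * (N * M ^ 2) := by gcongr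
          _ = M ^ 2 / N := by field_simp

end

noncomputable section

/-! ### Averages over order statistics -/

/-- Concentration of order statistics, with a free parameter `δ`. -/
theorem eLpNorm_orderStat_sub_le {N : ℕ} {r : ℕ} (h1 : 1 ≤ r) (hr : r ≤ N) {δ : ℝ} (hδ : 0 < δ) :
    eLpNorm (fun v : Fin N → ℝ => orderStat v r - (r : ℝ) / N) 2 (uniformSample N)
      ≤ ENNReal.ofReal (δ + (δ⁻¹ * (1 / √N) + δ⁻¹ * (1 / √N))) := by
  have hN : 0 < N := by omega
  have hN' : (0 : ℝ) < N := by exact_mod_cast hN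
  set p : ℝ := (r : ℝ) / N with hp
  have hp0 : 0 ≤ p := by positivity
  have hp1 : p ≤ 1 := by rw [hp, div_le_one hN']; exact_mod_cast hr
  let g : ℝ → ℝ → ℝ := fun t => (Set.Iic t).indicator fun _ => 1
  have hgm : ∀ t, Measurable (g t) := fun t => measurable_const.indicator measurableSet_Iic
  have hg1 : ∀ t x, |g t x| ≤ 1 := fun t x => by
    by_cases h : x ∈ Set.Iic t <;> simp [g, h]
  let E : ℝ → (Fin N → ℝ) → ℝ := fun t v =>
    (1 / (N : ℝ)) * ∑ a, g t (v a) - ∫ x in Set.Icc (0 : ℝ) 1, g t x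
  have hEm : ∀ t, Measurable (E t) := fun t => by
    have := hgm t
    fun_prop
  have hE : ∀ t, eLpNorm (E t) 2 (uniformSample N) ≤ ENNReal.ofReal (1 / √N) := fun t =>
    eLpNorm_avg_sub_integral_le hN (hgm t) (hg1 t)
  have hint : ∀ t ∈ Set.Icc (0 : ℝ) 1, ∫ x in Set.Icc (0 : ℝ) 1, g t x = t := fun t ht => by
    simp only [g]
    rw [integral_indicator measurableSet_Iic, Measure.restrict_restrict measurableSet_Iic]
    have : Set.Iic t ∩ Set.Icc (0 : ℝ) 1 = Set.Icc 0 t := by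
      ext x; simp only [Set.mem_inter_iff, Set.mem_Iic, Set.mem_Icc]
      exact ⟨fun h => ⟨h.2.1, h.1⟩, fun h => ⟨h.2, h.1, h.2.trans ht.2⟩⟩
    simp [this, ht.1]
  have hcount : ∀ t (v : Fin N → ℝ), ∑ a, g t (v a)
      = ((Finset.univ.filter fun a => v a ≤ t).card : ℝ) := fun t v => by
    simp [g, Set.indicator_apply, Finset.sum_boole]
  have hb : ∀ᵐ v ∂(uniformSample N), |orderStat v r - p|
      ≤ δ + (δ⁻¹ * |E (p + δ) v| + δ⁻¹ * |E (p - δ) v|) := by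
    filter_upwards [ae_uniformSample_mem N] with v hv
    obtain ⟨a, ha⟩ := orderStat_mem v h1 hr
    have hs := hv a
    rw [← ha] at hs
    have hle : |orderStat v r - p| ≤ 1 := by
      rw [abs_le]; constructor <;> linarith [hs.1, hs.2]
    have n1 : 0 ≤ δ⁻¹ * |E (p + δ) v| := by positivity
    have n2 : 0 ≤ δ⁻¹ * |E (p - δ) v| := by positivity
    by_cases hc : |orderStat v r - p| ≤ δ
    · linarith
    rw [abs_le, not_and_or, not_le, not_le] at hc
    rcases hc with hc | hc
    · have h3 : (1 : ℝ) ≤ δ⁻¹ * |E (p - δ) v| := by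
        rw [le_inv_mul_iff₀ hδ, mul_one]
        refine le_trans ?_ (le_abs_self _)
        have h4 := (orderStat_le_iff v h1 hr (p - δ)).1 (by linarith)
        simp only [E]
        rw [hint _ ⟨by linarith [hs.1], by linarith⟩, hcount]
        have h5 : p ≤ 1 / (N : ℝ) * ((Finset.univ.filter fun a => v a ≤ p - δ).card : ℝ) := by
          rw [one_div_mul_eq_div]
          exact div_le_div_of_nonneg_right (by exact_mod_cast h4) hN'.le
        linarith
      linarith
    · have h3 : (1 : ℝ) ≤ δ⁻¹ * |E (p + δ) v| := by
        rw [le_inv_mul_iff₀ hδ, mul_one]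
        refine le_trans ?_ (neg_le_abs _)
        have h4 : ¬ orderStat v r ≤ p + δ := by linarith
        rw [orderStat_le_iff v h1 hr, not_le] at h4
        simp only [E]
        rw [hint _ ⟨by linarith, by linarith [hs.2]⟩, hcount]
        have h5 : 1 / (N : ℝ) * ((Finset.univ.filter fun a => v a ≤ p + δ).card : ℝ) ≤ p := by
          rw [one_div_mul_eq_div]
          exact div_le_div_of_nonneg_right (by exact_mod_cast h4.le) hN'.le
        linarith
      linarith
  have hm : ∀ t, eLpNorm (fun v => δ⁻¹ * |E t v|) 2 (uniformSample N)
      ≤ ENNReal.ofReal (δ⁻¹ * (1 / √N)) := fun t => by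
    have e1 := eLpNorm_norm (p := 2) (μ := uniformSample N) (E t)
    simp only [Real.norm_eq_abs] at e1
    have e2 : eLpNorm (fun v => δ⁻¹ * |E t v|) 2 (uniformSample N)
      = ‖δ⁻¹‖ₑ * eLpNorm (fun v => |E t v|) 2 (uniformSample N) :=
        eLpNorm_const_smul δ⁻¹ (fun v => |E t v|) 2 _
    rw [e2, e1, Real.enorm_eq_ofReal (by positivity), ENNReal.ofReal_mul (by positivity)]
    gcongr
    exact hE t
  calc _ ≤ eLpNorm ((fun _ => δ) + ((fun v => δ⁻¹ * |E (p + δ) v|) + fun v => δ⁻¹ * |E (p - δ) v|))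
          2 (uniformSample N) := eLpNorm_mono_ae_real hb
    _ ≤ eLpNorm (fun _ => δ) 2 (uniformSample N)
        + (eLpNorm (fun v => δ⁻¹ * |E (p + δ) v|) 2 (uniformSample N)
          + eLpNorm (fun v => δ⁻¹ * |E (p - δ) v|) 2 (uniformSample N)) := by
        refine (eLpNorm_add_le (by fun_prop) ?_ (by norm_num)).trans
          (add_le_add le_rfl (eLpNorm_add_le ?_ ?_ (by norm_num)))
        · exact (((hEm _).abs.const_mul _).add ((hEm _).abs.const_mul _)).aestronglyMeasurable
        · exact ((hEm _).abs.const_mul _).aestronglyMeasurable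
        · exact ((hEm _).abs.const_mul _).aestronglyMeasurable
    _ ≤ ENNReal.ofReal δ + (ENNReal.ofReal (δ⁻¹ * (1 / √N)) + ENNReal.ofReal (δ⁻¹ * (1 / √N))) := by
        refine add_le_add ?_ (add_le_add (hm _) (hm _))
        rw [eLpNorm_const _ (by norm_num) (IsProbabilityMeasure.ne_zero _)]
        simp [Real.enorm_eq_ofReal hδ.le]
    _ = _ := by
        rw [ENNReal.ofReal_add hδ.le (by positivity), ENNReal.ofReal_add (by positivity)
          (by positivity)]

theorem tendsto_one_div_sqrt {n : ℕ → ℕ} (hn : Tendsto n atTop atTop) :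
    Tendsto (fun k => 1 / √(n k : ℝ)) atTop (𝓝 0) := by
  have : Tendsto (fun k => √(n k : ℝ)) atTop atTop :=
    Real.tendsto_sqrt_atTop.comp (tendsto_natCast_atTop_atTop.comp hn)
  simp only [one_div]
  exact this.inv_tendsto_atTop

theorem l2Null_orderStat_sub {n r : ℕ → ℕ} (hn : Tendsto n atTop atTop) (h1 : ∀ k, 1 ≤ r k)
    (hr : ∀ k, r k ≤ n k) :
    L2Null n fun k v => orderStat v (r k) - (r k : ℝ) / n k := by
  have hm : ∀ k, Measurable fun v : Fin (n k) → ℝ => orderStat v (r k) - (r k : ℝ) / n k :=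
    fun k => (measurable_orderStat _).sub_const _
  refine ⟨hm, ?_⟩
  rw [ENNReal.tendsto_nhds_zero]
  intro ε hε
  obtain ⟨δ, hδ0, hδ⟩ : ∃ δ : ℝ, 0 < δ ∧ ENNReal.ofReal (δ + δ) ≤ ε := by
    rcases eq_or_ne ε ⊤ with rfl | h
    · exact ⟨1, one_pos, le_top⟩
    · refine ⟨ε.toReal / 2, half_pos (ENNReal.toReal_pos hε.ne' h), ?_⟩
      rw [add_halves, ENNReal.ofReal_toReal h]
  have ht : Tendsto (fun k => δ⁻¹ * (1 / √(n k : ℝ)) + δ⁻¹ * (1 / √(n k : ℝ))) atTop (𝓝 0) := by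
    simpa using ((tendsto_one_div_sqrt hn).const_mul δ⁻¹).add
      ((tendsto_one_div_sqrt hn).const_mul δ⁻¹)
  filter_upwards [ht.eventually (gt_mem_nhds hδ0)] with k hk
  refine (eLpNorm_orderStat_sub_le (h1 k) (hr k) hδ0).trans (le_trans ?_ hδ)
  exact ENNReal.ofReal_le_ofReal (by linarith)

/-- Summing over the ranks at most `r` or over the sample points at most `p` makes a difference of
at most `M` for each sample point by which the two ranges differ. -/
theorem abs_sum_censoredStat_sub_le {N : ℕ} (v : Fin N → ℝ) {r : ℕ} {ψ : ℝ → ℝ}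
    {M : ℝ} (hM : ∀ x, |ψ x| ≤ M) (p : ℝ) :
    |∑ i ∈ Finset.Icc (1 : ℤ) r, ψ (censoredStat v r i) - ∑ a, (Set.Iic p).indicator ψ (v a)|
      ≤ M * |∑ a, (Set.Iic p).indicator (fun _ => (1 : ℝ)) (v a) - r| := by
  have hM0 : 0 ≤ M := (abs_nonneg _).trans (hM 0)
  set K := (Finset.univ.filter fun a => v a ≤ p).card with hK
  have hKN : K ≤ N := by simpa using Finset.card_le_univ (Finset.univ.filter fun a => v a ≤ p)
  have e1 : ∑ i ∈ Finset.Icc (1 : ℤ) r, ψ (censoredStat v r i)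
      = ∑ j ∈ Finset.Icc 1 r, ψ (orderStat v j) := by
    refine Finset.sum_nbij' (fun i => i.toNat) (fun j => (j : ℤ)) ?_ ?_ ?_ ?_ ?_
    · intro i hi; simp at hi ⊢; omega
    · intro i hi; simp at hi ⊢; omega
    · intro i hi; simp at hi ⊢; omega
    · intro i hi; simp
    · intro i hi
      simp only [Finset.mem_Icc] at hi
      rw [censoredStat_of_mem v hi.1 hi.2]
  have e2 : ∑ a, (Set.Iic p).indicator ψ (v a) = ∑ j ∈ Finset.Icc 1 K, ψ (orderStat v j) := by
    rw [← sum_orderStat v, ← Finset.sum_subset (Finset.Icc_subset_Icc le_rfl hKN)]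
    · refine Finset.sum_congr rfl fun j hj => ?_
      simp only [Finset.mem_Icc] at hj
      rw [Set.indicator_of_mem]
      exact (orderStat_le_iff v hj.1 (by omega) p).2 hj.2
    · intro j hj hj'
      simp only [Finset.mem_Icc] at hj hj'
      rw [Set.indicator_of_notMem]
      simp only [Set.mem_Iic, orderStat_le_iff v hj.1 hj.2 p]
      omega
  have e3 : ∑ a, (Set.Iic p).indicator (fun _ => (1 : ℝ)) (v a) = K := by
    simp [Set.indicator_apply, Finset.sum_boole, hK]
  rw [e1, e2, e3]
  have key : ∀ b c : ℕ, b ≤ c → |∑ j ∈ Finset.Icc 1 c, ψ (orderStat v j)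
      - ∑ j ∈ Finset.Icc 1 b, ψ (orderStat v j)| ≤ M * ((c : ℝ) - b) := by
    intro b c hbc
    have hd : Finset.Icc 1 c = Finset.Icc 1 b ∪ Finset.Ioc b c := by ext; simp; omega
    have hdis : Disjoint (Finset.Icc 1 b) (Finset.Ioc b c) := by
      rw [Finset.disjoint_left]; intro x; simp; omega
    rw [hd, Finset.sum_union hdis, add_sub_cancel_left]
    refine (Finset.abs_sum_le_sum_abs _ _).trans ?_
    refine (Finset.sum_le_card_nsmul _ _ M fun j _ => hM _).trans (le_of_eq ?_)
    simp [Nat.cast_sub hbc, mul_comm]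
  rcases le_total K r with h | h
  · have := key K r h
    rw [abs_sub_comm (K : ℝ), abs_of_nonneg (a := (r : ℝ) - K) (by
      have : (K : ℝ) ≤ r := by exact_mod_cast h
      linarith)]
    exact this
  · have := key r K h
    rw [abs_of_nonneg (a := (K : ℝ) - r) (by
      have : (r : ℝ) ≤ K := by exact_mod_cast h
      linarith), abs_sub_comm]
    exact this

theorem measurable_avg_censoredStat {N : ℕ} (r : ℕ) (I : Finset ℤ) {ψ : ℝ → ℝ}
    (hψ : Measurable ψ) :
    Measurable fun v : Fin N → ℝ => (1 / (N : ℝ)) * ∑ i ∈ I, ψ (censoredStat v r i) :=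
  (Finset.measurable_sum _ fun i _ => hψ.comp (measurable_censoredStat r i)).const_mul _

/-- A tail of a square integrable function that is small in mean square. -/
theorem exists_truncation {ψ : ℝ → ℝ} (hψ : Measurable ψ)
    (hψ2 : MemLp ψ 2 (volume.restrict (Set.Icc (0 : ℝ) 1))) {ε : ℝ} (hε : 0 < ε) :
    ∃ (M : ℝ) (b τ : ℝ → ℝ), Measurable b ∧ Measurable τ ∧ (∀ x, |b x| ≤ M) ∧
      (∀ x, ψ x = b x + τ x) ∧ MemLp τ 2 (volume.restrict (Set.Icc (0 : ℝ) 1)) ∧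
      eLpNorm τ 2 (volume.restrict (Set.Icc (0 : ℝ) 1)) ≤ ENNReal.ofReal ε := by
  obtain ⟨M, hM⟩ := hψ2.eLpNorm_indicator_norm_ge_le hψ.stronglyMeasurable hε
  set s : Set ℝ := {x | M ≤ ‖ψ x‖₊} with hs
  have hsm : MeasurableSet s := measurableSet_le measurable_const (by fun_prop)
  refine ⟨|M|, sᶜ.indicator ψ, s.indicator ψ, hψ.indicator hsm.compl, hψ.indicator hsm,
    fun x => ?_, fun x => ?_, hψ2.indicator hsm, hM⟩
  · by_cases hx : x ∈ s
    · simp [hx]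
    · simp only [Set.mem_compl_iff, hx, not_false_eq_true, Set.indicator_of_mem]
      simp only [hs, Set.mem_ofPred_eq, not_le, coe_nnnorm, Real.norm_eq_abs] at hx
      exact hx.le.trans (le_abs_self _)
  · rw [add_comm, Set.indicator_self_add_compl_apply]

/-- The law of large numbers for the sample points of rank at most `r`. -/
theorem l2Null_avg_sub_integral {n r : ℕ → ℕ} (hn : Tendsto n atTop atTop) (h1 : ∀ k, 1 ≤ r k)
    (hr : ∀ k, r k ≤ n k) {ψ : ℝ → ℝ} (hψ : Measurable ψ)
    (hψ2 : MemLp ψ 2 (volume.restrict (Set.Icc (0 : ℝ) 1))) :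
    L2Null n fun k v => (1 / (n k : ℝ)) * ∑ i ∈ Finset.Icc (1 : ℤ) (r k),
      ψ (censoredStat v (r k) i) - ∫ p in (0 : ℝ)..((r k : ℝ) / n k), ψ p := by
  have hn0 : ∀ k, (0 : ℝ) < n k := fun k => by exact_mod_cast (h1 k).trans (hr k)
  have hp0 : ∀ k, (0 : ℝ) ≤ (r k : ℝ) / n k := fun k => by positivity
  have hp1 : ∀ k, (r k : ℝ) / n k ≤ 1 := fun k => by
    rw [div_le_one (hn0 k)]; exact_mod_cast hr k
  have hii : ∀ k (g : ℝ → ℝ), ∫ x in Set.Icc (0 : ℝ) 1, (Set.Iic ((r k : ℝ) / n k)).indicator g x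
      = ∫ p in (0 : ℝ)..((r k : ℝ) / n k), g p := fun k g => by
    rw [integral_indicator measurableSet_Iic, Measure.restrict_restrict measurableSet_Iic,
      intervalIntegral.integral_of_le (hp0 k), ← integral_Icc_eq_integral_Ioc]
    congr 2
    ext x; simp only [Set.mem_inter_iff, Set.mem_Iic, Set.mem_Icc]
    exact ⟨fun h => ⟨h.2.1, h.1⟩, fun h => ⟨h.2, h.1, h.2.trans (hp1 k)⟩⟩
  refine L2Null.of_approx (fun k => (measurable_avg_censoredStat _ _ hψ).sub_const _)
    fun ε hε => ?_
  obtain ⟨M, b, τ, hb, hτ, hbM, hadd, hτ2, hτε⟩ := exists_truncation hψ hψ2 (half_pos hε)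
  have hM0 : 0 ≤ M := (abs_nonneg _).trans (hbM 0)
  have hlaw : ∀ g : ℝ → ℝ, Measurable g → ∀ K : ℝ, (∀ x, |g x| ≤ K) → L2Null n fun k v =>
      (1 / (n k : ℝ)) * ∑ a, (Set.Iic ((r k : ℝ) / n k)).indicator g (v a)
        - ∫ p in (0 : ℝ)..((r k : ℝ) / n k), g p := fun g hg K hK => by
    have hgi : ∀ k, Measurable ((Set.Iic ((r k : ℝ) / n k)).indicator g) := fun k =>
      hg.indicator measurableSet_Iic
    refine L2Null.of_eLpNorm_le (a := fun k => K * (1 / √(n k))) (fun k => ?_)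
      (by simpa using (tendsto_one_div_sqrt hn).const_mul K) (Eventually.of_forall fun k => ?_)
    · have := hgi k
      fun_prop
    · rw [← hii, mul_one_div]
      refine eLpNorm_avg_sub_integral_le ((h1 k).trans (hr k)) (hgi k) fun x => ?_
      by_cases hx : x ∈ Set.Iic ((r k : ℝ) / n k)
      · simpa [hx] using hK x
      · simpa [hx] using (abs_nonneg _).trans (hK 0)
  refine ⟨_, fun k v => (1 / (n k : ℝ)) * ∑ a, |τ (v a)| + ε / 2,
    (hlaw b hb M hbM).abs.add ((hlaw (fun _ => 1) measurable_const 1 (by simp)).abs.const_mul M),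
    fun k => by fun_prop, ?_, ?_⟩
  · refine Eventually.of_forall fun k => ?_
    refine (eLpNorm_add_le (Measurable.aestronglyMeasurable (by fun_prop)) (by fun_prop)
      (by norm_num)).trans ?_
    rw [← add_halves ε, ENNReal.ofReal_add (by positivity) (by positivity), add_halves]
    refine add_le_add ((eLpNorm_avg_abs_le ((h1 k).trans (hr k)) hτ).trans hτε) ?_
    rw [eLpNorm_const _ (by norm_num) (IsProbabilityMeasure.ne_zero _)]
    simp [Real.enorm_eq_ofReal (half_pos hε).le]
  · refine Eventually.of_forall fun k => Eventually.of_forall fun v => ?_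
    have hintτ : IntegrableOn τ (Set.Icc 0 1) := hτ2.integrable (by norm_num)
    have hintb : IntegrableOn b (Set.Icc 0 1) :=
      (MemLp.of_bound hb.aestronglyMeasurable M (Eventually.of_forall hbM) :
        MemLp b 2 (volume.restrict (Set.Icc (0 : ℝ) 1))).integrable (by norm_num)
    have hsub : Set.uIcc (0 : ℝ) ((r k : ℝ) / n k) ⊆ Set.Icc 0 1 := by
      rw [Set.uIcc_of_le (hp0 k)]; exact Set.Icc_subset_Icc le_rfl (hp1 k)
    have hiτ : IntervalIntegrable τ volume 0 ((r k : ℝ) / n k) :=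
      (hintτ.mono_set hsub).intervalIntegrable
    have hib : IntervalIntegrable b volume 0 ((r k : ℝ) / n k) :=
      (hintb.mono_set hsub).intervalIntegrable
    have i1 : |∫ p in (0 : ℝ)..((r k : ℝ) / n k), τ p| ≤ ε / 2 := by
      calc |∫ p in (0 : ℝ)..((r k : ℝ) / n k), τ p|
          ≤ ∫ p in (0 : ℝ)..((r k : ℝ) / n k), |τ p| :=
            intervalIntegral.abs_integral_le_integral_abs (hp0 k)
        _ ≤ ∫ p in Set.Icc (0 : ℝ) 1, |τ p| := by
            rw [intervalIntegral.integral_of_le (hp0 k), ← integral_Icc_eq_integral_Ioc]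
            exact setIntegral_mono_set hintτ.abs (Eventually.of_forall fun x => abs_nonneg _)
              (LE.le.eventuallyLE (Set.Icc_subset_Icc le_rfl (hp1 k)))
        _ ≤ ε / 2 := by
            have h3 : eLpNorm τ 1 (volume.restrict (Set.Icc (0 : ℝ) 1)) ≤ ENNReal.ofReal (ε / 2) :=
              (eLpNorm_le_eLpNorm_of_exponent_le (by norm_num) hτ.aestronglyMeasurable).trans hτε
            rw [eLpNorm_one_eq_lintegral_enorm, ← ofReal_integral_norm_eq_lintegral_enorm hintτ,
              ENNReal.ofReal_le_ofReal_iff (by positivity)] at h3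
            exact h3
    have i2 : ∫ p in (0 : ℝ)..((r k : ℝ) / n k), ψ p
        = (∫ p in (0 : ℝ)..((r k : ℝ) / n k), b p) + ∫ p in (0 : ℝ)..((r k : ℝ) / n k), τ p := by
      rw [← intervalIntegral.integral_add hib hiτ]
      exact intervalIntegral.integral_congr fun x _ => hadd x
    have i3 : ∑ i ∈ Finset.Icc (1 : ℤ) (r k), ψ (censoredStat v (r k) i)
        = ∑ i ∈ Finset.Icc (1 : ℤ) (r k), b (censoredStat v (r k) i)
          + ∑ i ∈ Finset.Icc (1 : ℤ) (r k), τ (censoredStat v (r k) i) := by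
      rw [← Finset.sum_add_distrib]
      exact Finset.sum_congr rfl fun i _ => hadd _
    have i4 : |∑ i ∈ Finset.Icc (1 : ℤ) (r k), τ (censoredStat v (r k) i)|
        ≤ ∑ a, |τ (v a)| :=
      (Finset.abs_sum_le_sum_abs _ _).trans
        (sum_censoredStat_le v (hr k) (ψ := fun x => |τ x|) fun _ => abs_nonneg _)
    have i5 := abs_sum_censoredStat_sub_le v (r := r k) hbM ((r k : ℝ) / n k)
    have i6 : ∫ p in (0 : ℝ)..((r k : ℝ) / n k), (1 : ℝ) = (r k : ℝ) / n k := by simp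
    set S1 := ∑ i ∈ Finset.Icc (1 : ℤ) (r k), b (censoredStat v (r k) i)
    set S2 := ∑ i ∈ Finset.Icc (1 : ℤ) (r k), τ (censoredStat v (r k) i)
    set S3 := ∑ a, (Set.Iic ((r k : ℝ) / n k)).indicator b (v a)
    set S4 := ∑ a, (Set.Iic ((r k : ℝ) / n k)).indicator (fun _ => (1 : ℝ)) (v a)
    set S5 := ∑ a, |τ (v a)|
    rw [i2, i3, i6]
    set B := ∫ p in (0 : ℝ)..((r k : ℝ) / n k), b p
    set C := ∫ p in (0 : ℝ)..((r k : ℝ) / n k), τ p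
    have j1 : |1 / (n k : ℝ) * (S1 - S3)| ≤ M * |1 / (n k : ℝ) * S4 - (r k : ℝ) / n k| := by
      have : 1 / (n k : ℝ) * S4 - (r k : ℝ) / n k = 1 / (n k : ℝ) * (S4 - r k) := by ring
      rw [this, abs_mul, abs_mul, mul_left_comm]
      gcongr
    have j2 : |1 / (n k : ℝ) * S2| ≤ 1 / (n k : ℝ) * S5 := by
      rw [abs_mul, abs_of_pos (one_div_pos.2 (hn0 k))]
      have := hn0 k
      gcongr
    have hS5 : 0 ≤ 1 / (n k : ℝ) * S5 := (abs_nonneg _).trans j2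
    rw [abs_of_nonneg (add_nonneg (abs_nonneg _) (mul_nonneg hM0 (abs_nonneg _))),
      abs_of_nonneg (add_nonneg hS5 (half_pos hε).le)]
    have : 1 / (n k : ℝ) * (S1 + S2) - (B + C)
      = (1 / (n k : ℝ) * S3 - B) + 1 / (n k : ℝ) * (S1 - S3) + 1 / (n k : ℝ) * S2 - C := by ring
    rw [this]
    calc _ ≤ |1 / (n k : ℝ) * S3 - B| + |1 / (n k : ℝ) * (S1 - S3)| + |1 / (n k : ℝ) * S2|
        + |C| := by
          refine (abs_sub _ _).trans (add_le_add ((abs_add_le _ _).trans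
            (add_le_add (abs_add_le _ _) le_rfl)) le_rfl)
      _ ≤ _ := by linarith

/-- Sums over few order statistics are negligible: the weights `e k i` have a negligible average
and each rank is used at most twice. -/
theorem l2Null_weighted {n r : ℕ → ℕ} (h1 : ∀ k, 1 ≤ r k) (hr : ∀ k, r k ≤ n k)
    {I : ℕ → Finset ℤ} {e : (k : ℕ) → ℤ → (Fin (n k) → ℝ) → ℝ} (hem : ∀ k i, Measurable (e k i))
    (he0 : ∀ k i v, 0 ≤ e k i v) (he1 : ∀ k i v, e k i v ≤ 1)
    (he : L2Null n fun k v => (1 / (n k : ℝ)) * ∑ i ∈ I k, e k i v)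
    {σ : ℕ → ℤ → ℤ} (hσ : ∀ k, ∀ i ∈ I k, σ k i ∈ Finset.Icc (1 : ℤ) (r k))
    (hσ2 : ∀ k, ∀ j ∈ Finset.Icc (1 : ℤ) (r k), ((I k).filter fun i => σ k i = j).card ≤ 2)
    {ψ : ℝ → ℝ} (hψ : Measurable ψ)
    (hψ2 : MemLp ψ 2 (volume.restrict (Set.Icc (0 : ℝ) 1))) :
    L2Null n fun k v => (1 / (n k : ℝ)) * ∑ i ∈ I k,
      e k i v * |ψ (censoredStat v (r k) (σ k i))| := by
  refine L2Null.of_approx (fun k => ?_) fun ε hε => ?_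
  · refine (Finset.measurable_sum _ fun i _ => ?_).const_mul _
    exact (hem k i).mul (hψ.comp (measurable_censoredStat _ _)).abs
  obtain ⟨M, b, τ, hb, hτ, hbM, hadd, hτ2, hτε⟩ := exists_truncation hψ hψ2 (half_pos hε)
  refine ⟨_, fun k v => 2 * ((1 / (n k : ℝ)) * ∑ a, |τ (v a)|), he.const_mul M,
    fun k => by fun_prop, Eventually.of_forall fun k => ?_,
    Eventually.of_forall fun k => Eventually.of_forall fun v => ?_⟩
  · have e2 : eLpNorm (fun v : Fin (n k) → ℝ => 2 * ((1 / (n k : ℝ)) * ∑ a, |τ (v a)|)) 2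
        (uniformSample (n k)) = ‖(2 : ℝ)‖ₑ * eLpNorm (fun v : Fin (n k) → ℝ =>
          (1 / (n k : ℝ)) * ∑ a, |τ (v a)|) 2 (uniformSample (n k)) :=
        eLpNorm_const_smul (2 : ℝ) (fun v : Fin (n k) → ℝ =>
          (1 / (n k : ℝ)) * ∑ a, |τ (v a)|) 2 _
    rw [e2, show ε = 2 * (ε / 2) by ring, ENNReal.ofReal_mul (by norm_num),
      Real.enorm_eq_ofReal (by norm_num)]
    gcongr
    exact (eLpNorm_avg_abs_le ((h1 k).trans (hr k)) hτ).trans hτε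
  · have hM0 : 0 ≤ M := (abs_nonneg _).trans (hbM 0)
    have s1 : ∑ i ∈ I k, |τ (censoredStat v (r k) (σ k i))| ≤ 2 * ∑ a, |τ (v a)| := by
      calc ∑ i ∈ I k, |τ (censoredStat v (r k) (σ k i))|
          = ∑ j ∈ Finset.Icc (1 : ℤ) (r k), ∑ i ∈ (I k).filter (fun i => σ k i = j),
              |τ (censoredStat v (r k) (σ k i))| :=
            (Finset.sum_fiberwise_of_maps_to (hσ k) _).symm
        _ ≤ ∑ j ∈ Finset.Icc (1 : ℤ) (r k), 2 * |τ (censoredStat v (r k) j)| := by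
            refine Finset.sum_le_sum fun j hj => ?_
            rw [Finset.sum_congr rfl (g := fun _ => |τ (censoredStat v (r k) j)|) fun i hi => by
              rw [(Finset.mem_filter.1 hi).2], Finset.sum_const, nsmul_eq_mul]
            have : ((((I k).filter fun i => σ k i = j).card : ℕ) : ℝ) ≤ 2 := by
              exact_mod_cast hσ2 k j hj
            gcongr
        _ = 2 * ∑ j ∈ Finset.Icc (1 : ℤ) (r k), |τ (censoredStat v (r k) j)| := by
            rw [Finset.mul_sum]
        _ ≤ 2 * ∑ a, |τ (v a)| := by
            gcongr
            exact sum_censoredStat_le v (hr k) (ψ := fun x => |τ x|) fun _ => abs_nonneg _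
    have s2 : ∑ i ∈ I k, e k i v * |ψ (censoredStat v (r k) (σ k i))|
        ≤ M * ∑ i ∈ I k, e k i v + 2 * ∑ a, |τ (v a)| := by
      calc _ ≤ ∑ i ∈ I k, (M * e k i v + |τ (censoredStat v (r k) (σ k i))|) := by
            refine Finset.sum_le_sum fun i _ => ?_
            set c := censoredStat v (r k) (σ k i)
            have a1 : |ψ c| ≤ M + |τ c| := by
              rw [hadd c]; exact (abs_add_le _ _).trans (by linarith [hbM c])
            have a2 := he0 k i v
            have a3 := he1 k i v
            have a4 := abs_nonneg (τ c)
            nlinarith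
        _ = M * ∑ i ∈ I k, e k i v + ∑ i ∈ I k, |τ (censoredStat v (r k) (σ k i))| := by
            rw [Finset.sum_add_distrib, Finset.mul_sum]
        _ ≤ _ := by linarith
    have hE0 : 0 ≤ ∑ i ∈ I k, e k i v := Finset.sum_nonneg fun i _ => he0 k i v
    have hn0 : (0 : ℝ) ≤ 1 / (n k : ℝ) := by positivity
    have s0 : 0 ≤ ∑ i ∈ I k, e k i v * |ψ (censoredStat v (r k) (σ k i))| :=
      Finset.sum_nonneg fun i _ => mul_nonneg (he0 k i v) (abs_nonneg _)
    rw [abs_of_nonneg (mul_nonneg hn0 s0), abs_of_nonneg (mul_nonneg hM0 (mul_nonneg hn0 hE0)),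
      abs_of_nonneg (by positivity)]
    calc _ ≤ 1 / (n k : ℝ) * (M * ∑ i ∈ I k, e k i v + 2 * ∑ a, |τ (v a)|) := by gcongr
      _ = _ := by ring

end

noncomputable section

/-! ### Short spacings of uniform samples -/

/-- Union bound for the number of points of a uniform sample in a set. -/
theorem uniformSample_card_le (N h : ℕ) {S : Set ℝ} [DecidablePred (· ∈ S)] :
    uniformSample N {v | h ≤ (Finset.univ.filter fun a => v a ∈ S).card}
      ≤ (N.choose h : ENNReal) * (volume.restrict (Set.Icc (0 : ℝ) 1) S) ^ h := by
  have hsub : {v : Fin N → ℝ | h ≤ (Finset.univ.filter fun a => v a ∈ S).card}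
      ⊆ ⋃ T ∈ Finset.powersetCard h (Finset.univ : Finset (Fin N)),
        Set.pi Set.univ fun a => if a ∈ T then S else Set.univ := by
    intro v hv
    obtain ⟨T, hT, hTc⟩ := Finset.exists_subset_card_eq hv
    simp only [Set.mem_iUnion]
    refine ⟨T, by simp [hTc], fun a _ => ?_⟩
    by_cases ha : a ∈ T
    · simpa [ha] using (Finset.mem_filter.1 (hT ha)).2
    · simp [ha]
  refine (measure_mono hsub).trans ((measure_biUnion_finset_le _ _).trans ?_)
  have h1 : ∀ T ∈ Finset.powersetCard h (Finset.univ : Finset (Fin N)),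
      uniformSample N (Set.pi Set.univ fun a => if a ∈ T then S else Set.univ)
        = (volume.restrict (Set.Icc (0 : ℝ) 1) S) ^ h := by
    intro T hT
    rw [uniformSample, Measure.pi_pi]
    have : ∀ a, (volume.restrict (Set.Icc (0 : ℝ) 1)) (if a ∈ T then S else Set.univ)
        = if a ∈ T then volume.restrict (Set.Icc (0 : ℝ) 1) S else 1 := fun a => by
      split_ifs
      · rfl
      · exact measure_univ
    simp only [this]
    rw [Finset.prod_ite_mem, Finset.univ_inter, Finset.prod_const, (Finset.mem_powersetCard.1 hT).2]
  rw [Finset.sum_congr rfl h1, Finset.sum_const, Finset.card_powersetCard, Finset.card_univ,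
    Fintype.card_fin, nsmul_eq_mul]

/-- At most a few points of a uniform sample of size `N` are close to a given point: the
probability that the interval of radius `h / (N t)` contains `h` of them decays in `t`. -/
theorem uniformSample_crowded_le {N h : ℕ} (hN : 0 < N) (hh : 5 ≤ h) (p : ℝ) {t : ℝ} (ht : 0 < t) :
    uniformSample N {v | h ≤ (Finset.univ.filter fun a =>
        v a ∈ Set.Ioo (p - h / (N * t)) (p + h / (N * t))).card}
      ≤ ENNReal.ofReal ((2 * Real.exp 1) ^ 5 * (t ^ 5)⁻¹) := by
  have hN' : (0 : ℝ) < N := by exact_mod_cast hN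
  have hh' : (0 : ℝ) < h := by exact_mod_cast (by omega : 0 < h)
  -- for small `t` the bound exceeds `1`; for large `t` the union bound gives a power `h ≥ 5` of
  -- `2 e / t < 1`
  rcases le_or_gt t (2 * Real.exp 1) with htl | htl
  · refine prob_le_one.trans ?_
    rw [ENNReal.one_le_ofReal, ← div_eq_mul_inv, ← div_pow]
    exact one_le_pow₀ ((one_le_div ht).2 htl)
  set δ := (h : ℝ) / (N * t)
  have hδ : 0 ≤ δ := by positivity
  refine (uniformSample_card_le N h (S := Set.Ioo (p - δ) (p + δ))).trans ?_
  have h1 : (volume.restrict (Set.Icc (0 : ℝ) 1)) (Set.Ioo (p - δ) (p + δ))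
      ≤ ENNReal.ofReal (2 * δ) := by
    refine (Measure.restrict_apply_le _ _).trans ?_
    rw [Real.volume_Ioo]
    exact ENNReal.ofReal_le_ofReal (by linarith)
  calc (N.choose h : ENNReal) * (volume.restrict (Set.Icc (0 : ℝ) 1) (Set.Ioo (p - δ) (p + δ))) ^ h
      ≤ ENNReal.ofReal (N.choose h) * ENNReal.ofReal (2 * δ) ^ h := by
        rw [ENNReal.ofReal_natCast]; gcongr
    _ = ENNReal.ofReal (N.choose h * (2 * δ) ^ h) := by
        rw [← ENNReal.ofReal_pow (by positivity), ENNReal.ofReal_mul (by positivity)]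
    _ ≤ _ := by
        refine ENNReal.ofReal_le_ofReal ?_
        calc (N.choose h : ℝ) * (2 * δ) ^ h
            ≤ ((N : ℝ) ^ h / h.factorial) * (2 * δ) ^ h := by
              gcongr; exact Nat.choose_le_pow_div h N
          _ = ((h : ℝ) ^ h / h.factorial) * (2 / t) ^ h := by
              rw [div_mul_eq_mul_div, div_mul_eq_mul_div, ← mul_pow, ← mul_pow]
              congr 2
              simp only [δ]; field_simp
          _ ≤ Real.exp h * (2 / t) ^ h := by
              gcongr; exact Real.pow_div_factorial_le_exp (h : ℝ) hh'.le h
          _ = (2 * Real.exp 1 / t) ^ h := by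
              rw [← Real.exp_one_pow, ← mul_pow]; congr 1; ring
          _ ≤ (2 * Real.exp 1 / t) ^ 5 :=
              pow_le_pow_of_le_one (by positivity) ((div_le_one ht).2 htl.le) hh
          _ = _ := by rw [div_pow, div_eq_mul_inv]

/-- A kernel that controls averages over the windows `(x_(i), x_(i+h)]` of the sample. -/
def winKer (h r : ℕ) {N : ℕ} (v : Fin N → ℝ) (p : ℝ) : ℝ :=
  ((h : ℝ) / N ^ 2) * ∑ i ∈ Finset.Icc (1 : ℤ) (r - h),
    (Set.Ioc (censoredStat v r i) (censoredStat v r (i + h))).indicator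
      (fun _ => ((censoredStat v r (i + h) - censoredStat v r i) ^ 2)⁻¹) p

theorem measurable_winKer (h r N : ℕ) :
    Measurable fun z : (Fin N → ℝ) × ℝ => winKer h r z.1 z.2 := by
  unfold winKer
  refine (Finset.measurable_sum _ fun i _ => ?_).const_mul _
  have hc : ∀ j, Measurable fun z : (Fin N → ℝ) × ℝ => censoredStat z.1 r j := fun j =>
    (measurable_censoredStat r j).comp measurable_fst
  have hS : MeasurableSet {z : (Fin N → ℝ) × ℝ |
      z.2 ∈ Set.Ioc (censoredStat z.1 r i) (censoredStat z.1 r (i + h))} :=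
    (measurableSet_lt (hc i) measurable_snd).inter (measurableSet_le measurable_snd (hc _))
  have := Measurable.indicator
    (((hc (i + h)).sub (hc i)).pow_const 2).inv hS
  exact this

attribute [irreducible] winKer

theorem measurable_winKer_left (h r N : ℕ) (p : ℝ) :
    Measurable fun v : Fin N → ℝ => winKer h r v p :=
  (measurable_winKer h r N).comp measurable_prodMk_right

theorem measurable_winKer_right (h r : ℕ) {N : ℕ} (v : Fin N → ℝ) :
    Measurable fun p => winKer h r v p :=
  (measurable_winKer h r N).comp measurable_prodMk_left

theorem card_window_le {c : ℤ → ℝ} (hc : Monotone c) (J : Finset ℤ) (h : ℕ) (p : ℝ) :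
    (J.filter fun i => p ∈ Set.Ioc (c i) (c (i + h))).card ≤ h := by
  rcases (J.filter fun i => p ∈ Set.Ioc (c i) (c (i + h))).eq_empty_or_nonempty with he | hne
  · rw [he]; simp
  obtain ⟨i0, hi0, hmin⟩ := Finset.exists_min_image _ id hne
  have hsub : (J.filter fun i => p ∈ Set.Ioc (c i) (c (i + h))) ⊆ Finset.Ico i0 (i0 + h) := by
    intro i hi
    have h1 := hmin i hi
    simp only [Finset.mem_filter, Set.mem_Ioc, id] at hi hi0 h1
    rw [Finset.mem_Ico]
    refine ⟨h1, ?_⟩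
    by_contra! hle
    linarith [hc hle, hi.2.1, hi0.2.2]
  calc _ ≤ (Finset.Ico i0 (i0 + h)).card := Finset.card_le_card hsub
    _ = h := by simp

/-- A large value of the kernel forces many sample points near `p`. -/
theorem crowded_of_lt_winKer {N h r : ℕ} (hN : 0 < N) (hh : 1 ≤ h) (hr : r ≤ N)
    (v : Fin N → ℝ) (p : ℝ) {t : ℝ} (ht : 0 < t) (hK : t ^ 2 < winKer h r v p) :
    h ≤ (Finset.univ.filter fun a =>
        v a ∈ Set.Ioo (p - h / (N * t)) (p + h / (N * t))).card := by
  have hN' : (0 : ℝ) < N := by exact_mod_cast hN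
  have hh' : (0 : ℝ) < h := by exact_mod_cast hh
  set c := censoredStat v r with hcdef
  rcases Nat.eq_zero_or_pos r with hr0 | hr0
  · exfalso
    have : winKer h r v p = 0 := by
      unfold winKer
      rw [Finset.Icc_eq_empty (by rw [hr0]; push_cast; omega)]; simp
    rw [this] at hK; nlinarith
  have hc : Monotone c := censoredStat_mono v hr0 hr
  obtain ⟨i, hi, hip, hW⟩ : ∃ i ∈ Finset.Icc (1 : ℤ) (r - h), p ∈ Set.Ioc (c i) (c (i + h)) ∧
      c (i + h) - c i < h / (N * t) := by
    by_contra! hcon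
    have hb : winKer h r v p ≤ ((h : ℝ) / N ^ 2) * (h * ((h / (N * t)) ^ 2)⁻¹) := by
      unfold winKer
      gcongr
      calc _ = ∑ i ∈ (Finset.Icc (1 : ℤ) (r - h)).filter (fun i => p ∈ Set.Ioc (c i) (c (i + h))),
            ((c (i + h) - c i) ^ 2)⁻¹ := by
            rw [Finset.sum_filter]
            exact Finset.sum_congr rfl fun i _ => by rw [Set.indicator_apply]
        _ ≤ ∑ i ∈ (Finset.Icc (1 : ℤ) (r - h)).filter (fun i => p ∈ Set.Ioc (c i) (c (i + h))),
            ((h / (N * t)) ^ 2)⁻¹ := by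
            refine Finset.sum_le_sum fun i hi => ?_
            have := hcon i (Finset.mem_filter.1 hi).1 (Finset.mem_filter.1 hi).2
            gcongr
        _ ≤ h * ((h / (N * t)) ^ 2)⁻¹ := by
            rw [Finset.sum_const, nsmul_eq_mul]
            gcongr
            exact card_window_le hc _ h p
    have : ((h : ℝ) / N ^ 2) * (h * ((h / (N * t)) ^ 2)⁻¹) = t ^ 2 := by field_simp
    linarith
  rw [Finset.mem_Icc] at hi
  have e1 : (((Finset.univ.filter fun a =>
      v a ∈ Set.Ioo (p - h / (N * t)) (p + h / (N * t))).card : ℕ) : ℝ)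
      = ∑ j ∈ Finset.Icc 1 N, (Set.Ioo (p - h / (N * t)) (p + h / (N * t))).indicator
          (fun _ => (1 : ℝ)) (orderStat v j) := by
    rw [sum_orderStat v]
    simp [Set.indicator_apply, Finset.sum_boole]
  have e2 : (h : ℝ) ≤ ∑ j ∈ Finset.Icc 1 N,
      (Set.Ioo (p - h / (N * t)) (p + h / (N * t))).indicator
        (fun _ => (1 : ℝ)) (orderStat v j) := by
    calc (h : ℝ) = ∑ j ∈ Finset.Ioc i.toNat (i.toNat + h), (1 : ℝ) := by simp
      _ = ∑ j ∈ Finset.Ioc i.toNat (i.toNat + h),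
          (Set.Ioo (p - h / (N * t)) (p + h / (N * t))).indicator
            (fun _ => (1 : ℝ)) (orderStat v j) := by
          refine Finset.sum_congr rfl fun j hj => ?_
          rw [Finset.mem_Ioc] at hj
          rw [Set.indicator_of_mem]
          have hj2 : orderStat v j = c j := by
            rw [hcdef, censoredStat_of_mem v (by omega) (by omega)]; simp
          have m1 : c i ≤ c j := hc (by omega)
          have m2 : c j ≤ c (i + h) := hc (by omega)
          rw [hj2]
          exact ⟨by linarith [hip.1, hip.2], by linarith [hip.1, hip.2]⟩
      _ ≤ _ := by
          refine Finset.sum_le_sum_of_subset_of_nonneg (fun j hj => ?_) fun j _ _ => ?_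
          · rw [Finset.mem_Ioc] at hj; rw [Finset.mem_Icc]; omega
          · exact Set.indicator_nonneg (fun _ _ => zero_le_one) _
  rw [← e1] at e2
  exact_mod_cast e2

theorem winKer_nonneg (h r : ℕ) {N : ℕ} (v : Fin N → ℝ) (p : ℝ) : 0 ≤ winKer h r v p := by
  unfold winKer
  refine mul_nonneg (by positivity) (Finset.sum_nonneg fun i _ => ?_)
  exact Set.indicator_nonneg (fun _ _ => by positivity) _

/-- Five sample points near `p` already have probability of order `t ^ (-5)`; with `t = √s` this is
a tail of order `s ^ (-5/2)`, enough for a finite second moment. This is why windows of at least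
five spacings are required. -/
theorem meas_lt_winKer_le {N h r : ℕ} (hN : 0 < N) (hh : 5 ≤ h) (hr : r ≤ N) (p : ℝ) {s : ℝ}
    (hs : 0 < s) :
    uniformSample N {v | s < winKer h r v p}
      ≤ ENNReal.ofReal ((2 * Real.exp 1) ^ 5 * s ^ (-(5 / 2) : ℝ)) := by
  have h1 : {v : Fin N → ℝ | s < winKer h r v p} ⊆ {v | h ≤ (Finset.univ.filter fun a =>
      v a ∈ Set.Ioo (p - h / (N * √s)) (p + h / (N * √s))).card} := fun v hv =>
    crowded_of_lt_winKer hN (by omega) hr v p (Real.sqrt_pos.2 hs)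
      (by rw [Real.sq_sqrt hs.le]; exact hv)
  have h2 : (√s ^ 5)⁻¹ = s ^ (-(5 / 2) : ℝ) := by
    rw [Real.sqrt_eq_rpow, ← Real.rpow_natCast, ← Real.rpow_mul hs.le, ← Real.rpow_neg hs.le]
    norm_num
  rw [← h2]
  exact (measure_mono h1).trans (uniformSample_crowded_le hN hh p (Real.sqrt_pos.2 hs))

/-- Layer cake bound for the second moment of a variable with tail of order `s ^ (-5/2)`. -/
theorem lintegral_sq_le_of_tail {α : Type*} [MeasurableSpace α] {ν : Measure α}
    [IsProbabilityMeasure ν] {K : α → ℝ} (hK : Measurable K) (h0 : ∀ x, 0 ≤ K x) {A : ℝ}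
    (hA : 0 ≤ A) (htail : ∀ s : ℝ, 0 < s → ν {x | s < K x} ≤ ENNReal.ofReal (A * s ^
        (-(5 / 2) : ℝ))) :
    ∫⁻ x, ENNReal.ofReal (K x ^ 2) ∂ν ≤ ENNReal.ofReal (2 * (1 + 2 * A)) := by
  have hlc := lintegral_rpow_eq_lintegral_meas_lt_mul ν (f := K) (Eventually.of_forall h0)
    hK.aemeasurable (p := 2) (by norm_num)
  simp only [Real.rpow_two] at hlc
  rw [hlc, ENNReal.ofReal_mul (by norm_num)]
  refine mul_le_mul_right ?_ _
  have hu : Set.Ioi (0 : ℝ) = Set.Ioc 0 1 ∪ Set.Ioi 1 := by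
    rw [Set.Ioc_union_Ioi_eq_Ioi zero_le_one]
  have hI : IntegrableOn (fun s : ℝ => A * s ^ (-(3 / 2) : ℝ)) (Set.Ioi 1) :=
    (integrableOn_Ioi_rpow_of_lt (by norm_num) one_pos).const_mul A
  have h1 : ∫⁻ s in Set.Ioc (0 : ℝ) 1, ν {x | s < K x} * ENNReal.ofReal (s ^ ((2 : ℝ) - 1))
      ≤ ENNReal.ofReal 1 := by
    calc _ ≤ ∫⁻ s in Set.Ioc (0 : ℝ) 1, 1 := by
          refine setLIntegral_mono measurable_const fun s hs => ?_
          refine mul_le_one' prob_le_one ?_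
          rw [ENNReal.ofReal_le_one]
          exact Real.rpow_le_one hs.1.le hs.2 (by norm_num)
      _ = _ := by simp
  have h2 : ∫⁻ s in Set.Ioi (1 : ℝ), ν {x | s < K x} * ENNReal.ofReal (s ^ ((2 : ℝ) - 1))
      ≤ ENNReal.ofReal (2 * A) := by
    calc _ ≤ ∫⁻ s in Set.Ioi (1 : ℝ), ENNReal.ofReal (A * s ^ (-(3 / 2) : ℝ)) := by
          refine setLIntegral_mono (by fun_prop) fun s hs => ?_
          have hs0 : (0 : ℝ) < s := lt_trans one_pos hs
          refine (mul_le_mul_left (htail s hs0) _).trans (le_of_eq ?_)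
          rw [← ENNReal.ofReal_mul (by positivity), mul_assoc, ← Real.rpow_add hs0]
          norm_num
      _ = ENNReal.ofReal (2 * A) := by
          rw [← ofReal_integral_eq_lintegral_ofReal hI]
          · congr 1
            rw [integral_const_mul, integral_Ioi_rpow_of_lt (by norm_num) one_pos]
            norm_num; ring
          · filter_upwards [ae_restrict_mem measurableSet_Ioi] with s hs
            have hs0 : (0 : ℝ) < s := lt_trans one_pos hs
            positivity
  rw [hu]
  refine (lintegral_union_le _ _ _).trans ?_
  rw [ENNReal.ofReal_add (by norm_num) (by positivity)]
  exact add_le_add h1 h2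

/-- The kernel is bounded in mean square, uniformly in the sample size and in the point. -/
theorem exists_lintegral_winKer_sq_le : ∃ C : ℝ, 0 ≤ C ∧ ∀ {N h r : ℕ}, 0 < N → 5 ≤ h → r ≤ N →
    ∀ p : ℝ, ∫⁻ v, ENNReal.ofReal (winKer h r v p ^ 2) ∂(uniformSample N) ≤ ENNReal.ofReal C := by
  refine ⟨2 * (1 + 2 * (2 * Real.exp 1) ^ 5), by positivity, fun {N h r} hN hh hr p => ?_⟩
  exact lintegral_sq_le_of_tail (measurable_winKer_left h r N p)
    (winKer_nonneg h r · p) (by positivity) fun s hs => meas_lt_winKer_le hN hh hr p hs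

end

noncomputable section

/-! ### Averages over short windows of the sample -/

theorem lintegral_sq_le_measure_univ_mul {α : Type*} [MeasurableSpace α] {ν : Measure α}
    {F : α → ENNReal} (hF : Measurable F) : (∫⁻ x, F x ∂ν) ^ 2 ≤ ν Set.univ * ∫⁻ x, F x ^ 2 ∂ν := by
  have h := ENNReal.lintegral_mul_le_Lp_mul_Lq ν Real.HolderConjugate.two_two hF.aemeasurable
    (aemeasurable_const (b := (1 : ENNReal)))
  simp only [Pi.mul_apply, mul_one, ENNReal.rpow_two, one_pow, lintegral_one] at h
  calc (∫⁻ x, F x ∂ν) ^ 2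
      ≤ ((∫⁻ x, F x ^ 2 ∂ν) ^ (1 / 2 : ℝ) * ν Set.univ ^ (1 / 2 : ℝ)) ^ 2 := by gcongr
    _ = ν Set.univ * ∫⁻ x, F x ^ 2 ∂ν := by
        rw [mul_pow, ← ENNReal.rpow_natCast, ← ENNReal.rpow_natCast, ← ENNReal.rpow_mul,
          ← ENNReal.rpow_mul]
        norm_num [mul_comm]

/-- The mean of `φ` over the interval from `a` to `b`. -/
def winAvg (φ : ℝ → ℝ) (a b : ℝ) : ℝ := (b - a)⁻¹ * ∫ p in a..b, φ p

theorem measurable_winAvg {φ : ℝ → ℝ} (hφ : Integrable φ) :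
    Measurable fun z : ℝ × ℝ => winAvg φ z.1 z.2 := by
  have hc : Continuous fun b => ∫ p in (0 : ℝ)..b, φ p :=
    intervalIntegral.continuous_primitive (fun a b => hφ.intervalIntegrable) 0
  have : (fun z : ℝ × ℝ => winAvg φ z.1 z.2)
      = fun z => (z.2 - z.1)⁻¹ * ((∫ p in (0 : ℝ)..z.2, φ p) - ∫ p in (0 : ℝ)..z.1, φ p) := by
    ext z
    rw [winAvg, intervalIntegral.integral_interval_sub_left hφ.intervalIntegrable
      hφ.intervalIntegrable]
  rw [this]
  exact (measurable_snd.sub measurable_fst).inv.mul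
    ((hc.measurable.comp measurable_snd).sub (hc.measurable.comp measurable_fst))

theorem measurable_winAvg_censoredStat {N : ℕ} {φ : ℝ → ℝ} (hφ : Integrable φ) (r : ℕ) (i j : ℤ) :
    Measurable fun v : Fin N → ℝ => winAvg φ (censoredStat v r i) (censoredStat v r j) :=
  (measurable_winAvg hφ).comp ((measurable_censoredStat r i).prodMk (measurable_censoredStat r j))

theorem sq_sum_indicator_le_winKer {N h r : ℕ} (hN : 0 < N) (hr1 : 1 ≤ r) (hr : r ≤ N)
    (v : Fin N → ℝ) (p : ℝ) :
    ((1 / (N : ℝ)) * ∑ i ∈ Finset.Icc (1 : ℤ) (r - h),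
      (Set.Ioc (censoredStat v r i) (censoredStat v r (i + h))).indicator
      (fun _ => (censoredStat v r (i + h) - censoredStat v r i)⁻¹) p) ^ 2 ≤ winKer h r v p := by
  have hN' : (0 : ℝ) < N := by exact_mod_cast hN
  set c := censoredStat v r with hcdef
  have hc : Monotone c := censoredStat_mono v hr1 hr
  unfold winKer
  rw [← hcdef]
  set F := (Finset.Icc (1 : ℤ) (r - h)).filter fun i => p ∈ Set.Ioc (c i) (c (i + h))
  have e1 : ∑ i ∈ Finset.Icc (1 : ℤ) (r - h), (Set.Ioc (c i) (c (i + h))).indicator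
      (fun _ => (c (i + h) - c i)⁻¹) p = ∑ i ∈ F, (c (i + h) - c i)⁻¹ := by
    rw [Finset.sum_filter]
    exact Finset.sum_congr rfl fun i _ => by rw [Set.indicator_apply]
  have e2 : ∑ i ∈ Finset.Icc (1 : ℤ) (r - h), (Set.Ioc (c i) (c (i + h))).indicator
      (fun _ => ((c (i + h) - c i) ^ 2)⁻¹) p = ∑ i ∈ F, ((c (i + h) - c i) ^ 2)⁻¹ := by
    rw [Finset.sum_filter]
    exact Finset.sum_congr rfl fun i _ => by rw [Set.indicator_apply]
  rw [e1, e2, mul_pow]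
  have hs := sq_sum_le_card_mul_sum_sq (s := F) (f := fun i => (c (i + h) - c i)⁻¹)
  have hcard : (F.card : ℝ) ≤ h := by exact_mod_cast card_window_le hc _ h p
  calc (1 / (N : ℝ)) ^ 2 * (∑ i ∈ F, (c (i + h) - c i)⁻¹) ^ 2
      ≤ (1 / (N : ℝ)) ^ 2 * (h * ∑ i ∈ F, ((c (i + h) - c i) ^ 2)⁻¹) := by
        gcongr
        refine hs.trans ?_
        simp only [inv_pow]
        gcongr
    _ = _ := by ring

theorem ofReal_sum_winAvg_le {N h r : ℕ} (hN : 0 < N) (hr1 : 1 ≤ r) (hr : r ≤ N)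
    {v : Fin N → ℝ} (hv : ∀ a, v a ∈ Set.Ioo (0 : ℝ) 1) {φ : ℝ → ℝ} (hφ : Integrable φ)
    (h0 : ∀ p, 0 ≤ φ p) :
    ENNReal.ofReal ((1 / (N : ℝ)) * ∑ i ∈ Finset.Icc (1 : ℤ) (r - h),
      winAvg φ (censoredStat v r i) (censoredStat v r (i + h)))
      ≤ ∫⁻ p in Set.Icc (0 : ℝ) 1, ENNReal.ofReal (φ p) * ENNReal.ofReal (√(winKer h r v p)) := by
  have hN' : (0 : ℝ) < N := by exact_mod_cast hN
  set c := censoredStat v r with hcdef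
  have hc : Monotone c := censoredStat_mono v hr1 hr
  have hc01 : ∀ i, c i ∈ Set.Ioo (0 : ℝ) 1 := fun i => by
    obtain ⟨a, ha⟩ := censoredStat_mem v hr1 hr i
    rw [hcdef, ha]; exact hv a
  have hpt : ∀ i, winAvg φ (c i) (c (i + h)) = ∫ p in Set.Icc (0 : ℝ) 1,
      φ p * (Set.Ioc (c i) (c (i + h))).indicator (fun _ => (c (i + h) - c i)⁻¹) p := fun i => by
    have hle : c i ≤ c (i + h) := hc (by omega)
    rw [winAvg, intervalIntegral.integral_of_le hle, ← integral_const_mul]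
    have : Set.Ioc (c i) (c (i + h)) = Set.Ioc (c i) (c (i + h)) ∩ Set.Icc 0 1 := by
      rw [Set.inter_eq_left.2]
      exact fun x hx => ⟨(hc01 i).1.le.trans hx.1.le, hx.2.trans (hc01 _).2.le⟩
    conv_lhs => rw [this]
    rw [← Measure.restrict_restrict measurableSet_Ioc, ← integral_indicator measurableSet_Ioc]
    congr 1; ext p
    by_cases hp : p ∈ Set.Ioc (c i) (c (i + h))
    · simp [hp, mul_comm]
    · simp [hp]
  have hint : ∀ i, Integrable (fun p => φ p *
      (Set.Ioc (c i) (c (i + h))).indicator (fun _ => (c (i + h) - c i)⁻¹) p)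
      (volume.restrict (Set.Icc (0 : ℝ) 1)) := fun i => by
    refine hφ.restrict.mul_bdd (c := |(c (i + h) - c i)⁻¹|)
      (measurable_const.indicator measurableSet_Ioc).aestronglyMeasurable
      (Eventually.of_forall fun p => ?_)
    by_cases hp : p ∈ Set.Ioc (c i) (c (i + h)) <;> simp [hp]
  have hsum : (1 / (N : ℝ)) * ∑ i ∈ Finset.Icc (1 : ℤ) (r - h), winAvg φ (c i) (c (i + h))
      = ∫ p in Set.Icc (0 : ℝ) 1, φ p * ((1 / (N : ℝ)) * ∑ i ∈ Finset.Icc (1 : ℤ) (r - h),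
        (Set.Ioc (c i) (c (i + h))).indicator (fun _ => (c (i + h) - c i)⁻¹) p) := by
    simp only [hpt]
    rw [← integral_finsetSum _ fun i _ => hint i, ← integral_const_mul]
    congr 1; ext p
    rw [← Finset.mul_sum]; ring
  rw [hsum]
  refine (ENNReal.ofReal_le_ofReal (le_abs_self _)).trans ?_
  rw [← Real.enorm_eq_ofReal_abs]
  refine (enorm_integral_le_lintegral_enorm _).trans (lintegral_mono fun p => ?_)
  rw [← ENNReal.ofReal_mul (h0 p), Real.enorm_eq_ofReal_abs, abs_mul, abs_of_nonneg (h0 p)]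
  refine ENNReal.ofReal_le_ofReal (mul_le_mul_of_nonneg_left ?_ (h0 p))
  exact Real.abs_le_sqrt (sq_sum_indicator_le_winKer hN hr1 hr v p)

theorem winAvg_nonneg {φ : ℝ → ℝ} (h0 : ∀ p, 0 ≤ φ p) {a b : ℝ} (hab : a ≤ b) :
    0 ≤ winAvg φ a b :=
  mul_nonneg (inv_nonneg.2 (sub_nonneg.2 hab))
    (intervalIntegral.integral_nonneg hab fun p _ => h0 p)

/-- Averages over short windows are bounded from the integrable functions to mean square. -/
theorem exists_eLpNorm_sum_winAvg_le : ∃ C : ℝ, 0 ≤ C ∧ ∀ {N h r : ℕ}, 0 < N → 5 ≤ h → 1 ≤ r →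
    r ≤ N → ∀ {φ : ℝ → ℝ}, Measurable φ → Integrable φ → (∀ p, 0 ≤ φ p) →
    eLpNorm (fun v : Fin N → ℝ => (1 / (N : ℝ)) * ∑ i ∈ Finset.Icc (1 : ℤ) (r - h),
      winAvg φ (censoredStat v r i) (censoredStat v r (i + h))) 2 (uniformSample N)
      ≤ ENNReal.ofReal (C * ∫ p, φ p) := by
  obtain ⟨C, hC0, hC⟩ := exists_lintegral_winKer_sq_le
  refine ⟨√(1 + C), Real.sqrt_nonneg _, fun {N h r} hN hh hr1 hr {φ} hφm hφ h0 => ?_⟩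
  have hI0 : 0 ≤ ∫ p, φ p := integral_nonneg h0
  refine eLpNorm_two_le_of_lintegral_sq_le (by positivity) ?_
  set lam := volume.restrict (Set.Icc (0 : ℝ) 1) with hlam
  set ν := lam.withDensity fun p => ENNReal.ofReal (φ p) with hν
  have hν1 : ν Set.univ ≤ ENNReal.ofReal (∫ p, φ p) := by
    rw [hν, withDensity_apply _ MeasurableSet.univ, Measure.restrict_univ,
      ofReal_integral_eq_lintegral_ofReal hφ (Eventually.of_forall h0)]
    exact lintegral_mono' Measure.restrict_le_self le_rfl
  have hfin : IsFiniteMeasure ν := ⟨hν1.trans_lt ENNReal.ofReal_lt_top⟩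
  have hKm := measurable_winKer h r N
  have hKv : ∀ v : Fin N → ℝ, Measurable fun p => winKer h r v p := fun v =>
    measurable_winKer_right h r v
  have hsq : ∀ (v : Fin N → ℝ) p, ENNReal.ofReal (√(winKer h r v p)) ^ 2
      = ENNReal.ofReal (winKer h r v p) := fun v p => by
    rw [← ENNReal.ofReal_pow (Real.sqrt_nonneg _), Real.sq_sqrt (winKer_nonneg h r v p)]
  -- Cauchy-Schwarz with respect to the measure `ν` with density `φ`, so that only the mean of the
  -- kernel at each point `p` is needed
  calc ∫⁻ v, ENNReal.ofReal (((1 / (N : ℝ)) * ∑ i ∈ Finset.Icc (1 : ℤ) (r - h),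
        winAvg φ (censoredStat v r i) (censoredStat v r (i + h))) ^ 2) ∂(uniformSample N)
      ≤ ∫⁻ v, ν Set.univ * ∫⁻ p, ENNReal.ofReal (winKer h r v p) ∂ν ∂(uniformSample N) := by
        refine lintegral_mono_ae ?_
        filter_upwards [ae_uniformSample_mem N] with v hv
        have hT0 : 0 ≤ (1 / (N : ℝ)) * ∑ i ∈ Finset.Icc (1 : ℤ) (r - h),
            winAvg φ (censoredStat v r i) (censoredStat v r (i + h)) :=
          mul_nonneg (by positivity) (Finset.sum_nonneg fun i _ =>
            winAvg_nonneg h0 (censoredStat_mono v hr1 hr (by omega)))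
        rw [ENNReal.ofReal_pow hT0]
        have h1 := ofReal_sum_winAvg_le (h := h) hN hr1 hr hv hφ h0
        have h2 : ∫⁻ p, ENNReal.ofReal (φ p) * ENNReal.ofReal (√(winKer h r v p)) ∂lam
            = ∫⁻ p, ENNReal.ofReal (√(winKer h r v p)) ∂ν := by
          rw [hν, lintegral_withDensity_eq_lintegral_mul _ hφm.ennreal_ofReal
            (hKv v).sqrt.ennreal_ofReal]
          rfl
        rw [h2] at h1
        refine (pow_le_pow_left' h1 2).trans ?_
        refine (lintegral_sq_le_measure_univ_mul (hKv v).sqrt.ennreal_ofReal).trans (le_of_eq ?_)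
        simp only [hsq]
    _ = ν Set.univ * ∫⁻ p, ∫⁻ v, ENNReal.ofReal (winKer h r v p) ∂(uniformSample N) ∂ν := by
        rw [lintegral_const_mul' _ _ (measure_ne_top _ _), lintegral_lintegral_swap]
        exact hKm.ennreal_ofReal.aemeasurable
    _ ≤ ν Set.univ * ∫⁻ _, ENNReal.ofReal (1 + C) ∂ν := by
        gcongr with p
        calc ∫⁻ v, ENNReal.ofReal (winKer h r v p) ∂(uniformSample N)
            ≤ ∫⁻ v, (1 + ENNReal.ofReal (winKer h r v p ^ 2)) ∂(uniformSample N) := by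
              refine lintegral_mono fun v => ?_
              rw [← ENNReal.ofReal_one, ← ENNReal.ofReal_add zero_le_one (sq_nonneg _)]
              exact ENNReal.ofReal_le_ofReal (by nlinarith [sq_nonneg (winKer h r v p - 1)])
          _ = 1 + ∫⁻ v, ENNReal.ofReal (winKer h r v p ^ 2) ∂(uniformSample N) := by
              rw [lintegral_add_left measurable_const]; simp
          _ ≤ ENNReal.ofReal (1 + C) := by
              rw [ENNReal.ofReal_add zero_le_one hC0, ENNReal.ofReal_one]
              gcongr
              exact hC hN hh hr p
    _ ≤ ENNReal.ofReal (∫ p, φ p) * (ENNReal.ofReal (1 + C) * ENNReal.ofReal (∫ p, φ p)) := by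
        rw [lintegral_const]
        gcongr
    _ = _ := by
        rw [← ENNReal.ofReal_mul (by positivity), ← ENNReal.ofReal_mul hI0, mul_pow,
          Real.sq_sqrt (by positivity)]
        congr 1; ring

/-- The average reciprocal spacing is bounded in mean square. -/
theorem exists_eLpNorm_sum_inv_spacing_le : ∃ C : ℝ, 0 ≤ C ∧ ∀ {N h r : ℕ}, 0 < N → 5 ≤ h →
    1 ≤ r → r ≤ N →
    eLpNorm (fun v : Fin N → ℝ => (1 / (N : ℝ)) * ∑ i ∈ Finset.Icc (1 : ℤ) (r - h),
      (h : ℝ) / (N * (censoredStat v r (i + h) - censoredStat v r i))) 2 (uniformSample N)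
      ≤ ENNReal.ofReal C := by
  obtain ⟨C, hC0, hC⟩ := exists_lintegral_winKer_sq_le
  refine ⟨√C, Real.sqrt_nonneg _, fun {N h r} hN hh hr1 hr => ?_⟩
  refine eLpNorm_two_le_of_lintegral_sq_le (by positivity) ?_
  rw [Real.sq_sqrt hC0]
  have hN' : (0 : ℝ) < N := by exact_mod_cast hN
  have hKm := measurable_winKer h r N
  have hKv : ∀ v : Fin N → ℝ, Measurable fun p => winKer h r v p := fun v =>
    measurable_winKer_right h r v
  set lam := volume.restrict (Set.Icc (0 : ℝ) 1) with hlam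
  calc ∫⁻ v, ENNReal.ofReal (((1 / (N : ℝ)) * ∑ i ∈ Finset.Icc (1 : ℤ) (r - h),
      (h : ℝ) / (N * (censoredStat v r (i + h) - censoredStat v r i))) ^ 2) ∂(uniformSample N)
      ≤ ∫⁻ v, ∫⁻ p, ENNReal.ofReal (winKer h r v p ^ 2) ∂lam ∂(uniformSample N) := by
        refine lintegral_mono_ae ?_
        filter_upwards [ae_uniformSample_mem N, ae_uniformSample_injective N] with v hv hinj
        set c := censoredStat v r with hcdef
        have hc : Monotone c := censoredStat_mono v hr1 hr
        have hc01 : ∀ i, c i ∈ Set.Ioo (0 : ℝ) 1 := fun i => by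
          obtain ⟨a, ha⟩ := censoredStat_mem v hr1 hr i
          rw [hcdef, ha]; exact hv a
        have hT0 : 0 ≤ (1 / (N : ℝ)) * ∑ i ∈ Finset.Icc (1 : ℤ) (r - h),
            (h : ℝ) / (N * (c (i + h) - c i)) :=
          mul_nonneg (by positivity) (Finset.sum_nonneg fun i _ =>
            div_nonneg (by positivity) (mul_nonneg hN'.le (sub_nonneg.2 (hc (by omega)))))
        have e1 : (1 / (N : ℝ)) * ∑ i ∈ Finset.Icc (1 : ℤ) (r - h),
            (h : ℝ) / (N * (c (i + h) - c i)) = ∫ p, winKer h r v p ∂lam := by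
          unfold winKer
          rw [integral_const_mul, integral_finsetSum]
          · rw [Finset.mul_sum, Finset.mul_sum]
            refine Finset.sum_congr rfl fun i hi => ?_
            rw [Finset.mem_Icc] at hi
            have hlt : 0 < c (i + h) - c i :=
              sub_pos.2 (censoredStat_lt hinj hr hi.1 (by omega) (by omega))
            have hsub : Set.Ioc (c i) (c (i + h)) ⊆ Set.Icc 0 1 := fun x hx =>
              ⟨(hc01 i).1.le.trans hx.1.le, hx.2.trans (hc01 _).2.le⟩
            rw [integral_indicator measurableSet_Ioc, hlam,
              Measure.restrict_restrict measurableSet_Ioc, Set.inter_eq_left.2 hsub]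
            simp only [integral_const, MeasurableSet.univ, measureReal_restrict_apply,
              Set.univ_inter, Real.volume_real_Ioc_of_le (hc (by omega : i ≤ i + h)), smul_eq_mul]
            rw [← hcdef]
            field_simp
          · intro i _
            exact (integrable_const _).indicator measurableSet_Ioc
        rw [ENNReal.ofReal_pow hT0, e1]
        have h3 : ENNReal.ofReal (∫ p, winKer h r v p ∂lam)
            ≤ ∫⁻ p, ENNReal.ofReal (winKer h r v p) ∂lam := by
          refine (ENNReal.ofReal_le_ofReal (le_abs_self _)).trans ?_
          rw [← Real.enorm_eq_ofReal_abs]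
          refine (enorm_integral_le_lintegral_enorm _).trans (lintegral_mono fun p => ?_)
          rw [Real.enorm_eq_ofReal (winKer_nonneg h r v p)]
        refine (pow_le_pow_left' h3 2).trans ?_
        refine (lintegral_sq_le_measure_univ_mul (hKv v).ennreal_ofReal).trans (le_of_eq ?_)
        rw [measure_univ, one_mul]
        refine lintegral_congr fun p => ?_
        rw [ENNReal.ofReal_pow (winKer_nonneg h r v p)]
    _ = ∫⁻ p, ∫⁻ v, ENNReal.ofReal (winKer h r v p ^ 2) ∂(uniformSample N) ∂lam := by
        rw [lintegral_lintegral_swap]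
        exact (hKm.pow_const 2).ennreal_ofReal.aemeasurable
    _ ≤ ∫⁻ _, ENNReal.ofReal C ∂lam := lintegral_mono fun p => hC hN hh hr p
    _ = ENNReal.ofReal C := by simp [hlam]

/-- A tail of an integrable function with small integral. -/
theorem exists_truncation_one {φ : ℝ → ℝ} (hφm : Measurable φ) (hφ : Integrable φ) {ε : ℝ}
    (hε : 0 < ε) :
    ∃ (M : ℝ) (τ : ℝ → ℝ), 0 ≤ M ∧ Measurable τ ∧ Integrable τ ∧ (∀ x, 0 ≤ τ x) ∧
      (∀ x, |φ x| ≤ M + τ x) ∧ ∫ x, τ x ≤ ε := by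
  obtain ⟨M, hM⟩ := (memLp_one_iff_integrable.2 hφ).eLpNorm_indicator_norm_ge_le
    hφm.stronglyMeasurable hε
  set s : Set ℝ := {x | M ≤ ‖φ x‖₊} with hs
  have hsm : MeasurableSet s := measurableSet_le measurable_const (by fun_prop)
  refine ⟨|M|, fun x => |s.indicator φ x|, abs_nonneg _, (hφm.indicator hsm).abs,
    (hφ.indicator hsm).abs, fun x => abs_nonneg _, fun x => ?_, ?_⟩
  · by_cases hx : x ∈ s
    · simp [hx]
    · simp only [hx, not_false_eq_true, Set.indicator_of_notMem, abs_zero, add_zero]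
      simp only [hs, Set.mem_ofPred_eq, not_le, coe_nnnorm, Real.norm_eq_abs] at hx
      exact hx.le.trans (le_abs_self _)
  · rw [eLpNorm_one_eq_lintegral_enorm,
      ← ofReal_integral_norm_eq_lintegral_enorm (hφ.indicator hsm),
      ENNReal.ofReal_le_ofReal_iff hε.le] at hM
    exact hM

theorem winAvg_const_add {τ : ℝ → ℝ} (hτ : Integrable τ) (M : ℝ) {a b : ℝ} (hab : a < b) :
    winAvg (fun p => M + τ p) a b = M + winAvg τ a b := by
  have : b - a ≠ 0 := (sub_pos.2 hab).ne'
  rw [winAvg, winAvg, intervalIntegral.integral_add (by simp) hτ.intervalIntegrable]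
  simp only [intervalIntegral.integral_const, smul_eq_mul]
  field_simp

theorem winAvg_mono {φ ψ : ℝ → ℝ} {a b : ℝ} (hφ : IntervalIntegrable φ volume a b)
    (hψ : IntervalIntegrable ψ volume a b) (h : ∀ p, φ p ≤ ψ p) (hab : a ≤ b) :
    winAvg φ a b ≤ winAvg ψ a b :=
  mul_le_mul_of_nonneg_left (intervalIntegral.integral_mono hab hφ hψ h)
    (inv_nonneg.2 (sub_nonneg.2 hab))

/-- Window averages of an integrable function over few windows are negligible. -/
theorem l2Null_weighted_winAvg {n r h : ℕ → ℕ} (h1 : ∀ k, 1 ≤ r k) (hr : ∀ k, r k ≤ n k)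
    (hh : ∀ᶠ k in atTop, 5 ≤ h k) {e : (k : ℕ) → ℤ → (Fin (n k) → ℝ) → ℝ}
    (hem : ∀ k i, Measurable (e k i)) (he0 : ∀ k i v, 0 ≤ e k i v) (he1 : ∀ k i v, e k i v ≤ 1)
    (he : L2Null n fun k v => (1 / (n k : ℝ)) * ∑ i ∈ Finset.Icc (1 : ℤ) (r k - h k), e k i v)
    {φ : ℝ → ℝ} (hφm : Measurable φ) (hφ : Integrable φ) :
    L2Null n fun k v => (1 / (n k : ℝ)) * ∑ i ∈ Finset.Icc (1 : ℤ) (r k - h k),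
      e k i v * winAvg (fun p => |φ p|) (censoredStat v (r k) i)
        (censoredStat v (r k) (i + h k)) := by
  obtain ⟨C, hC0, hC⟩ := exists_eLpNorm_sum_winAvg_le
  refine L2Null.of_approx (fun k => ?_) fun ε hε => ?_
  · refine (Finset.measurable_sum _ fun i _ => ?_).const_mul _
    exact (hem k i).mul (measurable_winAvg_censoredStat hφ.abs _ _ _)
  obtain ⟨M, τ, hM0, hτm, hτ, hτ0, hb, hτε⟩ :=
    exists_truncation_one hφm hφ (ε := ε / (C + 1)) (by positivity)
  refine ⟨_, fun k v => (1 / (n k : ℝ)) * ∑ i ∈ Finset.Icc (1 : ℤ) (r k - h k),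
    winAvg τ (censoredStat v (r k) i) (censoredStat v (r k) (i + h k)), he.const_mul M,
    fun k => ?_, ?_, ?_⟩
  · refine (Finset.measurable_sum _ fun i _ => ?_).const_mul _
    exact measurable_winAvg_censoredStat hτ _ _ _
  · filter_upwards [hh] with k hk
    refine (hC ((h1 k).trans (hr k)) hk (h1 k) (hr k) hτm hτ hτ0).trans ?_
    refine ENNReal.ofReal_le_ofReal ?_
    calc C * ∫ p, τ p ≤ (C + 1) * (ε / (C + 1)) := by
          have : 0 ≤ ∫ p, τ p := integral_nonneg hτ0
          gcongr
          linarith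
      _ = ε := by field_simp
  · filter_upwards [hh] with k hk
    filter_upwards [ae_uniformSample_injective (n k)] with v hinj
    set c := censoredStat v (r k) with hcdef
    have hc : Monotone c := censoredStat_mono v (h1 k) (hr k)
    have hn0 : (0 : ℝ) ≤ 1 / (n k : ℝ) := by positivity
    have hw0 : ∀ i, 0 ≤ winAvg (fun p => |φ p|) (c i) (c (i + h k)) := fun i =>
      winAvg_nonneg (fun p => abs_nonneg _) (hc (by omega))
    have hτw0 : ∀ i, 0 ≤ winAvg τ (c i) (c (i + h k)) := fun i =>
      winAvg_nonneg hτ0 (hc (by omega))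
    have hs : ∑ i ∈ Finset.Icc (1 : ℤ) (r k - h k), e k i v
          * winAvg (fun p => |φ p|) (c i) (c (i + h k))
        ≤ M * ∑ i ∈ Finset.Icc (1 : ℤ) (r k - h k), e k i v
          + ∑ i ∈ Finset.Icc (1 : ℤ) (r k - h k), winAvg τ (c i) (c (i + h k)) := by
      rw [Finset.mul_sum, ← Finset.sum_add_distrib]
      refine Finset.sum_le_sum fun i hi => ?_
      rw [Finset.mem_Icc] at hi
      have hlt : c i < c (i + h k) := censoredStat_lt hinj (hr k) hi.1 (by omega) (by omega)
      have h2 : winAvg (fun p => |φ p|) (c i) (c (i + h k))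
          ≤ M + winAvg τ (c i) (c (i + h k)) := by
        rw [← winAvg_const_add hτ M hlt]
        exact winAvg_mono hφ.abs.intervalIntegrable
          (IntervalIntegrable.add (by simp) hτ.intervalIntegrable) hb hlt.le
      have := he0 k i v
      have := he1 k i v
      have := hτw0 i
      nlinarith
    rw [abs_of_nonneg (mul_nonneg hn0 (Finset.sum_nonneg fun i _ =>
        mul_nonneg (he0 k i v) (hw0 i))),
      abs_of_nonneg (mul_nonneg hM0 (mul_nonneg hn0 (Finset.sum_nonneg fun i _ => he0 k i v))),
      abs_of_nonneg (mul_nonneg hn0 (Finset.sum_nonneg fun i _ => hτw0 i))]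
    calc _ ≤ 1 / (n k : ℝ) * (M * ∑ i ∈ Finset.Icc (1 : ℤ) (r k - h k), e k i v
          + ∑ i ∈ Finset.Icc (1 : ℤ) (r k - h k), winAvg τ (c i) (c (i + h k))) := by gcongr
      _ = _ := by ring

/-- The negative part of the logarithmic spacings over few windows is negligible. -/
theorem l2Null_weighted_log_spacing {n r h : ℕ → ℕ} (h1 : ∀ k, 1 ≤ r k) (hr : ∀ k, r k ≤ n k)
    (hh : ∀ᶠ k in atTop, 5 ≤ h k) {e : (k : ℕ) → ℤ → (Fin (n k) → ℝ) → ℝ}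
    (hem : ∀ k i, Measurable (e k i)) (he0 : ∀ k i v, 0 ≤ e k i v) (he1 : ∀ k i v, e k i v ≤ 1)
    (he : L2Null n fun k v => (1 / (n k : ℝ)) * ∑ i ∈ Finset.Icc (1 : ℤ) (r k - h k), e k i v) :
    L2Null n fun k v => (1 / (n k : ℝ)) * ∑ i ∈ Finset.Icc (1 : ℤ) (r k - h k),
      e k i v * max 0 (Real.log ((h k : ℝ) / (n k * (censoredStat v (r k) (i + h k)
        - censoredStat v (r k) i)))) := by
  obtain ⟨C, hC0, hC⟩ := exists_eLpNorm_sum_inv_spacing_le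
  have hWm : ∀ k i, Measurable fun v : Fin (n k) → ℝ => (h k : ℝ) / (n k *
      (censoredStat v (r k) (i + h k) - censoredStat v (r k) i)) := fun k i =>
    (((measurable_censoredStat _ _).sub (measurable_censoredStat _ _)).const_mul _).const_div _
  refine L2Null.of_approx (fun k => ?_) fun ε hε => ?_
  · refine (Finset.measurable_sum _ fun i _ => ?_).const_mul _
    exact (hem k i).mul (measurable_const.max (hWm k i).log)
  set M : ℝ := max 1 (C / ε) with hM
  have hM1 : 1 ≤ M := le_max_left _ _
  have hM0 : 0 < M := by linarith
  refine ⟨_, fun k v => M⁻¹ * ((1 / (n k : ℝ)) * ∑ i ∈ Finset.Icc (1 : ℤ) (r k - h k),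
    (h k : ℝ) / (n k * (censoredStat v (r k) (i + h k) - censoredStat v (r k) i))),
    he.const_mul (Real.log M), fun k => ?_, ?_, ?_⟩
  · exact ((Finset.measurable_sum _ fun i _ => hWm k i).const_mul _).const_mul _
  · filter_upwards [hh] with k hk
    have e2 := eLpNorm_const_smul (p := 2) (μ := uniformSample (n k)) M⁻¹
      (fun v : Fin (n k) → ℝ => (1 / (n k : ℝ)) * ∑ i ∈ Finset.Icc (1 : ℤ) (r k - h k),
        (h k : ℝ) / (n k * (censoredStat v (r k) (i + h k) - censoredStat v (r k) i)))
    refine (le_of_eq e2).trans ?_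
    rw [Real.enorm_eq_ofReal (by positivity)]
    refine (mul_le_mul_right (hC ((h1 k).trans (hr k)) hk (h1 k) (hr k)) _).trans ?_
    rw [← ENNReal.ofReal_mul (by positivity)]
    refine ENNReal.ofReal_le_ofReal ?_
    rw [inv_mul_le_iff₀ hM0]
    have := le_max_right 1 (C / ε)
    rw [div_le_iff₀ hε] at this
    exact this
  · filter_upwards [hh] with k hk
    filter_upwards [ae_uniformSample_injective (n k)] with v hinj
    set c := censoredStat v (r k) with hcdef
    have hc : Monotone c := censoredStat_mono v (h1 k) (hr k)
    have hnk : (0 : ℝ) < n k := by exact_mod_cast (h1 k).trans (hr k)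
    have hn0 : (0 : ℝ) ≤ 1 / (n k : ℝ) := by positivity
    have hq0 : ∀ i, 0 ≤ (h k : ℝ) / (n k * (c (i + h k) - c i)) := fun i =>
      div_nonneg (by positivity) (mul_nonneg hnk.le (sub_nonneg.2 (hc (by omega))))
    have hlogM : 0 ≤ Real.log M := Real.log_nonneg hM1
    have hs : ∑ i ∈ Finset.Icc (1 : ℤ) (r k - h k), e k i v
          * max 0 (Real.log ((h k : ℝ) / (n k * (c (i + h k) - c i))))
        ≤ Real.log M * ∑ i ∈ Finset.Icc (1 : ℤ) (r k - h k), e k i v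
          + M⁻¹ * ∑ i ∈ Finset.Icc (1 : ℤ) (r k - h k), (h k : ℝ) / (n k * (c (i + h k)
              - c i)) := by
      rw [Finset.mul_sum, Finset.mul_sum, ← Finset.sum_add_distrib]
      refine Finset.sum_le_sum fun i hi => ?_
      rw [Finset.mem_Icc] at hi
      have hlt : 0 < c (i + h k) - c i :=
        sub_pos.2 (censoredStat_lt hinj (hr k) hi.1 (by omega) (by omega))
      have hh0 : (0 : ℝ) < h k := by exact_mod_cast (by omega : 0 < h k)
      set q := (h k : ℝ) / (n k * (c (i + h k) - c i)) with hq
      have hqpos : 0 < q := by positivity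
      have h2 : max 0 (Real.log q) ≤ Real.log M + M⁻¹ * q := by
        refine max_le (by positivity) ?_
        have h3 := Real.log_le_sub_one_of_pos (by positivity : 0 < M⁻¹ * q)
        rw [Real.log_mul (by positivity) hqpos.ne', Real.log_inv] at h3
        linarith
      have := he0 k i v
      have := he1 k i v
      have h4 : 0 ≤ M⁻¹ * q := by positivity
      nlinarith
    rw [abs_of_nonneg (mul_nonneg hn0 (Finset.sum_nonneg fun i _ =>
        mul_nonneg (he0 k i v) (le_max_left _ _))),
      abs_of_nonneg (mul_nonneg hlogM (mul_nonneg hn0 (Finset.sum_nonneg fun i _ => he0 k i v))),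
      abs_of_nonneg (mul_nonneg (inv_nonneg.2 hM0.le)
        (mul_nonneg hn0 (Finset.sum_nonneg fun i _ => hq0 i)))]
    calc _ ≤ 1 / (n k : ℝ) * (Real.log M * ∑ i ∈ Finset.Icc (1 : ℤ) (r k - h k), e k i v
          + M⁻¹ * ∑ i ∈ Finset.Icc (1 : ℤ) (r k - h k),
            (h k : ℝ) / (n k * (c (i + h k) - c i))) := by gcongr
      _ = _ := by ring

end

noncomputable section

/-! ### Local counts of uniform samples -/

/-- The triangular kernel, a probability density on `[-1, 1]`. -/
def tri (u : ℝ) : ℝ := max 0 (1 - |u|)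

theorem tri_nonneg (u : ℝ) : 0 ≤ tri u := le_max_left _ _

theorem tri_le_one (u : ℝ) : tri u ≤ 1 := max_le zero_le_one (by linarith [abs_nonneg u])

theorem continuous_tri : Continuous tri := by unfold tri; fun_prop

theorem tri_eq_zero {u : ℝ} (hu : u ∉ Set.Icc (-1 : ℝ) 1) : tri u = 0 := by
  refine max_eq_left ?_
  by_contra! h
  exact hu (abs_le.1 (by linarith))

theorem integrable_tri : Integrable tri :=
  continuous_tri.integrable_of_hasCompactSupport
    (HasCompactSupport.intro isCompact_Icc fun _ hu => tri_eq_zero hu)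

theorem integral_tri : ∫ u, tri u = 1 := by
  have h1 : ∫ u, tri u = ∫ u in Set.Icc (-1 : ℝ) 1, tri u :=
    (setIntegral_eq_integral_of_forall_compl_eq_zero fun _ hu => tri_eq_zero hu).symm
  rw [h1, integral_Icc_eq_integral_Ioc, ← intervalIntegral.integral_of_le (by norm_num),
    ← intervalIntegral.integral_add_adjacent_intervals (b := 0)
      (continuous_tri.intervalIntegrable _ _) (continuous_tri.intervalIntegrable _ _)]
  have h2 : ∫ u in (-1 : ℝ)..0, tri u = ∫ u in (-1 : ℝ)..0, (1 + u) := by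
    refine intervalIntegral.integral_congr fun u hu => ?_
    rw [Set.uIcc_of_le (by norm_num)] at hu
    simp only [tri]
    rw [abs_of_nonpos hu.2, max_eq_right (by linarith [hu.1])]; ring
  have h3 : ∫ u in (0 : ℝ)..1, tri u = ∫ u in (0 : ℝ)..1, (1 - u) := by
    refine intervalIntegral.integral_congr fun u hu => ?_
    rw [Set.uIcc_of_le (by norm_num)] at hu
    simp only [tri]
    rw [abs_of_nonneg hu.1, max_eq_right (by linarith [hu.2])]
  rw [h2, h3, intervalIntegral.integral_add (by simp) (by simp),
    intervalIntegral.integral_sub (by simp) (by simp)]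
  simp
  norm_num

theorem integrable_tri_comp {c : ℝ} (hc : 0 < c) (x : ℝ) :
    Integrable fun y => tri (c * (y - x)) :=
  (integrable_tri.comp_mul_left' hc.ne').comp_sub_right x

theorem setIntegral_tri_comp_le {c : ℝ} (hc : 0 < c) (x : ℝ) :
    ∫ y in Set.Icc (0 : ℝ) 1, tri (c * (y - x)) ≤ c⁻¹ := by
  calc ∫ y in Set.Icc (0 : ℝ) 1, tri (c * (y - x)) ≤ ∫ y, tri (c * (y - x)) :=
        setIntegral_le_integral (integrable_tri_comp hc x)
          (Eventually.of_forall fun _ => tri_nonneg _)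
    _ = c⁻¹ := by
        rw [integral_sub_right_eq_self (fun y => tri (c * y)) x,
          Measure.integral_comp_mul_left, integral_tri, abs_of_pos (inv_pos.2 hc)]
        simp

/-- The variance of a sum over a uniform sample. -/
theorem lintegral_sum_sub_sq_le {N : ℕ} {g : ℝ → ℝ} (hg : Measurable g) {M : ℝ}
    (hM : ∀ x, |g x| ≤ M) :
    ∫⁻ v : Fin N → ℝ, ENNReal.ofReal ((∑ a, g (v a) - N * ∫ x in Set.Icc (0 : ℝ) 1, g x) ^ 2)
      ∂(uniformSample N) ≤ ENNReal.ofReal (N * ∫ x in Set.Icc (0 : ℝ) 1, g x ^ 2) := by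
  set lam := volume.restrict (Set.Icc (0 : ℝ) 1)
  have hgL : MemLp g 2 lam := MemLp.of_bound hg.aestronglyMeasurable M (Eventually.of_forall hM)
  have hS : MemLp (∑ a : Fin N, fun v : Fin N → ℝ => g (v a)) 2 (uniformSample N) :=
    memLp_finsetSum' _ fun a _ => hgL.comp_measurePreserving
      (measurePreserving_eval (fun _ : Fin N => lam) a)
  have hint : ∫ v, (∑ a : Fin N, fun v : Fin N → ℝ => g (v a)) v ∂(uniformSample N)
      = N * ∫ x, g x ∂lam := by
    simp only [Finset.sum_apply]
    rw [integral_finsetSum]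
    · have : ∀ a : Fin N, ∫ v, g (v a) ∂(uniformSample N) = ∫ x, g x ∂lam := fun a => by
        exact integral_comp_eval (μ := fun _ : Fin N => lam) hg.aestronglyMeasurable
      simp [this]
    · intro a _
      exact ((hgL.comp_measurePreserving
        (measurePreserving_eval (fun _ : Fin N => lam) a)).integrable (by norm_num))
  have hvar : variance (∑ a : Fin N, fun v : Fin N → ℝ => g (v a)) (uniformSample N)
      ≤ N * ∫ x, g x ^ 2 ∂lam := by
    unfold uniformSample
    rw [variance_sum_pi (fun _ => hgL)]
    simpa using mul_le_mul_of_nonneg_left (variance_le_expectation_sq hg.aestronglyMeasurable)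
      (Nat.cast_nonneg N)
  calc ∫⁻ v, ENNReal.ofReal ((∑ a, g (v a) - N * ∫ x, g x ∂lam) ^ 2) ∂uniformSample N
      = evariance (∑ a : Fin N, fun v : Fin N → ℝ => g (v a)) (uniformSample N) := by
        rw [evariance_eq_lintegral_ofReal, hint]
        simp only [Finset.sum_apply]
    _ = ENNReal.ofReal (variance (∑ a : Fin N, fun v : Fin N → ℝ => g (v a))
          (uniformSample N)) := hS.ofReal_variance_eq.symm
    _ ≤ _ := ENNReal.ofReal_le_ofReal hvar

/-- The kernel estimate, with the triangular kernel of width `m / N`, of the density of the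
sample `v` at `x`. -/
def localCount (m : ℕ) {N : ℕ} (v : Fin N → ℝ) (x : ℝ) : ℝ :=
  (1 / (m : ℝ)) * ∑ b, tri ((N : ℝ) / m * (v b - x))

/-- By independence the other sample points contribute at most `1` on average to the kernel estimate
at the sample point `v a`, with variance of order `1 / m`. -/
theorem lintegral_localCount_le {N m : ℕ} (hN : 0 < N) (hm : 0 < m) (a : Fin N) :
    ∫⁻ v, ENNReal.ofReal ((max 0 (localCount m v (v a) - 1)) ^ 2) ∂(uniformSample N)
      ≤ ENNReal.ofReal (4 / m) := by
  -- the point `v a` is split off; it contributes `tri 0 = 1` and is independent of the others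
  obtain ⟨K, rfl⟩ : ∃ K, N = K + 1 := ⟨N - 1, by omega⟩
  have hm' : (0 : ℝ) < m := by exact_mod_cast hm
  have hm1 : (1 : ℝ) ≤ m := by exact_mod_cast hm
  set lam := volume.restrict (Set.Icc (0 : ℝ) 1) with hlam
  set c : ℝ := ((K + 1 : ℕ) : ℝ) / m with hc
  have hc0 : 0 < c := by positivity
  let G : ℝ × (Fin K → ℝ) → ENNReal := fun z =>
    ENNReal.ofReal ((max 0 ((1 / (m : ℝ)) * (1 + ∑ b, tri (c * (z.2 b - z.1))) - 1)) ^ 2)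
  have htri := continuous_tri
  have hG : Measurable G := by
    refine Measurable.ennreal_ofReal ?_
    fun_prop
  have hmp := measurePreserving_piFinSuccAbove (fun _ : Fin (K + 1) => lam) a
  have e1 : ∫⁻ v, ENNReal.ofReal ((max 0 (localCount m v (v a) - 1)) ^ 2)
      ∂(uniformSample (K + 1)) = ∫⁻ z, G z ∂(lam.prod (uniformSample K)) := by
    have h2 := hmp.lintegral_comp hG
    unfold uniformSample
    rw [← h2]
    refine lintegral_congr fun v => ?_
    simp only [G, localCount, Fin.sum_univ_succAbove _ a, MeasurableEquiv.piFinSuccAbove_apply,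
      Fin.insertNthEquiv_symm_apply, Fin.removeNth, sub_self, mul_zero]
    have h0 : tri 0 = 1 := by simp [tri]
    rw [h0]
  rw [e1, lintegral_prod _ hG.aemeasurable]
  have hx : ∀ x, ∫⁻ w, G (x, w) ∂(uniformSample K) ≤ ENNReal.ofReal (4 / m) := fun x => by
    set g : ℝ → ℝ := fun y => tri (c * (y - x)) with hg
    have hgm : Measurable g := by fun_prop
    have hg0 : ∀ y, 0 ≤ g y := fun y => tri_nonneg _
    have hg1 : ∀ y, g y ≤ 1 := fun y => tri_le_one _
    have hgi : IntegrableOn g (Set.Icc 0 1) := (integrable_tri_comp hc0 x).integrableOn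
    have hI := setIntegral_tri_comp_le hc0 x
    have hI2 : ∫ y in Set.Icc (0 : ℝ) 1, g y ^ 2 ≤ c⁻¹ := by
      refine le_trans (integral_mono_of_nonneg (Eventually.of_forall fun y => sq_nonneg _) hgi
        (Eventually.of_forall fun y => ?_)) hI
      have := hg0 y; have := hg1 y
      simp only; nlinarith
    have hKc : (K : ℝ) * c⁻¹ ≤ m := by
      rw [hc, inv_div, ← mul_div_assoc, div_le_iff₀ (by positivity)]
      push_cast; nlinarith
    have hv := lintegral_sum_sub_sq_le (N := K) hgm (M := 1) fun y => by
      rw [abs_of_nonneg (hg0 y)]; exact hg1 y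
    calc ∫⁻ w, G (x, w) ∂(uniformSample K)
        ≤ ∫⁻ w : Fin K → ℝ, (ENNReal.ofReal (2 / m ^ 2) * ENNReal.ofReal
            ((∑ b, g (w b) - K * ∫ y in Set.Icc (0 : ℝ) 1, g y) ^ 2)
            + ENNReal.ofReal (2 / m ^ 2)) ∂(uniformSample K) := by
          refine lintegral_mono fun w => ?_
          rw [← ENNReal.ofReal_mul (by positivity), ← ENNReal.ofReal_add (by positivity)
            (by positivity)]
          refine ENNReal.ofReal_le_ofReal ?_
          set S := ∑ b, g (w b)
          set μ0 := (K : ℝ) * ∫ y in Set.Icc (0 : ℝ) 1, g y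
          have hμ0 : μ0 ≤ m := (mul_le_mul_of_nonneg_left hI (Nat.cast_nonneg K)).trans hKc
          have h1 : max 0 ((1 / (m : ℝ)) * (1 + S) - 1) ≤ (1 / (m : ℝ)) * (1 + |S - μ0|) := by
            refine max_le (by positivity) ?_
            have : (1 : ℝ) = 1 / m * m := by field_simp
            nth_rewrite 3 [this]
            rw [← mul_sub]
            have := le_abs_self (S - μ0)
            gcongr
            linarith
          calc _ ≤ ((1 / (m : ℝ)) * (1 + |S - μ0|)) ^ 2 := by
                gcongr
            _ ≤ _ := by
                rw [mul_pow, ← sq_abs (S - μ0), div_pow, div_mul_eq_mul_div, div_mul_eq_mul_div,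
                  ← add_div]
                gcongr
                nlinarith [sq_nonneg (1 - |S - μ0|)]
      _ = ENNReal.ofReal (2 / m ^ 2) * (∫⁻ w : Fin K → ℝ, ENNReal.ofReal
            ((∑ b, g (w b) - K * ∫ y in Set.Icc (0 : ℝ) 1, g y) ^ 2) ∂(uniformSample K))
            + ENNReal.ofReal (2 / m ^ 2) := by
          rw [lintegral_add_right _ measurable_const, lintegral_const_mul' _ _ (by simp)]
          simp
      _ ≤ ENNReal.ofReal (2 / m ^ 2) * ENNReal.ofReal m + ENNReal.ofReal (2 / m ^ 2) := by
          gcongr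
          refine hv.trans (ENNReal.ofReal_le_ofReal ?_)
          exact (mul_le_mul_of_nonneg_left hI2 (Nat.cast_nonneg K)).trans hKc
      _ ≤ ENNReal.ofReal (4 / m) := by
          rw [← ENNReal.ofReal_mul (by positivity), ← ENNReal.ofReal_add (by positivity)
            (by positivity)]
          refine ENNReal.ofReal_le_ofReal ?_
          have e : 2 / (m : ℝ) ^ 2 * m + 2 / m ^ 2 = (2 * m + 2) / m ^ 2 := by ring
          rw [e, div_le_div_iff₀ (by positivity) hm']
          nlinarith
  calc ∫⁻ x, ∫⁻ w, G (x, w) ∂(uniformSample K) ∂lam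
      ≤ ∫⁻ _, ENNReal.ofReal (4 / m) ∂lam := lintegral_mono hx
    _ = _ := by simp [hlam]

/-- The amount by which the sample is locally too dense at its `i`-th point; the term `1 / m` makes
up for the point itself, which both windows contain. -/
def defect (m r : ℕ) {N : ℕ} (v : Fin N → ℝ) (i : ℤ) : ℝ :=
  max 0 (localCount m v (censoredStat v r i) - 1) + 1 / m

theorem measurable_localCount (m N : ℕ) :
    Measurable fun z : (Fin N → ℝ) × ℝ => localCount m z.1 z.2 := by
  have := continuous_tri
  unfold localCount
  fun_prop

theorem measurable_localCount_comp (m : ℕ) {N : ℕ} {g : (Fin N → ℝ) → ℝ} (hg : Measurable g) :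
    Measurable fun v : Fin N → ℝ => localCount m v (g v) := by
  have h := measurable_localCount m N
  generalize hF : (fun z : (Fin N → ℝ) × ℝ => localCount m z.1 z.2) = F at h
  have h2 : (fun v : Fin N → ℝ => localCount m v (g v)) = fun v => F (v, g v) := by rw [← hF]
  rw [h2]
  exact h.comp (measurable_id.prodMk hg)

theorem measurable_defect (m r N : ℕ) (i : ℤ) :
    Measurable fun v : Fin N → ℝ => defect m r v i := by
  have h : Measurable fun v : Fin N → ℝ => localCount m v (censoredStat v r i) :=
    measurable_localCount_comp m (measurable_censoredStat r i)
  unfold defect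
  exact (measurable_const.max (h.sub_const _)).add_const _

theorem defect_nonneg (m r : ℕ) {N : ℕ} (v : Fin N → ℝ) (i : ℤ) : 0 ≤ defect m r v i :=
  add_nonneg (le_max_left _ _) (by positivity)

/-- Since the number `m` of points in a window tends to infinity, the sample is rarely too dense. -/
theorem l2Null_defect {n r m : ℕ → ℕ} (h1 : ∀ k, 1 ≤ r k) (hr : ∀ k, r k ≤ n k)
    (hm : Tendsto m atTop atTop) :
    L2Null n fun k v => (1 / (n k : ℝ)) * ∑ i ∈ Finset.Icc (1 : ℤ) (r k),
      defect (m k) (r k) v i := by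
  have hmR : Tendsto (fun k => (m k : ℝ)) atTop atTop := tendsto_natCast_atTop_atTop.comp hm
  have hlc : ∀ k (a : Fin (n k)), Measurable fun v : Fin (n k) → ℝ => localCount (m k) v (v a) :=
    fun k a => measurable_localCount_comp _ (measurable_pi_apply a)
  have hA : L2Null n fun k v => (1 / (n k : ℝ)) * ∑ a,
      max 0 (localCount (m k) v (v a) - 1) := by
    refine L2Null.of_eLpNorm_le (a := fun k => √(4 / m k)) (fun k => ?_) ?_ ?_
    · exact (Finset.measurable_sum _ fun a _ =>
        measurable_const.max ((hlc k a).sub_const _)).const_mul _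
    · have : Tendsto (fun k => (4 : ℝ) / m k) atTop (𝓝 0) := tendsto_const_nhds.div_atTop hmR
      simpa using this.sqrt
    · filter_upwards [hm.eventually_gt_atTop 0] with k hk
      have hN : 0 < n k := (h1 k).trans (hr k)
      have hN' : (0 : ℝ) < n k := by exact_mod_cast hN
      refine eLpNorm_two_le_of_lintegral_sq_le (Real.sqrt_nonneg _) ?_
      rw [Real.sq_sqrt (by positivity)]
      calc _ ≤ ∫⁻ v : Fin (n k) → ℝ, ENNReal.ofReal (1 / (n k : ℝ)) * ∑ a, ENNReal.ofReal
            ((max 0 (localCount (m k) v (v a) - 1)) ^ 2) ∂(uniformSample (n k)) := by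
            refine lintegral_mono fun v => ?_
            rw [← ENNReal.ofReal_sum_of_nonneg (fun a _ => sq_nonneg _),
              ← ENNReal.ofReal_mul (by positivity)]
            refine ENNReal.ofReal_le_ofReal ?_
            have hs := sq_sum_le_card_mul_sum_sq (s := Finset.univ)
              (f := fun a : Fin (n k) => max 0 (localCount (m k) v (v a) - 1))
            rw [Finset.card_univ, Fintype.card_fin] at hs
            rw [mul_pow]
            calc _ ≤ (1 / (n k : ℝ)) ^ 2 * _ := mul_le_mul_of_nonneg_left hs (by positivity)
              _ = _ := by field_simp
        _ = ENNReal.ofReal (1 / (n k : ℝ)) * ∑ a, ∫⁻ v : Fin (n k) → ℝ, ENNReal.ofReal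
            ((max 0 (localCount (m k) v (v a) - 1)) ^ 2) ∂(uniformSample (n k)) := by
            rw [lintegral_const_mul' _ _ (by simp), lintegral_finsetSum]
            exact fun a _ =>
              ((measurable_const.max ((hlc k a).sub_const _)).pow_const 2).ennreal_ofReal
        _ ≤ ENNReal.ofReal (1 / (n k : ℝ)) * ∑ _a : Fin (n k), ENNReal.ofReal (4 / m k) := by
            gcongr with a
            exact lintegral_localCount_le hN hk a
        _ = ENNReal.ofReal (4 / m k) := by
            rw [Finset.sum_const, Finset.card_univ, Fintype.card_fin, nsmul_eq_mul, ← mul_assoc,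
              ← ENNReal.ofReal_natCast, ← ENNReal.ofReal_mul (by positivity),
              one_div_mul_cancel hN'.ne', ENNReal.ofReal_one, one_mul]
  have hB : L2Null n fun k _ => 1 / (m k : ℝ) :=
    L2Null.of_const (tendsto_const_nhds.div_atTop hmR)
  refine (hA.add hB).mono (fun k => ?_) (Eventually.of_forall fun k =>
    Eventually.of_forall fun v => ?_)
  · exact (Finset.measurable_sum _ fun i _ => measurable_defect _ _ _ i).const_mul _
  · have hN' : (0 : ℝ) < n k := by exact_mod_cast (h1 k).trans (hr k)
    have hs := sum_censoredStat_le v (hr k)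
      (ψ := fun x => max 0 (localCount (m k) v x - 1)) fun _ => le_max_left _ _
    have hn0 : (0 : ℝ) ≤ 1 / (n k : ℝ) := by positivity
    rw [abs_of_nonneg (mul_nonneg hn0 (Finset.sum_nonneg fun i _ => defect_nonneg _ _ _ _))]
    refine le_trans ?_ (le_abs_self _)
    have e : ∑ i ∈ Finset.Icc (1 : ℤ) (r k), defect (m k) (r k) v i
        = ∑ i ∈ Finset.Icc (1 : ℤ) (r k),
          max 0 (localCount (m k) v (censoredStat v (r k) i) - 1) + r k * (1 / m k) := by
      simp only [defect, Finset.sum_add_distrib, Finset.sum_const, nsmul_eq_mul]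
      simp
    rw [e, mul_add]
    refine add_le_add (mul_le_mul_of_nonneg_left hs hn0) ?_
    have hrn : (r k : ℝ) ≤ n k := by exact_mod_cast hr k
    calc 1 / (n k : ℝ) * (r k * (1 / m k)) ≤ 1 / (n k : ℝ) * (n k * (1 / m k)) := by gcongr
      _ = 1 / m k := by field_simp

/-- Away from the ends the window drop of the uniform order statistics is at least its typical
size, up to the local excess of sample points. -/
theorem one_sub_defect_le {N m r : ℕ} (hm : 0 < m) (hr : r ≤ N) {v : Fin N → ℝ}
    {i : ℤ} (hi1 : (m : ℤ) + 2 ≤ i) (hi2 : i - 1 + m ≤ r) :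
    1 - defect m r v i ≤ (N : ℝ) / m * gap m (fun j => -censoredStat v r j) i := by
  have hm' : (0 : ℝ) < m := by exact_mod_cast hm
  have hN' : (0 : ℝ) < N := by exact_mod_cast (by omega : 0 < N)
  set c := censoredStat v r with hcdef
  set q : ℤ → ℝ := fun j => tri ((N : ℝ) / m * (c j - c i)) with hq
  have hq0 : ∀ j, 0 ≤ q j := fun j => tri_nonneg _
  have hqi : q i = 1 := by simp [hq, tri]
  have hup : 1 - (1 / (m : ℝ)) * ∑ s ∈ Finset.range m, q (i + s)
      ≤ (N : ℝ) / m * (upAvg m c i - c i) := by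
    have e1 : (N : ℝ) / m * (upAvg m c i - c i)
        = (1 / (m : ℝ)) * ∑ s ∈ Finset.range m, ((N : ℝ) / m * (c (i + s) - c i)) := by
      rw [← Finset.mul_sum, Finset.sum_sub_distrib, upAvg]
      simp; field_simp
    have e2 : 1 - (1 / (m : ℝ)) * ∑ s ∈ Finset.range m, q (i + s)
        = (1 / (m : ℝ)) * ∑ s ∈ Finset.range m, (1 - q (i + s)) := by
      rw [Finset.sum_sub_distrib]; simp; field_simp
    rw [e1, e2]
    gcongr with s hs
    have h1 : 1 - |(N : ℝ) / m * (c (i + s) - c i)| ≤ q (i + s) := le_max_right _ _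
    have h2 : c i ≤ c (i + s) := censoredStat_mono v (by omega) hr (by omega)
    rw [abs_of_nonneg (mul_nonneg (by positivity) (sub_nonneg.2 h2))] at h1
    linarith
  have hlo : 1 - (1 / (m : ℝ)) * ∑ t ∈ Finset.range (m + 2), q (i - t)
      ≤ (N : ℝ) / m * (c i - loAvg m c i) := by
    have e1 : (N : ℝ) / m * (c i - loAvg m c i)
        = (1 / ((m : ℝ) + 2)) * ∑ t ∈ Finset.range (m + 2), ((N : ℝ) / m * (c i - c (i - t))) := by
      rw [← Finset.mul_sum, Finset.sum_sub_distrib, loAvg]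
      simp; field_simp
    have e2 : 1 - (1 / ((m : ℝ) + 2)) * ∑ t ∈ Finset.range (m + 2), q (i - t)
        = (1 / ((m : ℝ) + 2)) * ∑ t ∈ Finset.range (m + 2), (1 - q (i - t)) := by
      rw [Finset.sum_sub_distrib]; simp; field_simp
    have e3 : (1 / ((m : ℝ) + 2)) * ∑ t ∈ Finset.range (m + 2), q (i - t)
        ≤ (1 / (m : ℝ)) * ∑ t ∈ Finset.range (m + 2), q (i - t) := by
      refine mul_le_mul_of_nonneg_right ?_ (Finset.sum_nonneg fun t _ => hq0 _)
      exact one_div_le_one_div_of_le hm' (by linarith)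
    refine (sub_le_sub_left e3 1).trans ?_
    rw [e1, e2]
    gcongr with s hs
    have h1 : 1 - |(N : ℝ) / m * (c (i - s) - c i)| ≤ q (i - s) := le_max_right _ _
    have h2 : c (i - s) ≤ c i := censoredStat_mono v (by omega) hr (by omega)
    rw [abs_of_nonpos (mul_nonpos_of_nonneg_of_nonpos (by positivity) (sub_nonpos.2 h2))] at h1
    linarith
  have hsum : ∑ s ∈ Finset.range m, q (i + s) + ∑ t ∈ Finset.range (m + 2), q (i - t)
      ≤ m * localCount m v (c i) + 1 := by
    have e1 : (m : ℝ) * localCount m v (c i)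
        = ∑ j ∈ Finset.Icc 1 N, tri ((N : ℝ) / m * (orderStat v j - c i)) := by
      rw [sum_orderStat v (fun y => tri ((N : ℝ) / m * (y - c i))), localCount]
      field_simp
    have e2 : ∑ s ∈ Finset.range m, q (i + s) = 1 + ∑ s ∈ Finset.range (m - 1), q (i + s + 1) := by
      obtain ⟨m', rfl⟩ : ∃ m', m = m' + 1 := ⟨m - 1, by omega⟩
      rw [Finset.sum_range_succ', Nat.add_sub_cancel, add_comm]
      congr 1
      · simpa using hqi
      · refine Finset.sum_congr rfl fun s _ => ?_
        congr 1; push_cast; ring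
    have e3 : ∑ s ∈ Finset.range (m - 1), q (i + s + 1) + ∑ t ∈ Finset.range (m + 2), q (i - t)
        = ∑ j ∈ Finset.Icc (i - 1 - m) (i - 1 + m), q j := by
      have u : Finset.Icc (i - 1 - m) (i - 1 + m)
          = Finset.Icc (i + 1) (i - 1 + m) ∪ Finset.Icc (i - 1 - m) i := by
        ext j; simp only [Finset.mem_union, Finset.mem_Icc]; omega
      have d : Disjoint (Finset.Icc (i + 1) (i - 1 + m)) (Finset.Icc (i - 1 - m) i) := by
        rw [Finset.disjoint_left]; intro j; simp only [Finset.mem_Icc]; omega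
      rw [u, Finset.sum_union d]
      congr 1
      · refine Finset.sum_nbij' (fun s => i + s + 1) (fun j => (j - i - 1).toNat) ?_ ?_ ?_ ?_ ?_ <;>
          intro j hj <;> simp only [Finset.mem_Icc, Finset.mem_range] at * <;> omega
      · refine Finset.sum_nbij' (fun s => i - s) (fun j => (i - j).toNat) ?_ ?_ ?_ ?_ ?_ <;>
          intro j hj <;> simp only [Finset.mem_Icc, Finset.mem_range] at * <;> omega
    have e4 : ∑ j ∈ Finset.Icc (i - 1 - m) (i - 1 + m), q j
        = ∑ j ∈ Finset.Icc (i - 1 - m).toNat (i - 1 + m).toNat,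
          tri ((N : ℝ) / m * (orderStat v j - c i)) := by
      refine Finset.sum_nbij' (fun j => j.toNat) (fun j => (j : ℤ)) ?_ ?_ ?_ ?_ ?_
      · intro j hj; simp only [Finset.mem_Icc] at *; omega
      · intro j hj; simp only [Finset.mem_Icc] at *; omega
      · intro j hj; simp only [Finset.mem_Icc] at *; omega
      · intro j hj; simp only [Finset.mem_Icc] at *; omega
      · intro j hj
        simp only [Finset.mem_Icc] at hj
        simp only [hq, hcdef]
        rw [censoredStat_of_mem v (i := j) (by omega) (by omega)]
    have e5 : ∑ j ∈ Finset.Icc (i - 1 - m).toNat (i - 1 + m).toNat,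
          tri ((N : ℝ) / m * (orderStat v j - c i))
        ≤ ∑ j ∈ Finset.Icc 1 N, tri ((N : ℝ) / m * (orderStat v j - c i)) :=
      Finset.sum_le_sum_of_subset_of_nonneg
        (Finset.Icc_subset_Icc (by omega) (by omega)) fun j _ _ => tri_nonneg _
    linarith
  have hgap : gap m (fun j => -c j) i = (upAvg m c i - c i) + (c i - loAvg m c i) := by
    simp only [gap, loAvg, upAvg, Finset.sum_neg_distrib]; ring
  have hd : localCount m v (c i) - 1 + 1 / m ≤ defect m r v i :=
    add_le_add (le_max_right _ _) le_rfl
  rw [hgap, mul_add]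
  have h3 : (1 / (m : ℝ)) * ∑ s ∈ Finset.range m, q (i + s)
      + (1 / (m : ℝ)) * ∑ t ∈ Finset.range (m + 2), q (i - t)
      ≤ localCount m v (c i) + 1 / m := by
    rw [← mul_add]
    calc _ ≤ (1 / (m : ℝ)) * (m * localCount m v (c i) + 1) := by gcongr
      _ = _ := by field_simp
  linarith

end

noncomputable section

/-! ### The logarithmic derivative of the quantile function -/

variable {μ : Measure ℝ} {f : ℝ → ℝ}

/-- The logarithm of the derivative `1 / (f (Q p) * Q p ^ 2)` of `-1 / Q`, where `Q` is the quantile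
function of the distribution `μ` with density `f`; it is extended by `0` to all of `ℝ`. -/
def logDerivInv (μ : Measure ℝ) (f : ℝ → ℝ) : ℝ → ℝ :=
  (Set.Ioo (0 : ℝ) 1).indicator fun p =>
    -Real.log (f (quantile μ p)) - 2 * Real.log (quantile μ p)

theorem ae_log_deriv_quantile [IsProbabilityMeasure μ] (hf_meas : Measurable f)
    (hf_nonneg : ∀ x, 0 ≤ f x) (hf : μ = volume.withDensity (fun x => ENNReal.ofReal (f x))) :
    ∀ᵐ p ∂(volume.restrict (Set.Icc (0 : ℝ) 1)),
      Real.log (deriv (quantile μ) p) = -Real.log (f (quantile μ p)) := by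
  filter_upwards [ae_deriv_quantile hf_meas hf_nonneg hf] with p hp
  rw [← Real.log_inv, eq_inv_of_mul_eq_one_right hp]

theorem integrable_log_density_quantile [IsProbabilityMeasure μ] (hf_meas : Measurable f)
    (hf_nonneg : ∀ x, 0 ≤ f x) (hf : μ = volume.withDensity (fun x => ENNReal.ofReal (f x)))
    (hent : Integrable (fun x => f x * Real.log (f x)) volume) :
    Integrable (fun x => Real.log (f x)) μ := by
  rw [hf]
  rw [integrable_withDensity_iff_integrable_smul' (by fun_prop) (by simp)]
  refine hent.congr (.of_forall fun x => ?_)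
  simp [hf_nonneg x]

theorem integrable_log_deriv_quantile [IsProbabilityMeasure μ] (hf_meas : Measurable f)
    (hf_nonneg : ∀ x, 0 ≤ f x) (hf : μ = volume.withDensity (fun x => ENNReal.ofReal (f x)))
    (hent : Integrable (fun x => f x * Real.log (f x)) volume) :
    Integrable (fun p => Real.log (deriv (quantile μ) p))
      (volume.restrict (Set.Icc (0 : ℝ) 1)) := by
  have h1 := integrable_log_density_quantile hf_meas hf_nonneg hf hent
  have h2 := (measurePreserving_quantile (μ := μ)).integrable_comp_of_integrable h1
  refine h2.neg.congr ?_
  filter_upwards [ae_log_deriv_quantile hf_meas hf_nonneg hf] with p hp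
  simp [hp]

theorem memLp_log_quantile [IsProbabilityMeasure μ]
    (hlog : Integrable (fun x => Real.log x ^ 2) μ) :
    MemLp (fun p => Real.log (quantile μ p)) 2 (volume.restrict (Set.Icc (0 : ℝ) 1)) := by
  have h1 : MemLp Real.log 2 μ :=
    (memLp_two_iff_integrable_sq Real.measurable_log.aestronglyMeasurable).2 hlog
  exact h1.comp_measurePreserving measurePreserving_quantile

theorem memLp_log_toIoo_quantile [IsProbabilityMeasure μ] (hpos : ∀ᵐ x ∂μ, 0 < x)
    (hlog : Integrable (fun x => Real.log x ^ 2) μ) :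
    MemLp (fun p => Real.log (quantile μ p / (1 + quantile μ p))) 2
      (volume.restrict (Set.Icc (0 : ℝ) 1)) := by
  have hQ := measurable_quantile (μ := μ)
  have hm : Measurable fun p => Real.log (quantile μ p / (1 + quantile μ p)) := by fun_prop
  have h2 : MemLp (fun _ : ℝ => Real.log 2) 2 (volume.restrict (Set.Icc (0 : ℝ) 1)) :=
    memLp_const _
  refine ((memLp_log_quantile hlog).abs.add h2).mono' hm.aestronglyMeasurable ?_
  filter_upwards [ae_mem_Ioo] with p hp
  have hq := quantile_pos hpos hp
  set x := quantile μ p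
  have h3 : Real.log (1 + x) ≤ max 0 (Real.log x) + Real.log 2 := by
    rcases le_total x 1 with h | h
    · have := Real.log_le_log (by linarith) (by linarith : 1 + x ≤ 2)
      linarith [le_max_left 0 (Real.log x)]
    · have := Real.log_le_log (by linarith) (by linarith : 1 + x ≤ x * 2)
      rw [Real.log_mul (by positivity) (by norm_num)] at this
      linarith [le_max_right 0 (Real.log x)]
  have h4 : Real.log x ≤ Real.log (1 + x) := Real.log_le_log hq (by linarith)
  have h5 : 0 ≤ Real.log (1 + x) := Real.log_nonneg (by linarith)
  rw [Real.log_div (by positivity) (by positivity), Real.norm_eq_abs]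
  change _ ≤ |Real.log x| + Real.log 2
  have h6 := Real.log_nonneg (by norm_num : (1 : ℝ) ≤ 2)
  rcases le_total 0 (Real.log x) with h | h
  · rw [max_eq_right h] at h3
    rw [abs_of_nonneg h, abs_le]; constructor <;> linarith
  · rw [max_eq_left h] at h3
    rw [abs_of_nonpos h, abs_le]; constructor <;> linarith

theorem measurable_logDerivInv (hf_meas : Measurable f) : Measurable (logDerivInv μ f) := by
  have hQ := measurable_quantile (μ := μ)
  exact Measurable.indicator (by fun_prop) measurableSet_Ioo

theorem integrable_logDerivInv [IsProbabilityMeasure μ] (hf_meas : Measurable f)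
    (hf_nonneg : ∀ x, 0 ≤ f x) (hf : μ = volume.withDensity (fun x => ENNReal.ofReal (f x)))
    (hent : Integrable (fun x => f x * Real.log (f x)) volume)
    (hlog : Integrable (fun x => Real.log x ^ 2) μ) :
    Integrable (logDerivInv μ f) := by
  have h1 := integrable_log_density_quantile hf_meas hf_nonneg hf hent
  have h2 := (measurePreserving_quantile (μ := μ)).integrable_comp_of_integrable h1
  have h3 := (memLp_log_quantile hlog).integrable (by norm_num)
  rw [logDerivInv, integrable_indicator_iff measurableSet_Ioo, IntegrableOn,
    restrict_Ioo_eq_restrict_Icc]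
  exact h2.neg.sub (h3.const_mul 2)

theorem ae_exp_logDerivInv [IsProbabilityMeasure μ] (hf_meas : Measurable f)
    (hf_nonneg : ∀ x, 0 ≤ f x) (hf : μ = volume.withDensity (fun x => ENNReal.ofReal (f x)))
    (hpos : ∀ᵐ x ∂μ, 0 < x) :
    ∀ᵐ p ∂(volume.restrict (Set.Icc (0 : ℝ) 1)),
      Real.exp (logDerivInv μ f p) = 1 / (f (quantile μ p) * quantile μ p ^ 2) := by
  filter_upwards [ae_deriv_quantile hf_meas hf_nonneg hf, ae_mem_Ioo] with p hp hp1
  have hQ := quantile_pos hpos hp1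
  have hfp : 0 < f (quantile μ p) :=
    lt_of_le_of_ne (hf_nonneg _) fun h => by rw [← h] at hp; simp at hp
  rw [logDerivInv, Set.indicator_of_mem hp1, Real.exp_sub, Real.exp_neg, Real.exp_log hfp,
    mul_comm 2, Real.exp_mul, Real.exp_log hQ]
  norm_cast
  field_simp

theorem integral_exp_logDerivInv_le [IsProbabilityMeasure μ] (hf_meas : Measurable f)
    (hf_nonneg : ∀ x, 0 ≤ f x) (hf : μ = volume.withDensity (fun x => ENNReal.ofReal (f x)))
    (hpos : ∀ᵐ x ∂μ, 0 < x) {p q : ℝ} (hp : p ∈ Set.Ioo (0 : ℝ) 1) (hq : q ∈ Set.Ioo (0 : ℝ) 1)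
    (hpq : p ≤ q) :
    IntegrableOn (fun u => Real.exp (logDerivInv μ f u)) (Set.Ioc p q) ∧
    ∫ u in Set.Ioc p q, Real.exp (logDerivInv μ f u) ≤ (quantile μ p)⁻¹ - (quantile μ q)⁻¹ := by
  have hsub : Set.Ioc p q ⊆ Set.Icc 0 1 := fun u hu => ⟨hp.1.le.trans hu.1.le, hu.2.trans hq.2.le⟩
  have h1 := ae_restrict_of_ae_restrict_of_subset hsub
    (ae_exp_logDerivInv hf_meas hf_nonneg hf hpos)
  have h2 := lintegral_density_inv_le hf_meas hf_nonneg hf hpos hp hq hpq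
  have hQ := quantile_pos hpos hp
  have h3 : 0 ≤ (quantile μ p)⁻¹ - (quantile μ q)⁻¹ :=
    sub_nonneg.2 (inv_anti₀ hQ
      ((quantile_strictMonoOn (absolutelyContinuous_of_density hf)).monotoneOn hp hq hpq))
  have h4 : ∫⁻ u in Set.Ioc p q, ENNReal.ofReal (Real.exp (logDerivInv μ f u))
      ≤ ENNReal.ofReal ((quantile μ p)⁻¹ - (quantile μ q)⁻¹) := by
    refine le_trans (le_of_eq (lintegral_congr_ae ?_)) h2
    filter_upwards [h1] with u hu
    rw [hu]
  have hm : Measurable fun u => Real.exp (logDerivInv μ f u) :=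
    (measurable_logDerivInv hf_meas).exp
  have h5 : IntegrableOn (fun u => Real.exp (logDerivInv μ f u)) (Set.Ioc p q) := by
    refine ⟨hm.aestronglyMeasurable, ?_⟩
    rw [hasFiniteIntegral_iff_ofReal (.of_forall fun u => (Real.exp_pos _).le)]
    exact h4.trans_lt ENNReal.ofReal_lt_top
  refine ⟨h5, ?_⟩
  rw [← ENNReal.ofReal_le_ofReal_iff h3, ofReal_integral_eq_lintegral_ofReal h5
    (.of_forall fun u => (Real.exp_pos _).le)]
  exact h4

/-- Jensen's inequality in its tangent line form: for every `l` the increment of `-1 / Q` is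
bounded below by an affine function of the integral of the logarithm of its derivative. -/
theorem exp_mul_le_sub_inv_quantile [IsProbabilityMeasure μ] (hf_meas : Measurable f)
    (hf_nonneg : ∀ x, 0 ≤ f x) (hf : μ = volume.withDensity (fun x => ENNReal.ofReal (f x)))
    (hpos : ∀ᵐ x ∂μ, 0 < x) (hφ : Integrable (logDerivInv μ f)) {p q : ℝ}
    (hp : p ∈ Set.Ioo (0 : ℝ) 1) (hq : q ∈ Set.Ioo (0 : ℝ) 1) (hpq : p ≤ q) (l : ℝ) :
    Real.exp l * ((1 - l) * (q - p) + ∫ u in p..q, logDerivInv μ f u)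
      ≤ (quantile μ p)⁻¹ - (quantile μ q)⁻¹ := by
  obtain ⟨h1, h2⟩ := integral_exp_logDerivInv_le hf_meas hf_nonneg hf hpos hp hq hpq
  refine le_trans ?_ h2
  have h3 : IntegrableOn (logDerivInv μ f) (Set.Ioc p q) := hφ.integrableOn
  have h4 : IntegrableOn (fun _ : ℝ => 1 - l) (Set.Ioc p q) := integrableOn_const (by simp)
  have h5 : Real.exp l * ((1 - l) * (q - p) + ∫ u in p..q, logDerivInv μ f u)
      = ∫ u in Set.Ioc p q, Real.exp l * ((1 - l) + logDerivInv μ f u) := by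
    rw [integral_const_mul, integral_add h4 h3, intervalIntegral.integral_of_le hpq]
    simp [hpq, mul_comm]
  rw [h5]
  refine integral_mono ((h4.add h3).const_mul _) h1 fun u => ?_
  have := Real.add_one_le_exp (logDerivInv μ f u - l)
  rw [Real.exp_sub, le_div_iff₀ (Real.exp_pos _)] at this
  change Real.exp l * (1 - l + logDerivInv μ f u) ≤ Real.exp (logDerivInv μ f u)
  linarith

end

noncomputable section

/-! ### Local averages over the windows of the estimator -/

theorem gap_linear (m : ℕ) (a b : ℤ → ℝ) (α β : ℝ) (i : ℤ) :
    gap m (fun j => α * a j + β * b j) i = α * gap m a i + β * gap m b i := by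
  simp only [gap, loAvg, upAvg, Finset.sum_add_distrib, ← Finset.mul_sum]
  ring

theorem gap_neg (m : ℕ) (a : ℤ → ℝ) (i : ℤ) : gap m (fun j => -a j) i = -gap m a i := by
  simp only [gap, loAvg, upAvg, Finset.sum_neg_distrib]
  ring

theorem measurable_gap {α : Type*} [MeasurableSpace α] (m : ℕ) {a : ℤ → α → ℝ}
    (ha : ∀ j, Measurable (a j)) (i : ℤ) : Measurable fun x => gap m (fun j => a j x) i := by
  unfold gap loAvg upAvg
  exact ((Finset.measurable_fun_sum _ fun t _ => ha _).div_const _).sub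
    ((Finset.measurable_fun_sum _ fun t _ => ha _).div_const _)

theorem neg_primitive_sub {g : ℝ → ℝ} (hg : Integrable g) (a b : ℝ) :
    (-∫ u in (0 : ℝ)..a, g u) - (-∫ u in (0 : ℝ)..b, g u) = ∫ u in a..b, g u := by
  have := intervalIntegral.integral_interval_sub_left (a := 0) (b := b) (c := a) (μ := volume)
    hg.intervalIntegrable hg.intervalIntegrable
  linarith

/-- The average of `φ` with respect to the window density
`p ↦ gap m (fun j => 𝟙 (c j < p)) i`, whose total mass is `gap m (-c) i`. -/
def kerAvg (m : ℕ) (φ : ℝ → ℝ) (c : ℤ → ℝ) (i : ℤ) : ℝ :=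
  gap m (fun j => -∫ u in (0 : ℝ)..c j, φ u) i / gap m (fun j => -c j) i

theorem kerAvg_add {φ ψ : ℝ → ℝ} (hφ : Integrable φ) (hψ : Integrable ψ) (m : ℕ) (c : ℤ → ℝ)
    (i : ℤ) : kerAvg m (fun u => φ u + ψ u) c i = kerAvg m φ c i + kerAvg m ψ c i := by
  rw [kerAvg, kerAvg, kerAvg, ← add_div]
  congr 1
  have := gap_linear m (fun j => -∫ u in (0 : ℝ)..c j, φ u) (fun j => -∫ u in
      (0 : ℝ)..c j, ψ u) 1 1 i
  rw [one_mul, one_mul] at this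
  rw [← this]
  congr 1
  ext j
  rw [intervalIntegral.integral_add hφ.intervalIntegrable hψ.intervalIntegrable]
  ring

theorem measurable_kerAvg_censoredStat {N : ℕ} {φ : ℝ → ℝ} (hφ : Integrable φ) (m r : ℕ) (i : ℤ) :
    Measurable fun v : Fin N → ℝ => kerAvg m φ (censoredStat v r) i := by
  have h1 : Continuous fun s : ℝ => ∫ u in (0 : ℝ)..s, φ u :=
    intervalIntegral.continuous_primitive (fun a b => hφ.intervalIntegrable) 0
  unfold kerAvg
  exact (measurable_gap m (fun j => (h1.measurable.comp (measurable_censoredStat r j)).neg) i).div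
    (measurable_gap m (fun j => (measurable_censoredStat r j).neg) i)

/-- Jensen's inequality for the window density. -/
theorem gap_mul_exp_kerAvg_le {m : ℕ} (hm : 0 < m) {φ : ℝ → ℝ} (hφ : Integrable φ) {c y : ℤ → ℝ}
    (hJ : ∀ k l, k ≤ l → ∀ s, Real.exp s * ((1 - s) * (c l - c k) + ∫ u in c k..c l, φ u)
      ≤ y k - y l) {i : ℤ} (hi : 0 < gap m (fun j => -c j) i) :
    gap m (fun j => -c j) i * Real.exp (kerAvg m φ c i) ≤ gap m y i := by
  set s := kerAvg m φ c i with hs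
  have h1 : gap m (fun j => Real.exp s * (1 - s) * -c j + Real.exp s * -∫ u in (0 : ℝ)..c j, φ u) i
      ≤ gap m y i := by
    have := mul_gap_le hm (a := fun j => Real.exp s * (1 - s) * -c j
      + Real.exp s * -∫ u in (0 : ℝ)..c j, φ u) (b := y) (i := i) (γ := 1) fun k l _ hkl _ => by
        refine le_trans (le_of_eq ?_) (hJ k l hkl s)
        rw [← neg_primitive_sub hφ (c k) (c l)]
        ring
    rwa [one_mul] at this
  rw [gap_linear] at h1
  have h2 : gap m (fun j => -∫ u in (0 : ℝ)..c j, φ u) i = s * gap m (fun j => -c j) i := by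
    rw [hs, kerAvg]; field_simp
  rw [h2] at h1
  linarith

theorem abs_kerAvg_le {m : ℕ} (hm : 0 < m) {φ : ℝ → ℝ} (hφ : Integrable φ) {c : ℤ → ℝ}
    (hc : Monotone c) (i : ℤ) :
    |kerAvg m φ c i| ≤ gap m (fun j => -∫ u in (0 : ℝ)..c j, |φ u|) i / gap m
        (fun j => -c j) i := by
  have h0 : 0 ≤ gap m (fun j => -c j) i := gap_nonneg hm hc.neg i
  have key : |gap m (fun j => -∫ u in (0 : ℝ)..c j, φ u) i|
      ≤ gap m (fun j => -∫ u in (0 : ℝ)..c j, |φ u|) i := by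
    have h1 := mul_gap_le hm (a := fun j => -∫ u in (0 : ℝ)..c j, φ u)
      (b := fun j => -∫ u in (0 : ℝ)..c j, |φ u|) (i := i) (γ := 1) fun k l _ hkl _ => by
        rw [one_mul, neg_primitive_sub hφ, neg_primitive_sub hφ.abs]
        exact (le_abs_self _).trans (intervalIntegral.abs_integral_le_integral_abs (hc hkl))
    have h2 := mul_gap_le hm (a := fun j => -∫ u in (0 : ℝ)..c j, φ u)
      (b := fun j => -∫ u in (0 : ℝ)..c j, |φ u|) (i := i) (γ := -1) fun k l _ hkl _ => by
        rw [neg_primitive_sub hφ, neg_primitive_sub hφ.abs, neg_one_mul]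
        exact (neg_le_abs _).trans (intervalIntegral.abs_integral_le_integral_abs (hc hkl))
    exact abs_le.2 ⟨by linarith, by linarith⟩
  rw [kerAvg, abs_div, abs_of_nonneg h0]
  gcongr

/-- When the windows are not too short, averaging over windows is bounded in `L¹`: the windows
overlap at most `m` times on average. -/
theorem sum_abs_kerAvg_le {N m r : ℕ} (hN : 0 < N) (hm : 0 < m) {φ : ℝ → ℝ} (hφ : Integrable φ)
    {c : ℤ → ℝ} (hc : Monotone c) (h1 : ∀ i, c 1 ≤ c i) (hr : ∀ i, c i ≤ c r) {w : ℤ → ℝ}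
    (hw1 : ∀ i, w i ≤ 1)
    (hw : ∀ i, w i ≠ 0 → (m : ℝ) / (2 * N) ≤ gap m (fun j => -c j) i) :
    (1 / (N : ℝ)) * ∑ i ∈ Finset.Icc (1 : ℤ) r, w i * |kerAvg m φ c i| ≤ 2 * ∫ u, |φ u| := by
  have hmono : Antitone fun j => -∫ u in (0 : ℝ)..c j, |φ u| := by
    intro k l hkl
    rw [← sub_nonneg, neg_primitive_sub hφ.abs]
    exact intervalIntegral.integral_nonneg (hc hkl) fun _ _ => abs_nonneg _
  have h2 : ∀ i, w i * |kerAvg m φ c i|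
      ≤ (2 * N / m) * gap m (fun j => -∫ u in (0 : ℝ)..c j, |φ u|) i := by
    intro i
    have hg := gap_nonneg hm hmono i
    by_cases hi : w i = 0
    · rw [hi, zero_mul]; positivity
    · have h3 := hw i hi
      have h4 : 0 < (m : ℝ) / (2 * N) := by positivity
      calc w i * |kerAvg m φ c i| ≤ 1 * |kerAvg m φ c i| := by gcongr; exact hw1 i
        _ ≤ gap m (fun j => -∫ u in (0 : ℝ)..c j, |φ u|) i / gap m (fun j => -c j) i := by
          rw [one_mul]; exact abs_kerAvg_le hm hφ hc i
        _ ≤ gap m (fun j => -∫ u in (0 : ℝ)..c j, |φ u|) i / ((m : ℝ) / (2 * N)) := by gcongr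
        _ = _ := by field_simp
  have h3 := sum_gap_le hm (a := fun j => -∫ u in (0 : ℝ)..c j, |φ u|) (r := r)
    (fun i => by
      rw [← sub_nonneg, neg_primitive_sub hφ.abs]
      exact intervalIntegral.integral_nonneg (h1 i) fun _ _ => abs_nonneg _)
    (fun i => by
      rw [← sub_nonneg, neg_primitive_sub hφ.abs]
      exact intervalIntegral.integral_nonneg (hr i) fun _ _ => abs_nonneg _)
  have h4 : (-∫ u in (0 : ℝ)..c 1, |φ u|) - (-∫ u in (0 : ℝ)..c r, |φ u|) ≤ ∫ u, |φ u| := by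
    rw [neg_primitive_sub hφ.abs, intervalIntegral.integral_of_le (h1 r)]
    exact setIntegral_le_integral hφ.abs (.of_forall fun _ => abs_nonneg _)
  calc (1 / (N : ℝ)) * ∑ i ∈ Finset.Icc (1 : ℤ) r, w i * |kerAvg m φ c i|
      ≤ (1 / (N : ℝ)) * ∑ i ∈ Finset.Icc (1 : ℤ) r,
          (2 * N / m) * gap m (fun j => -∫ u in (0 : ℝ)..c j, |φ u|) i := by
        exact mul_le_mul_of_nonneg_left (Finset.sum_le_sum fun i _ => h2 i) (by positivity)
    _ ≤ (1 / (N : ℝ)) * ((2 * N / m) * (m * ∫ u, |φ u|)) := by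
        rw [← Finset.mul_sum]; gcongr; exact h3.trans (by gcongr)
    _ = 2 * ∫ u, |φ u| := by field_simp

theorem abs_kerAvg_sub_le {m : ℕ} (hm : 0 < m) {g : ℝ → ℝ} (hg : Integrable g) {ε C : ℝ}
    (hgε : ∀ x y, |g x - g y| ≤ ε + C * |x - y|) (hC : 0 ≤ C) {c : ℤ → ℝ} (hc : Monotone c) {i : ℤ}
    (hi : 0 < gap m (fun j => -c j) i) :
    |kerAvg m g c i - g (c i)| ≤ ε + C * (c (i - 1 + m) - c (i - 1 - m)) := by
  set K := ε + C * (c (i - 1 + m) - c (i - 1 - m))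
  have hK : ∀ u ∈ Set.Icc (c (i - 1 - m)) (c (i - 1 + m)), |g u - g (c i)| ≤ K := by
    intro u hu
    refine (hgε u (c i)).trans ?_
    have h1 : c (i - 1 - m) ≤ c i := hc (by omega)
    have h2 : c i ≤ c (i - 1 + m) := hc (by omega)
    have : |u - c i| ≤ c (i - 1 + m) - c (i - 1 - m) :=
      abs_le.2 ⟨by linarith [hu.1], by linarith [hu.2]⟩
    simp only [K]; gcongr
  have hb : ∀ k l : ℤ, i - 1 - m ≤ k → k ≤ l → l ≤ i - 1 + m →
      (g (c i) - K) * (c l - c k) ≤ ∫ u in c k..c l, g u ∧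
      ∫ u in c k..c l, g u ≤ (g (c i) + K) * (c l - c k) := by
    intro k l h1 h2 h3
    have hconst : ∀ a : ℝ, a * (c l - c k) = ∫ _ in c k..c l, a := fun a => by
      rw [intervalIntegral.integral_const, smul_eq_mul, mul_comm]
    have hmem : ∀ u ∈ Set.Icc (c k) (c l), |g u - g (c i)| ≤ K := fun u hu =>
      hK u ⟨(hc h1).trans hu.1, hu.2.trans (hc h3)⟩
    constructor
    · rw [hconst]
      exact intervalIntegral.integral_mono_on (hc h2) (by simp) hg.intervalIntegrable
        fun u hu => by linarith [(abs_le.1 (hmem u hu)).1]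
    · rw [hconst]
      exact intervalIntegral.integral_mono_on (hc h2) hg.intervalIntegrable (by simp)
        fun u hu => by linarith [(abs_le.1 (hmem u hu)).2]
  have h1 := mul_gap_le hm (a := fun j => -c j)
    (b := fun j => -∫ u in (0 : ℝ)..c j, g u) (i := i) (γ := g (c i) - K) fun k l hk hkl hl => by
      rw [neg_primitive_sub hg]; refine le_trans (le_of_eq ?_) (hb k l hk hkl hl).1; ring
  have h2 := mul_gap_le hm (a := fun j => -c j)
    (b := fun j => -(-∫ u in (0 : ℝ)..c j, g u)) (i := i) (γ := -(g (c i) + K))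
      fun k l hk hkl hl => by
      have := (hb k l hk hkl hl).2
      have e : - -(∫ u in (0 : ℝ)..c k, g u) - - -(∫ u in (0 : ℝ)..c l, g u)
        = -∫ u in c k..c l, g u := by rw [← neg_primitive_sub hg (c k) (c l)]; ring
      rw [e]; linarith
  rw [gap_neg m fun j => -∫ u in (0 : ℝ)..c j, g u] at h2
  rw [kerAvg, abs_le]
  constructor
  · have := (le_div_iff₀ hi).2 h1; linarith
  · have := (div_le_iff₀ hi).2 (by linarith :
      gap m (fun j => -∫ u in (0 : ℝ)..c j, g u) i ≤ (g (c i) + K) * gap m (fun j => -c j) i)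
    linarith

theorem sum_window_le {m r : ℕ} (hm : 0 < m) {c : ℤ → ℝ} (h1 : ∀ i, c 1 ≤ c i)
    (hr : ∀ i, c i ≤ c r) :
    ∑ i ∈ Finset.Icc (1 : ℤ) r, (c (i - 1 + m) - c (i - 1 - m)) ≤ 2 * m * (c r - c 1) := by
  have h := sum_shift_sub_le (a := fun i => -c i) (r := r) (fun i => neg_le_neg (h1 i))
    (fun i => neg_le_neg (hr i)) (m - 1) (m + 1)
  obtain ⟨d, rfl⟩ : ∃ d, m = d + 1 := ⟨m - 1, by omega⟩
  have e : ∀ i : ℤ, c (i - 1 + (d + 1 : ℕ)) - c (i - 1 - (d + 1 : ℕ))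
      = -c (i - (d + 1 + 1 : ℕ)) - -c (i + (d + 1 - 1 : ℕ)) := fun i => by
    rw [show i - 1 + ((d + 1 : ℕ) : ℤ) = i + (d + 1 - 1 : ℕ) by push_cast; simp,
      show i - 1 - ((d + 1 : ℕ) : ℤ) = i - (d + 1 + 1 : ℕ) by push_cast; ring]
    ring
  simp only [e]
  refine h.trans (le_of_eq ?_)
  push_cast [Nat.add_sub_cancel]; ring

/-- For a uniformly continuous `g` there is no harm in replacing local averages by values. -/
theorem sum_abs_kerAvg_sub_le {N m r : ℕ} (hN : 0 < N) (hm : 0 < m) (hrN : r ≤ N) {g : ℝ → ℝ}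
    (hg : Integrable g) {ε C : ℝ} (hε : 0 ≤ ε) (hC : 0 ≤ C)
    (hgε : ∀ x y, |g x - g y| ≤ ε + C * |x - y|)
    {c : ℤ → ℝ} (hc : Monotone c) (h1 : ∀ i, c 1 ≤ c i) (hr : ∀ i, c i ≤ c r)
    (hc1 : c r - c 1 ≤ 1) {w : ℤ → ℝ} (hw1 : ∀ i, w i ≤ 1)
    (hw : ∀ i, w i ≠ 0 → (m : ℝ) / (2 * N) ≤ gap m (fun j => -c j) i) :
    (1 / (N : ℝ)) * ∑ i ∈ Finset.Icc (1 : ℤ) r, w i * |kerAvg m g c i - g (c i)|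
      ≤ ε + 2 * C * (m / N) := by
  have h2 : ∀ i, w i * |kerAvg m g c i - g (c i)|
      ≤ ε + C * (c (i - 1 + m) - c (i - 1 - m)) := by
    intro i
    have h0 : c (i - 1 - m) ≤ c (i - 1 + m) := hc (by omega)
    by_cases hi : w i = 0
    · rw [hi, zero_mul]
      have : 0 ≤ c (i - 1 + m) - c (i - 1 - m) := by linarith
      positivity
    · have h4 : 0 < (m : ℝ) / (2 * N) := by positivity
      refine le_trans ?_ (abs_kerAvg_sub_le hm hg hgε hC hc (h4.trans_le (hw i hi)))
      exact mul_le_of_le_one_left (abs_nonneg _) (hw1 i)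
  calc _ ≤ (1 / (N : ℝ)) * ∑ i ∈ Finset.Icc (1 : ℤ) r,
          (ε + C * (c (i - 1 + m) - c (i - 1 - m))) := by gcongr with i _; exact h2 i
    _ = (1 / (N : ℝ)) * (r * ε
          + C * ∑ i ∈ Finset.Icc (1 : ℤ) r, (c (i - 1 + m) - c (i - 1 - m))) := by
        rw [Finset.sum_add_distrib, Finset.mul_sum]; simp
    _ ≤ (1 / (N : ℝ)) * (N * ε + C * (2 * m * 1)) := by
        gcongr
        exact (sum_window_le hm h1 hr).trans (by gcongr)
    _ = _ := by field_simp

end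

noncomputable section

/-! ### Regular windows -/

theorem censoredStat_one_le {N : ℕ} (v : Fin N → ℝ) {r : ℕ} (h1 : 1 ≤ r) (hr : r ≤ N) (i : ℤ) :
    censoredStat v r 1 ≤ censoredStat v r i := by
  rw [censoredStat_clamp v h1 i]
  exact censoredStat_mono v h1 hr (le_max_left _ _)

theorem censoredStat_le_last {N : ℕ} (v : Fin N → ℝ) {r : ℕ} (h1 : 1 ≤ r) (hr : r ≤ N) (i : ℤ) :
    censoredStat v r i ≤ censoredStat v r r := by
  rw [censoredStat_clamp v h1 i]
  exact censoredStat_mono v h1 hr (by omega)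

theorem censoredStat_mem_Ioo {N : ℕ} {v : Fin N → ℝ} (hv : ∀ a, v a ∈ Set.Ioo (0 : ℝ) 1) {r : ℕ}
    (h1 : 1 ≤ r) (hr : r ≤ N) (i : ℤ) : censoredStat v r i ∈ Set.Ioo (0 : ℝ) 1 := by
  obtain ⟨a, ha⟩ := censoredStat_mem v h1 hr i
  rw [ha]; exact hv a

/-- The weight that singles out the indices whose windows are clamped. -/
def edgeWeight (m r : ℕ) (i : ℤ) : ℝ := if (m : ℤ) + 2 ≤ i ∧ i - 1 + m ≤ r then 0 else 1

/-- The weight that singles out the indices whose windows are clamped or possibly too short. -/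
def badWeight (m r : ℕ) {N : ℕ} (i : ℤ) (v : Fin N → ℝ) : ℝ :=
  if (m : ℤ) + 2 ≤ i ∧ i - 1 + m ≤ r ∧ defect m r v i ≤ 1 / 2 then 0 else 1

theorem edgeWeight_nonneg (m r : ℕ) (i : ℤ) : 0 ≤ edgeWeight m r i := by
  unfold edgeWeight; split_ifs <;> norm_num

theorem edgeWeight_le_one (m r : ℕ) (i : ℤ) : edgeWeight m r i ≤ 1 := by
  unfold edgeWeight; split_ifs <;> norm_num

theorem badWeight_nonneg (m r : ℕ) {N : ℕ} (i : ℤ) (v : Fin N → ℝ) : 0 ≤ badWeight m r i v := by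
  unfold badWeight; split_ifs <;> norm_num

theorem badWeight_le_one (m r : ℕ) {N : ℕ} (i : ℤ) (v : Fin N → ℝ) : badWeight m r i v ≤ 1 := by
  unfold badWeight; split_ifs <;> norm_num

theorem measurable_badWeight (m r N : ℕ) (i : ℤ) :
    Measurable fun v : Fin N → ℝ => badWeight m r i v := by
  unfold badWeight
  refine Measurable.ite ?_ measurable_const measurable_const
  by_cases h : (m : ℤ) + 2 ≤ i ∧ i - 1 + m ≤ r
  · have : {v : Fin N → ℝ | (m : ℤ) + 2 ≤ i ∧ i - 1 + m ≤ r ∧ defect m r v i ≤ 1 / 2}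
        = {v | defect m r v i ≤ 1 / 2} := by ext v; simp [h.1, h.2]
    rw [this]
    exact measurableSet_le (measurable_defect m r N i) measurable_const
  · have : {v : Fin N → ℝ | (m : ℤ) + 2 ≤ i ∧ i - 1 + m ≤ r ∧ defect m r v i ≤ 1 / 2} = ∅ := by
      ext v; simp only [Set.mem_ofPred_eq, Set.mem_empty_iff_false, iff_false]
      exact fun h' => h ⟨h'.1, h'.2.1⟩
    rw [this]; exact MeasurableSet.empty

theorem badWeight_le (m r : ℕ) {N : ℕ} (i : ℤ) (v : Fin N → ℝ) :
    badWeight m r i v ≤ edgeWeight m r i + 2 * defect m r v i := by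
  have := defect_nonneg m r v i
  unfold badWeight edgeWeight
  split_ifs with h1 h2 h2
  · linarith
  · linarith
  · have : ¬ defect m r v i ≤ 1 / 2 := fun h => h1 ⟨h2.1, h2.2, h⟩
    linarith
  · linarith

theorem sum_edgeWeight_le (m r : ℕ) :
    ∑ i ∈ Finset.Icc (1 : ℤ) r, edgeWeight m r i ≤ 2 * m + 1 := by
  have h1 : ∑ i ∈ Finset.Icc (1 : ℤ) r, edgeWeight m r i
      = (((Finset.Icc (1 : ℤ) r).filter fun i => ¬((m : ℤ) + 2 ≤ i ∧ i - 1 + m ≤ r)).card : ℝ) := by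
    rw [Finset.card_filter]
    push_cast
    refine Finset.sum_congr rfl fun i _ => ?_
    unfold edgeWeight; split_ifs <;> simp_all
  have h2 : ((Finset.Icc (1 : ℤ) r).filter fun i => ¬((m : ℤ) + 2 ≤ i ∧ i - 1 + m ≤ r))
      ⊆ Finset.Icc 1 ((m : ℤ) + 1) ∪ Finset.Icc ((r : ℤ) - m + 1) r := by
    intro i hi
    simp only [Finset.mem_filter, Finset.mem_Icc, Finset.mem_union] at hi ⊢
    omega
  have h3 := (Finset.card_le_card h2).trans (Finset.card_union_le _ _)
  rw [Int.card_Icc, Int.card_Icc] at h3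
  have h4 : ((Finset.Icc (1 : ℤ) r).filter fun i => ¬((m : ℤ) + 2 ≤ i ∧ i - 1 + m ≤ r)).card
      ≤ 2 * m + 1 := by omega
  rw [h1]; exact_mod_cast h4

/-- A regular window has at least half of its typical length. -/
theorem half_le_gap_of_badWeight_ne_one {N m r : ℕ} (hN : 0 < N) (hm : 0 < m) (hr : r ≤ N)
    {v : Fin N → ℝ} {i : ℤ} (hi : badWeight m r i v ≠ 1) :
    (m : ℝ) / (2 * N) ≤ gap m (fun j => -censoredStat v r j) i := by
  unfold badWeight at hi
  split_ifs at hi with h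
  · have h1 := one_sub_defect_le (v := v) hm hr h.1 h.2.1
    have h2 : 1 / 2 ≤ (N : ℝ) / m * gap m (fun j => -censoredStat v r j) i := by linarith [h.2.2]
    rw [div_mul_eq_mul_div, le_div_iff₀ (by positivity)] at h2
    rw [div_le_iff₀ (by positivity)]
    linarith
  · exact absurd rfl hi

variable {n r m : ℕ → ℕ}

theorem l2Null_edgeWeight (hn : Tendsto n atTop atTop)
    (hmn : Tendsto (fun k => (m k : ℝ) / n k) atTop (𝓝 0)) :
    L2Null n fun k _ => (1 / (n k : ℝ)) * ∑ i ∈ Finset.Icc (1 : ℤ) (r k),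
      edgeWeight (m k) (r k) i := by
  refine (L2Null.of_const (n := n) (a := fun k => 2 * ((m k : ℝ) / n k) + 1 / n k) ?_).mono
    (fun k => measurable_const) (.of_forall fun k => .of_forall fun v => ?_)
  · have := (tendsto_one_div_atTop_nhds_zero_nat (𝕜 := ℝ)).comp hn
    simpa using (hmn.const_mul 2).add this
  · have h1 := sum_edgeWeight_le (m k) (r k)
    have h0 : 0 ≤ ∑ i ∈ Finset.Icc (1 : ℤ) (r k), edgeWeight (m k) (r k) i :=
      Finset.sum_nonneg fun i _ => edgeWeight_nonneg _ _ _
    rw [abs_of_nonneg (by positivity), abs_of_nonneg (by positivity)]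
    calc _ ≤ (1 / (n k : ℝ)) * (2 * m k + 1) := by gcongr
      _ = _ := by ring

theorem l2Null_badWeight (hn : Tendsto n atTop atTop) (h1 : ∀ k, 1 ≤ r k) (hr : ∀ k, r k ≤ n k)
    (hm : Tendsto m atTop atTop) (hmn : Tendsto (fun k => (m k : ℝ) / n k) atTop (𝓝 0)) :
    L2Null n fun k v => (1 / (n k : ℝ)) * ∑ i ∈ Finset.Icc (1 : ℤ) (r k),
      badWeight (m k) (r k) i v := by
  refine ((l2Null_edgeWeight (r := r) hn hmn).add ((l2Null_defect h1 hr hm).const_mul 2)).mono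
    (fun k => (Finset.measurable_fun_sum _ fun i _ => measurable_badWeight _ _ _ i).const_mul _)
    (.of_forall fun k => .of_forall fun v => ?_)
  have h0 : 0 ≤ ∑ i ∈ Finset.Icc (1 : ℤ) (r k), badWeight (m k) (r k) i v :=
    Finset.sum_nonneg fun i _ => badWeight_nonneg _ _ _ _
  rw [abs_of_nonneg (by positivity)]
  refine le_trans ?_ (le_abs_self _)
  calc _ ≤ (1 / (n k : ℝ)) * ∑ i ∈ Finset.Icc (1 : ℤ) (r k),
        (edgeWeight (m k) (r k) i + 2 * defect (m k) (r k) v i) := by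
        gcongr with i _; exact badWeight_le _ _ _ _
    _ = _ := by rw [Finset.sum_add_distrib, ← Finset.mul_sum]; ring

/-- Averages of a function of the order statistics do not change in the limit if the indices are
shifted and a few of them are discarded. -/
theorem l2Null_shifted_avg (hn : Tendsto n atTop atTop) (h1 : ∀ k, 1 ≤ r k) (hr : ∀ k, r k ≤ n k)
    {e : (k : ℕ) → ℤ → (Fin (n k) → ℝ) → ℝ} (hem : ∀ k i, Measurable (e k i))
    (he0 : ∀ k i v, 0 ≤ e k i v) (he1 : ∀ k i v, e k i v ≤ 1)
    (he : L2Null n fun k v => (1 / (n k : ℝ)) * ∑ i ∈ Finset.Icc (1 : ℤ) (r k), e k i v)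
    {s : ℕ → ℤ} (hs : Tendsto (fun k => |(s k : ℝ)| / n k) atTop (𝓝 0))
    (hes : ∀ k, ∀ i ∈ Finset.Icc (1 : ℤ) (r k), i + s k ∉ Finset.Icc (1 : ℤ) (r k) →
      ∀ v, e k i v = 1)
    {ψ : ℝ → ℝ} (hψ : Measurable ψ) (hψ2 : MemLp ψ 2 (volume.restrict (Set.Icc (0 : ℝ) 1))) :
    L2Null n fun k v => (1 / (n k : ℝ)) * ∑ i ∈ Finset.Icc (1 : ℤ) (r k),
      (1 - e k i v) * ψ (censoredStat v (r k) (i + s k)) - ∫ p in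
          (0 : ℝ)..((r k : ℝ) / n k), ψ p := by
  classical
  let e' : (k : ℕ) → ℤ → (Fin (n k) → ℝ) → ℝ := fun k j v =>
    if j - s k ∈ Finset.Icc (1 : ℤ) (r k) then e k (j - s k) v else 1
  have hem' : ∀ k j, Measurable (e' k j) := by
    intro k j; simp only [e']; split_ifs
    · exact hem k _
    · exact measurable_const
  have he0' : ∀ k j v, 0 ≤ e' k j v := by
    intro k j v; simp only [e']; split_ifs
    · exact he0 _ _ _
    · exact zero_le_one
  have he1' : ∀ k j v, e' k j v ≤ 1 := by
    intro k j v; simp only [e']; split_ifs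
    · exact he1 _ _ _
    · exact le_rfl
  have hsum : ∀ (k : ℕ) (F : ℤ → ℝ),
      ∑ j ∈ (Finset.Icc (1 : ℤ) (r k)).filter (fun j => j - s k ∈ Finset.Icc (1 : ℤ) (r k)),
        F (j - s k) = ∑ i ∈ (Finset.Icc (1 : ℤ) (r k)).filter
          (fun i => i + s k ∈ Finset.Icc (1 : ℤ) (r k)), F i := by
    intro k F
    refine Finset.sum_nbij' (fun j => j - s k) (fun i => i + s k) ?_ ?_ ?_ ?_ ?_
    · intro j hj; simp only [Finset.mem_filter] at hj ⊢; simpa using hj.symm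
    · intro j hj; simp only [Finset.mem_filter] at hj ⊢; simpa using hj.symm
    · intro j _; ring
    · intro j _; ring
    · intro j _; rfl
  have he' : L2Null n fun k v => (1 / (n k : ℝ)) * ∑ i ∈ Finset.Icc (1 : ℤ) (r k), e' k i v := by
    refine (he.add (L2Null.of_const hs)).mono
      (fun k => (Finset.measurable_fun_sum _ fun i _ => hem' k i).const_mul _)
      (.of_forall fun k => .of_forall fun v => ?_)
    have h0 : 0 ≤ ∑ i ∈ Finset.Icc (1 : ℤ) (r k), e' k i v :=
      Finset.sum_nonneg fun i _ => he0' _ _ _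
    rw [abs_of_nonneg (by positivity)]
    refine le_trans ?_ (le_abs_self _)
    have h2 : ∑ i ∈ Finset.Icc (1 : ℤ) (r k), e' k i v
        ≤ ∑ i ∈ Finset.Icc (1 : ℤ) (r k), e k i v + |(s k : ℝ)| := by
      simp only [e']
      rw [Finset.sum_ite, hsum k fun i => e k i v]
      refine add_le_add ?_ ?_
      · exact Finset.sum_le_sum_of_subset_of_nonneg (Finset.filter_subset _ _)
          fun i _ _ => he0 _ _ _
      · rw [Finset.sum_const, nsmul_eq_mul, mul_one]
        have h3 : (Finset.Icc (1 : ℤ) (r k)).filter (fun j => j - s k ∉ Finset.Icc (1 : ℤ) (r k))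
            ⊆ Finset.Icc 1 (s k) ∪ Finset.Icc (r k + s k + 1) (r k) := by
          intro j hj
          simp only [Finset.mem_filter, Finset.mem_Icc, Finset.mem_union] at hj ⊢
          omega
        have h4 := (Finset.card_le_card h3).trans (Finset.card_union_le _ _)
        rw [Int.card_Icc, Int.card_Icc] at h4
        have h5 : ((Finset.Icc (1 : ℤ) (r k)).filter
            (fun j => j - s k ∉ Finset.Icc (1 : ℤ) (r k))).card ≤ (s k).natAbs := by omega
        calc _ ≤ (((s k).natAbs : ℕ) : ℝ) := by exact_mod_cast h5
          _ = |(s k : ℝ)| := by rw [Nat.cast_natAbs]; push_cast; rfl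
    calc _ ≤ (1 / (n k : ℝ)) * (∑ i ∈ Finset.Icc (1 : ℤ) (r k), e k i v + |(s k : ℝ)|) := by gcongr
      _ = _ := by ring
  have hw := l2Null_weighted h1 hr (I := fun k => Finset.Icc (1 : ℤ) (r k)) hem' he0' he1' he'
    (σ := fun _ i => i) (fun k i hi => hi)
    (fun k j _ => by
      refine (Finset.card_le_card (t := {j}) fun i hi => ?_).trans (by simp)
      simp only [Finset.mem_filter] at hi; simp [hi.2]) hψ hψ2
  have hw' : L2Null n fun k v => (1 / (n k : ℝ)) * ∑ i ∈ Finset.Icc (1 : ℤ) (r k),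
      e' k i v * ψ (censoredStat v (r k) i) := by
    refine hw.mono (fun k => (Finset.measurable_fun_sum _ fun i _ =>
      (hem' k i).mul (hψ.comp (measurable_censoredStat _ _))).const_mul _)
      (.of_forall fun k => .of_forall fun v => ?_)
    rw [abs_mul, abs_mul]
    refine mul_le_mul_of_nonneg_left ?_ (abs_nonneg _)
    refine (Finset.abs_sum_le_sum_abs _ _).trans (le_trans (le_of_eq ?_) (le_abs_self _))
    refine Finset.sum_congr rfl fun i _ => ?_
    rw [abs_mul, abs_of_nonneg (he0' _ _ _)]
  have := (l2Null_avg_sub_integral hn h1 hr hψ hψ2).add (hw'.const_mul (-1))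
  convert this using 3 with k v
  have key : ∑ i ∈ Finset.Icc (1 : ℤ) (r k), (1 - e k i v) * ψ (censoredStat v (r k) (i + s k))
      = ∑ i ∈ Finset.Icc (1 : ℤ) (r k), ψ (censoredStat v (r k) i)
        - ∑ i ∈ Finset.Icc (1 : ℤ) (r k), e' k i v * ψ (censoredStat v (r k) i) := by
    have a1 : ∑ i ∈ Finset.Icc (1 : ℤ) (r k), (1 - e k i v) * ψ (censoredStat v (r k) (i + s k))
        = ∑ i ∈ (Finset.Icc (1 : ℤ) (r k)).filter (fun i => i + s k ∈ Finset.Icc (1 : ℤ) (r k)),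
          (1 - e k i v) * ψ (censoredStat v (r k) (i + s k)) := by
      rw [Finset.sum_filter]
      refine Finset.sum_congr rfl fun i hi => ?_
      split_ifs with h
      · rfl
      · rw [hes k i hi h v]; ring
    rw [a1, ← hsum k fun i => (1 - e k i v) * ψ (censoredStat v (r k) (i + s k)),
      ← Finset.sum_sub_distrib, Finset.sum_filter]
    refine Finset.sum_congr rfl fun j _ => ?_
    simp only [e']
    split_ifs with h
    · rw [sub_add_cancel]; ring
    · ring
  rw [key]; ring

theorem exists_abs_sub_le_add_mul {g : ℝ → ℝ} (hg : Continuous g) (hgc : HasCompactSupport g)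
    {ε : ℝ} (hε : 0 < ε) : ∃ C, 0 ≤ C ∧ ∀ x y, |g x - g y| ≤ ε + C * |x - y| := by
  obtain ⟨M, hM⟩ := hgc.exists_bound_of_continuous hg
  obtain ⟨δ, hδ, h⟩ := Metric.uniformContinuous_iff.1 (hgc.uniformContinuous_of_continuous hg) ε hε
  have hM0 : 0 ≤ M := (norm_nonneg _).trans (hM 0)
  refine ⟨2 * M / δ, by positivity, fun x y => ?_⟩
  by_cases hxy : |x - y| < δ
  · have := h (a := x) (b := y) (by simpa [Real.dist_eq] using hxy)
    rw [Real.dist_eq] at this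
    have h2 : 0 ≤ 2 * M / δ * |x - y| := by positivity
    linarith
  · have h1 := abs_sub (g x) (g y)
    have h2 := hM x
    have h3 := hM y
    rw [Real.norm_eq_abs] at h2 h3
    have h4 : 2 * M / δ * δ ≤ 2 * M / δ * |x - y| := by gcongr; exact not_lt.1 hxy
    rw [div_mul_cancel₀ _ hδ.ne'] at h4
    linarith

/-- Averages of `φ` over regular windows recover the integral of `φ`. -/
theorem l2Null_kerAvg (hn : Tendsto n atTop atTop) (h1 : ∀ k, 1 ≤ r k) (hr : ∀ k, r k ≤ n k)
    (hm : Tendsto m atTop atTop) (hmn : Tendsto (fun k => (m k : ℝ) / n k) atTop (𝓝 0))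
    {φ : ℝ → ℝ} (hφ : Integrable φ) :
    L2Null n fun k v => (1 / (n k : ℝ)) * ∑ i ∈ Finset.Icc (1 : ℤ) (r k),
      (1 - badWeight (m k) (r k) i v) * kerAvg (m k) φ (censoredStat v (r k)) i
        - ∫ p in (0 : ℝ)..((r k : ℝ) / n k), φ p := by
  have hmeas : ∀ {g : ℝ → ℝ} (_ : Integrable g) (k : ℕ), Measurable fun v : Fin (n k) → ℝ =>
      (1 / (n k : ℝ)) * ∑ i ∈ Finset.Icc (1 : ℤ) (r k),
      (1 - badWeight (m k) (r k) i v) * kerAvg (m k) g (censoredStat v (r k)) i := fun hg k =>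
    (Finset.measurable_fun_sum _ fun i _ => (measurable_const.sub
        (measurable_badWeight _ _ _ i)).mul
      (measurable_kerAvg_censoredStat hg _ _ i)).const_mul _
  refine L2Null.of_approx (fun k => (hmeas hφ k).sub_const _) fun ε hε => ?_
  -- `φ` is replaced by a continuous `g` with compact support, at a cost in `L¹` that the averages
  -- inherit; the averages of `g` are close to its values
  obtain ⟨g, hgc, hgφ, hg, hgi⟩ :=
    hφ.exists_hasCompactSupport_integral_sub_le (by positivity : 0 < ε / 6)
  obtain ⟨C, hC, hgC⟩ := exists_abs_sub_le_add_mul hg hgc (by positivity : 0 < ε / 4)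
  have hτ : Integrable fun u => φ u - g u := hφ.sub hgi
  have hg2 : MemLp g 2 (volume.restrict (Set.Icc (0 : ℝ) 1)) := by
    obtain ⟨M, hM⟩ := hgc.exists_bound_of_continuous hg
    exact MemLp.of_bound hg.aestronglyMeasurable M (.of_forall hM)
  have hZ := l2Null_shifted_avg hn h1 hr (e := fun k i v => badWeight (m k) (r k) i v)
    (fun k i => measurable_badWeight _ _ _ i) (fun k i v => badWeight_nonneg _ _ _ _)
    (fun k i v => badWeight_le_one _ _ _ _) (l2Null_badWeight hn h1 hr hm hmn) (s := fun _ => 0)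
    (by simp) (fun k i hi hi' => absurd hi (by simpa using hi')) hg.measurable hg2
  refine ⟨_, fun _ _ => ε, hZ, fun k => measurable_const, .of_forall fun k => ?_, ?_⟩
  · rw [eLpNorm_const _ (by norm_num) (IsProbabilityMeasure.ne_zero _)]
    simp [Real.enorm_eq_ofReal_abs, abs_of_pos hε]
  have hev : ∀ᶠ k in atTop, 2 * C * ((m k : ℝ) / n k) < ε / 4 := by
    have := hmn.const_mul (2 * C)
    rw [mul_zero] at this
    exact this.eventually (gt_mem_nhds (by positivity))
  filter_upwards [hev, hm.eventually_gt_atTop 0] with k hk hmk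
  filter_upwards [ae_uniformSample_mem (n k)] with v hv
  have hN : 0 < n k := (h1 k).trans (hr k)
  set c := censoredStat v (r k) with hcdef
  have hc : Monotone c := censoredStat_mono v (h1 k) (hr k)
  have hc1 : ∀ i, c 1 ≤ c i := censoredStat_one_le v (h1 k) (hr k)
  have hcr : ∀ i, c i ≤ c (r k) := censoredStat_le_last v (h1 k) (hr k)
  have hc01 : c (r k) - c 1 ≤ 1 := by
    linarith [(censoredStat_mem_Ioo hv (h1 k) (hr k) (r k)).2,
      (censoredStat_mem_Ioo hv (h1 k) (hr k) 1).1]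
  have hw1 : ∀ i, 1 - badWeight (m k) (r k) i v ≤ 1 := fun i => by
    linarith [badWeight_nonneg (m k) (r k) i v]
  have hw0 : ∀ i, 0 ≤ 1 - badWeight (m k) (r k) i v := fun i => by
    linarith [badWeight_le_one (m k) (r k) i v]
  have hw : ∀ i, 1 - badWeight (m k) (r k) i v ≠ 0 →
      (m k : ℝ) / (2 * n k) ≤ gap (m k) (fun j => -c j) i := fun i hi =>
    half_le_gap_of_badWeight_ne_one hN hmk (hr k) fun h => hi (by rw [h]; ring)
  have b1 := sum_abs_kerAvg_le hN hmk hτ hc hc1 hcr hw1 hw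
  have b2 := sum_abs_kerAvg_sub_le hN hmk (hr k) hgi (by positivity) hC hgC hc hc1 hcr hc01 hw1 hw
  have b3 : |∫ p in (0 : ℝ)..((r k : ℝ) / n k), (φ p - g p)| ≤ ∫ u, |φ u - g u| := by
    have h0 : (0 : ℝ) ≤ (r k : ℝ) / n k := by positivity
    refine (intervalIntegral.abs_integral_le_integral_abs h0).trans ?_
    rw [intervalIntegral.integral_of_le h0]
    exact setIntegral_le_integral hτ.abs (.of_forall fun _ => abs_nonneg _)
  have hgφ' : ∫ u, |φ u - g u| ≤ ε / 6 := hgφ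
  have b4 : ∀ F : ℤ → ℝ, |(1 / (n k : ℝ)) * ∑ i ∈ Finset.Icc (1 : ℤ) (r k),
      (1 - badWeight (m k) (r k) i v) * F i| ≤ (1 / (n k : ℝ)) * ∑ i ∈ Finset.Icc (1 : ℤ) (r k),
      (1 - badWeight (m k) (r k) i v) * |F i| := by
    intro F
    rw [abs_mul, abs_of_nonneg (by positivity : (0 : ℝ) ≤ 1 / n k)]
    gcongr
    refine (Finset.abs_sum_le_sum_abs _ _).trans (le_of_eq (Finset.sum_congr rfl fun i _ => ?_))
    rw [abs_mul, abs_of_nonneg (hw0 i)]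
  have b5 := (b4 _).trans b1
  have b6 := (b4 _).trans b2
  have key : (1 / (n k : ℝ)) * ∑ i ∈ Finset.Icc (1 : ℤ) (r k),
      (1 - badWeight (m k) (r k) i v) * kerAvg (m k) φ c i - ∫ p in (0 : ℝ)..((r k : ℝ) / n k), φ p
      = ((1 / (n k : ℝ)) * ∑ i ∈ Finset.Icc (1 : ℤ) (r k),
          (1 - badWeight (m k) (r k) i v) * g (c (i + 0)) - ∫ p in (0 : ℝ)..((r k : ℝ) / n k), g p)
        + (1 / (n k : ℝ)) * ∑ i ∈ Finset.Icc (1 : ℤ) (r k),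
          (1 - badWeight (m k) (r k) i v) * (kerAvg (m k) g c i - g (c i))
        + (1 / (n k : ℝ)) * ∑ i ∈ Finset.Icc (1 : ℤ) (r k),
          (1 - badWeight (m k) (r k) i v) * kerAvg (m k) (fun u => φ u - g u) c i
        - ∫ p in (0 : ℝ)..((r k : ℝ) / n k), (φ p - g p) := by
    rw [intervalIntegral.integral_sub hφ.intervalIntegrable hgi.intervalIntegrable]
    have : ∀ i, kerAvg (m k) φ c i
        = kerAvg (m k) g c i + kerAvg (m k) (fun u => φ u - g u) c i := fun i => by
      rw [← kerAvg_add hgi hτ]; congr 1; ext u; ring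
    simp only [this, add_zero, mul_add, mul_sub, Finset.sum_add_distrib, Finset.sum_sub_distrib]
    ring
  rw [key, abs_of_pos hε]
  refine (abs_sub _ _).trans ?_
  have t1 := abs_add_three ((1 / (n k : ℝ)) * ∑ i ∈ Finset.Icc (1 : ℤ) (r k),
          (1 - badWeight (m k) (r k) i v) * g (c (i + 0)) - ∫ p in (0 : ℝ)..((r k : ℝ) / n k), g p)
    ((1 / (n k : ℝ)) * ∑ i ∈ Finset.Icc (1 : ℤ) (r k),
          (1 - badWeight (m k) (r k) i v) * (kerAvg (m k) g c i - g (c i)))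
    ((1 / (n k : ℝ)) * ∑ i ∈ Finset.Icc (1 : ℤ) (r k),
          (1 - badWeight (m k) (r k) i v) * kerAvg (m k) (fun u => φ u - g u) c i)
  linarith

end

noncomputable section

/-! ### The lower bound -/

/-- The `i`-th logarithm in the entropy estimator. -/
def logSpacing (m r : ℕ) {N : ℕ} (x : Fin N → ℝ) (i : ℤ) : ℝ :=
  Real.log ((upperMean x m r i - lowerMean x m r i) / ((m : ℝ) / N))

theorem upAvg_pos {m : ℕ} (hm : 0 < m) {y : ℤ → ℝ} (hy0 : ∀ i, 0 < y i) (i : ℤ) :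
    0 < upAvg m y i :=
  div_pos (Finset.sum_pos (fun _ _ => hy0 _) (by simpa using hm.ne')) (by exact_mod_cast hm)

theorem loAvg_pos (m : ℕ) {y : ℤ → ℝ} (hy0 : ∀ i, 0 < y i) (i : ℤ) : 0 < loAvg m y i :=
  div_pos (Finset.sum_pos (fun _ _ => hy0 _) (by simp)) (by positivity)

/-- With the means `A < B` of `y` over the two windows, `A⁻¹ - B⁻¹ = (B - A) / (A * B)`. -/
theorem log_inv_upAvg_sub_eq {m : ℕ} (hm : 0 < m) {y : ℤ → ℝ} (hy0 : ∀ i, 0 < y i) {i : ℤ}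
    (hg : 0 < gap m y i) :
    Real.log ((upAvg m y i)⁻¹ - (loAvg m y i)⁻¹)
      = Real.log (gap m y i) - Real.log (upAvg m y i) - Real.log (loAvg m y i) := by
  have hA := upAvg_pos hm hy0 i
  have hB := loAvg_pos m hy0 i
  have e : (upAvg m y i)⁻¹ - (loAvg m y i)⁻¹ = gap m y i / upAvg m y i / loAvg m y i := by
    rw [gap]; field_simp
  rw [e, Real.log_div (by positivity) hB.ne', Real.log_div hg.ne' hA.ne']

theorem log_gap_sub_le {m : ℕ} (hm : 0 < m) {y : ℤ → ℝ} (hy : Antitone y) (hy0 : ∀ i, 0 < y i)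
    {i : ℤ} (hg : 0 < gap m y i) :
    Real.log (gap m y i) - Real.log (y i) - Real.log (y (i - 1 - m))
      ≤ Real.log ((upAvg m y i)⁻¹ - (loAvg m y i)⁻¹) := by
  rw [log_inv_upAvg_sub_eq hm hy0 hg]
  have h1 := Real.log_le_log (upAvg_pos hm hy0 i) (upAvg_le hm hy i)
  have h2 := Real.log_le_log (loAvg_pos m hy0 i) (loAvg_le (m := m) hy i)
  linarith

/-- Only half of the upper window is used, so that this applies near the first observation, where
the lower window is clamped. -/
theorem log_right_sub_le {m : ℕ} (hm : 0 < m) {y : ℤ → ℝ} (hy : Antitone y) (hy0 : ∀ i, 0 < y i)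
    {i : ℤ} (hd : 0 < y i - y (i + (m / 2 : ℕ))) :
    Real.log ((y i - y (i + (m / 2 : ℕ))) / 2) - 2 * Real.log (y i)
      ≤ Real.log ((upAvg m y i)⁻¹ - (loAvg m y i)⁻¹) := by
  have hA := upAvg_pos hm hy0 i
  have hB := loAvg_pos m hy0 i
  have h1 := half_le_sub_upAvg hm hy i
  have hyi := hy0 i
  have h2 : (y i - y (i + (m / 2 : ℕ))) / 2 / y i / y i ≤ (upAvg m y i)⁻¹ - (loAvg m y i)⁻¹ := by
    have h3 : (loAvg m y i)⁻¹ ≤ (y i)⁻¹ := inv_anti₀ hyi (le_loAvg hy i)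
    have h4 : (y i - upAvg m y i) / y i / y i ≤ (upAvg m y i)⁻¹ - (y i)⁻¹ := by
      have e : (upAvg m y i)⁻¹ - (y i)⁻¹ = (y i - upAvg m y i) / y i / upAvg m y i := by field_simp
      rw [e]
      exact div_le_div_of_nonneg_left (div_nonneg (by linarith) hyi.le) hA (upAvg_le hm hy i)
    have h5 : (y i - y (i + (m / 2 : ℕ))) / 2 / y i / y i ≤ (y i - upAvg m y i) / y i / y i := by
      gcongr
    linarith
  have h6 := Real.log_le_log (by positivity) h2
  rw [Real.log_div (by positivity) hyi.ne', Real.log_div (by positivity) hyi.ne'] at h6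
  linarith

/-- Only half of the lower window is used, so that this applies near the last observation, where the
upper window is clamped. -/
theorem log_left_sub_le {m : ℕ} (hm : 0 < m) {y : ℤ → ℝ} (hy : Antitone y) (hy0 : ∀ i, 0 < y i)
    {i : ℤ} (hd : 0 < y (i - (m / 2 : ℕ)) - y i) :
    Real.log ((y (i - (m / 2 : ℕ)) - y i) / 2) - Real.log (y i) - Real.log (y (i - 1 - m))
      ≤ Real.log ((upAvg m y i)⁻¹ - (loAvg m y i)⁻¹) := by
  have hA := upAvg_pos hm hy0 i
  have hB := loAvg_pos m hy0 i
  have h1 := half_le_loAvg_sub (m := m) hy i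
  have hyi := hy0 i
  have hyj := hy0 (i - 1 - m)
  have h2 : (y (i - (m / 2 : ℕ)) - y i) / 2 / y i / y (i - 1 - m)
      ≤ (upAvg m y i)⁻¹ - (loAvg m y i)⁻¹ := by
    have h3 : (y i)⁻¹ ≤ (upAvg m y i)⁻¹ := inv_anti₀ hA (upAvg_le hm hy i)
    have h4 : (loAvg m y i - y i) / y i / y (i - 1 - m) ≤ (y i)⁻¹ - (loAvg m y i)⁻¹ := by
      have e : (y i)⁻¹ - (loAvg m y i)⁻¹ = (loAvg m y i - y i) / y i / loAvg m y i := by field_simp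
      rw [e]
      exact div_le_div_of_nonneg_left (div_nonneg (by linarith) hyi.le) hB (loAvg_le hy i)
    have h5 : (y (i - (m / 2 : ℕ)) - y i) / 2 / y i / y (i - 1 - m)
        ≤ (loAvg m y i - y i) / y i / y (i - 1 - m) := by gcongr
    linarith
  have h6 := Real.log_le_log (by positivity) h2
  rw [Real.log_div (by positivity) hyj.ne', Real.log_div (by positivity) hyi.ne'] at h6
  linarith

/-- The properties of the quantile function `Q` and of the logarithm `φ` of the derivative of
`-1 / Q` on which the bounds rest. The last field is Jensen's inequality in its tangent line form:
the increment of `-1 / Q` is at least the integral of `exp φ ≥ exp s * (1 + φ - s)`. -/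
structure QuantileData (Q φ : ℝ → ℝ) : Prop where
  pos : ∀ p ∈ Set.Ioo (0 : ℝ) 1, 0 < Q p
  strictMonoOn : StrictMonoOn Q (Set.Ioo (0 : ℝ) 1)
  measurable : Measurable Q
  memLp_log : MemLp (fun p => Real.log (Q p)) 2 (volume.restrict (Set.Icc (0 : ℝ) 1))
  measurable_log_deriv : Measurable φ
  integrable : Integrable φ
  exp_mul_le : ∀ p ∈ Set.Ioo (0 : ℝ) 1, ∀ q ∈ Set.Ioo (0 : ℝ) 1, p ≤ q → ∀ s,
    Real.exp s * ((1 - s) * (q - p) + ∫ u in p..q, φ u) ≤ (Q p)⁻¹ - (Q q)⁻¹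

variable {Q φ : ℝ → ℝ}

/-- The contribution of a short window to the lower bound: the average of `|φ|`, and the logarithm
of the relative length of the window if it is too short. -/
def windowCost (φ : ℝ → ℝ) (h r : ℕ) {N : ℕ} (v : Fin N → ℝ) (i : ℤ) : ℝ :=
  winAvg (fun p => |φ p|) (censoredStat v r i) (censoredStat v r (i + h)) +
    max 0 (Real.log ((h : ℝ) / (N * (censoredStat v r (i + h) - censoredStat v r i))))

/-- The tangent line form of Jensen's inequality, on a single window of `h` spacings. -/
theorem QuantileData.log_sub_inv_ge (D : QuantileData Q φ) {m h r N : ℕ} (hN : 0 < N) (hm : 0 < m)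
    (hh : 0 < h) (hmh : m ≤ 3 * h) {v : Fin N → ℝ} (hv : ∀ a, v a ∈ Set.Ioo (0 : ℝ) 1)
    (hinj : Function.Injective v) (hr : r ≤ N) {i : ℤ} (hi1 : 1 ≤ i) (hi : i + h ≤ r) :
    0 < (Q (censoredStat v r i))⁻¹ - (Q (censoredStat v r (i + h)))⁻¹ ∧
    -windowCost φ h r v i - Real.log 6 ≤ Real.log
      (((Q (censoredStat v r i))⁻¹ - (Q (censoredStat v r (i + h)))⁻¹) / 2) - Real.log (m / N) := by
  have h1r : 1 ≤ r := by omega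
  have hp := censoredStat_mem_Ioo hv h1r hr i
  have hq := censoredStat_mem_Ioo hv h1r hr (i + h)
  have hpq : censoredStat v r i < censoredStat v r (i + h) :=
    censoredStat_lt hinj hr hi1 (by omega) hi
  unfold windowCost
  set p := censoredStat v r i
  set q := censoredStat v r (i + h)
  have hW : 0 < q - p := sub_pos.2 hpq
  have hJ := D.exp_mul_le p hp q hq hpq.le (winAvg φ p q)
  have e : ∫ u in p..q, φ u = winAvg φ p q * (q - p) := by rw [winAvg]; field_simp
  rw [e] at hJ
  have hJ' : Real.exp (winAvg φ p q) * (q - p) ≤ (Q p)⁻¹ - (Q q)⁻¹ :=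
    le_trans (le_of_eq (by ring)) hJ
  have hpos : 0 < (Q p)⁻¹ - (Q q)⁻¹ := lt_of_lt_of_le (by positivity) hJ'
  refine ⟨hpos, ?_⟩
  have h2 := Real.log_le_log (by positivity) hJ'
  rw [Real.log_mul (Real.exp_pos _).ne' hW.ne', Real.log_exp] at h2
  have h3 : -winAvg φ p q ≤ winAvg (fun u => |φ u|) p q := by
    rw [winAvg, winAvg, ← mul_neg]
    refine mul_le_mul_of_nonneg_left ?_ (by positivity)
    exact (neg_le_abs _).trans (intervalIntegral.abs_integral_le_integral_abs hpq.le)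
  have h4 := le_max_right 0 (Real.log ((h : ℝ) / (N * (q - p))))
  have hh' : (0 : ℝ) < h := by exact_mod_cast hh
  have hN' : (0 : ℝ) < N := by exact_mod_cast hN
  have hm' : (0 : ℝ) < m := by exact_mod_cast hm
  rw [Real.log_div (by positivity) (by positivity), Real.log_mul (by positivity) (by positivity)]
    at h4 ⊢
  rw [Real.log_div (by positivity) (by positivity), Real.log_div (by positivity) (by positivity)]
  have h5 : Real.log m ≤ Real.log 3 + Real.log h := by
    rw [← Real.log_mul (by norm_num) (by positivity)]
    exact Real.log_le_log hm' (by exact_mod_cast hmh)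
  have h6 : Real.log 6 = Real.log 2 + Real.log 3 := by
    rw [← Real.log_mul (by norm_num) (by norm_num)]; norm_num
  linarith

section pointwise

variable {m r N : ℕ} {v : Fin N → ℝ}

theorem QuantileData.censoredStat_comp (D : QuantileData Q φ) (hv : ∀ a, v a ∈ Set.Ioo (0 : ℝ) 1)
    (h1 : 1 ≤ r) (hr : r ≤ N) (i : ℤ) :
    censoredStat (fun a => Q (v a)) r i = Q (censoredStat v r i) :=
  _root_.censoredStat_comp D.strictMonoOn.monotoneOn hv h1 hr i

theorem QuantileData.antitone_inv (D : QuantileData Q φ) (hv : ∀ a, v a ∈ Set.Ioo (0 : ℝ) 1)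
    (h1 : 1 ≤ r) (hr : r ≤ N) : Antitone fun j => (Q (censoredStat v r j))⁻¹ := by
  intro i j hij
  have hp := censoredStat_mem_Ioo hv h1 hr i
  have hq := censoredStat_mem_Ioo hv h1 hr j
  exact inv_anti₀ (D.pos _ hp) (D.strictMonoOn.monotoneOn hp hq (censoredStat_mono v h1 hr hij))

theorem QuantileData.inv_pos (D : QuantileData Q φ) (hv : ∀ a, v a ∈ Set.Ioo (0 : ℝ) 1)
    (h1 : 1 ≤ r) (hr : r ≤ N) (j : ℤ) : 0 < (Q (censoredStat v r j))⁻¹ :=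
  _root_.inv_pos.2 (D.pos _ (censoredStat_mem_Ioo hv h1 hr j))

theorem QuantileData.inv_lt (D : QuantileData Q φ) (hv : ∀ a, v a ∈ Set.Ioo (0 : ℝ) 1)
    (hinj : Function.Injective v) (hr : r ≤ N) {i j : ℤ} (hi : 1 ≤ i) (hij : i < j) (hj : j ≤ r) :
    (Q (censoredStat v r j))⁻¹ < (Q (censoredStat v r i))⁻¹ := by
  have h1 : 1 ≤ r := by omega
  have hp := censoredStat_mem_Ioo hv h1 hr i
  exact inv_strictAnti₀ (D.pos _ hp)
    (D.strictMonoOn hp (censoredStat_mem_Ioo hv h1 hr j) (censoredStat_lt hinj hr hi hij hj))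

theorem QuantileData.gap_pos (D : QuantileData Q φ) (hm : 2 ≤ m) (hmr : 2 * m < r)
    (hr : r ≤ N) (hv : ∀ a, v a ∈ Set.Ioo (0 : ℝ) 1) (hinj : Function.Injective v) {i : ℤ}
    (hi : i ∈ Finset.Icc (1 : ℤ) r) :
    0 < gap m (fun j => (Q (censoredStat v r j))⁻¹) i := by
  rw [Finset.mem_Icc] at hi
  have h1 : 1 ≤ r := by omega
  have hanti := D.antitone_inv hv h1 hr
  have hU := upAvg_le (by omega : 0 < m) hanti i
  have hL := le_loAvg (m := m) hanti i
  rw [gap]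
  -- since `2 m < r`, half of at least one of the two windows is not clamped
  by_cases h : i + (m / 2 : ℕ) ≤ r
  · have h2 := half_le_sub_upAvg (by omega : 0 < m) hanti i
    have h3 := D.inv_lt hv hinj hr hi.1 (show i < i + (m / 2 : ℕ) by omega) h
    linarith
  · have h2 := half_le_loAvg_sub (m := m) hanti i
    have h3 := D.inv_lt hv hinj hr (show 1 ≤ i - (m / 2 : ℕ) by omega)
      (show i - (m / 2 : ℕ) < i by omega) hi.2
    linarith

theorem QuantileData.logSpacing_eq (D : QuantileData Q φ) (hm : 2 ≤ m) (hmr : 2 * m < r)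
    (hr : r ≤ N) (hv : ∀ a, v a ∈ Set.Ioo (0 : ℝ) 1) (hinj : Function.Injective v) {i : ℤ}
    (hi : i ∈ Finset.Icc (1 : ℤ) r) :
    logSpacing m r (fun a => Q (v a)) i
      = Real.log ((upAvg m (fun j => (Q (censoredStat v r j))⁻¹) i)⁻¹
        - (loAvg m (fun j => (Q (censoredStat v r j))⁻¹) i)⁻¹) - Real.log (m / N) := by
  have hg := D.gap_pos hm hmr hr hv hinj hi
  have h1 : 1 ≤ r := by omega
  have hA := upAvg_pos (by omega : 0 < m) (D.inv_pos hv h1 hr) i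
  rw [logSpacing, upperMean_eq, lowerMean_eq]
  simp only [D.censoredStat_comp hv h1 hr]
  rw [Real.log_div]
  · refine (sub_pos.2 (inv_strictAnti₀ hA ?_)).ne'
    rw [gap] at hg; linarith
  · have : 0 < N := by omega
    positivity

/-- The lower bound for regular windows, by Jensen's inequality for the window density. -/
theorem QuantileData.logSpacing_ge_of_regular (D : QuantileData Q φ) (hm : 2 ≤ m) (hmr : 2 * m < r)
    (hr : r ≤ N) (hv : ∀ a, v a ∈ Set.Ioo (0 : ℝ) 1) (hinj : Function.Injective v) {i : ℤ}
    (hi : i ∈ Finset.Icc (1 : ℤ) r) (hb : badWeight m r i v ≠ 1) :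
    kerAvg m φ (censoredStat v r) i - 2 * defect m r v i + Real.log (Q (censoredStat v r i))
      + Real.log (Q (censoredStat v r (i - 1 - m))) ≤ logSpacing m r (fun a => Q (v a)) i := by
  have h1 : 1 ≤ r := by omega
  have hN : 0 < N := by omega
  have hm0 : 0 < m := by omega
  have hc := censoredStat_mono v h1 hr
  rw [D.logSpacing_eq hm hmr hr hv hinj hi]
  have hgc : 0 < gap m (fun j => -censoredStat v r j) i :=
    lt_of_lt_of_le (by positivity) (half_le_gap_of_badWeight_ne_one hN hm0 hr hb)
  have hJ := gap_mul_exp_kerAvg_le hm0 D.integrable (c := censoredStat v r)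
    (y := fun j => (Q (censoredStat v r j))⁻¹) (fun k l hkl s => D.exp_mul_le _
      (censoredStat_mem_Ioo hv h1 hr k) _ (censoredStat_mem_Ioo hv h1 hr l) (hc hkl) s) hgc
  have h2 := log_gap_sub_le hm0 (D.antitone_inv hv h1 hr) (D.inv_pos hv h1 hr)
    (D.gap_pos hm hmr hr hv hinj hi)
  simp only [Real.log_inv] at h2
  have h3 := Real.log_le_log (by positivity) hJ
  rw [Real.log_mul hgc.ne' (Real.exp_pos _).ne', Real.log_exp] at h3
  -- the relative length of the window is at least `1 - defect`, and `log (1 - d) ≥ -2 d`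
  have h4 : -2 * defect m r v i ≤ Real.log (gap m (fun j => -censoredStat v r j) i)
      - Real.log (m / N) := by
    rw [← Real.log_div hgc.ne' (by positivity)]
    unfold badWeight at hb
    split_ifs at hb with h
    · have h5 := one_sub_defect_le (v := v) hm0 hr h.1 h.2.1
      have h6 : (N : ℝ) / m * gap m (fun j => -censoredStat v r j) i
          = gap m (fun j => -censoredStat v r j) i / (m / N) := by field_simp
      rw [h6] at h5
      have hd := h.2.2
      refine le_trans ?_ (Real.log_le_log (by linarith) h5)
      have h7 := Real.one_sub_inv_le_log_of_pos (by linarith : 0 < 1 - defect m r v i)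
      refine le_trans ?_ h7
      have h0 := defect_nonneg m r v i
      have h8 : (1 - defect m r v i)⁻¹ ≤ 1 + 2 * defect m r v i := by
        rw [inv_le_iff_one_le_mul₀ (by linarith)]
        nlinarith
      linarith
    · exact absurd rfl hb
  linarith

theorem QuantileData.logSpacing_ge_right (D : QuantileData Q φ) (hm : 2 ≤ m) (hmr : 2 * m < r)
    (hr : r ≤ N) (hv : ∀ a, v a ∈ Set.Ioo (0 : ℝ) 1) (hinj : Function.Injective v) {i : ℤ}
    (hi1 : 1 ≤ i) (hi : i + (m / 2 : ℕ) ≤ r) :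
    2 * Real.log (Q (censoredStat v r i)) - windowCost φ (m / 2) r v i - Real.log 6
      ≤ logSpacing m r (fun a => Q (v a)) i := by
  have h1 : 1 ≤ r := by omega
  rw [D.logSpacing_eq hm hmr hr hv hinj (Finset.mem_Icc.2 ⟨hi1, by omega⟩)]
  obtain ⟨h2, h3⟩ := D.log_sub_inv_ge (m := m) (h := m / 2) (by omega) (by omega) (by omega)
    (by omega) hv hinj hr hi1 hi
  have h4 := log_right_sub_le (by omega : 0 < m) (D.antitone_inv hv h1 hr) (D.inv_pos hv h1 hr) h2
  simp only [Real.log_inv] at h4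
  linarith

theorem QuantileData.logSpacing_ge_left (D : QuantileData Q φ) (hm : 2 ≤ m) (hmr : 2 * m < r)
    (hr : r ≤ N) (hv : ∀ a, v a ∈ Set.Ioo (0 : ℝ) 1) (hinj : Function.Injective v) {i : ℤ}
    (hi1 : 1 ≤ i - (m / 2 : ℕ)) (hi : i ≤ r) :
    Real.log (Q (censoredStat v r i)) + Real.log (Q (censoredStat v r (i - 1 - m)))
      - windowCost φ (m / 2) r v (i - (m / 2 : ℕ)) - Real.log 6
      ≤ logSpacing m r (fun a => Q (v a)) i := by
  have h1 : 1 ≤ r := by omega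
  rw [D.logSpacing_eq hm hmr hr hv hinj (Finset.mem_Icc.2 ⟨by omega, hi⟩)]
  obtain ⟨h2, h3⟩ := D.log_sub_inv_ge (m := m) (h := m / 2) (by omega) (by omega) (by omega)
    (by omega) hv hinj hr hi1 (by omega)
  rw [sub_add_cancel] at h2 h3
  have h4 := log_left_sub_le (by omega : 0 < m) (D.antitone_inv hv h1 hr) (D.inv_pos hv h1 hr) h2
  simp only [Real.log_inv] at h4
  linarith

end pointwise

end

noncomputable section

theorem windowCost_nonneg (φ : ℝ → ℝ) (h : ℕ) {r N : ℕ} (v : Fin N → ℝ) (h1 : 1 ≤ r) (hr : r ≤ N)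
    (i : ℤ) : 0 ≤ windowCost φ h r v i :=
  add_nonneg (winAvg_nonneg (fun _ => abs_nonneg _)
    (censoredStat_mono v h1 hr (by omega))) (le_max_left _ _)

section

variable {Q φ : ℝ → ℝ} {n r m : ℕ → ℕ}

theorem l2Null_weighted_windowCost {h : ℕ → ℕ} (h1 : ∀ k, 1 ≤ r k) (hr : ∀ k, r k ≤ n k)
    (hh : ∀ᶠ k in atTop, 5 ≤ h k) {e : (k : ℕ) → ℤ → (Fin (n k) → ℝ) → ℝ}
    (hem : ∀ k i, Measurable (e k i)) (he0 : ∀ k i v, 0 ≤ e k i v) (he1 : ∀ k i v, e k i v ≤ 1)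
    (he : L2Null n fun k v => (1 / (n k : ℝ)) * ∑ i ∈ Finset.Icc (1 : ℤ) (r k - h k), e k i v)
    (hφm : Measurable φ) (hφ : Integrable φ) :
    L2Null n fun k v => (1 / (n k : ℝ)) * ∑ i ∈ Finset.Icc (1 : ℤ) (r k - h k),
      e k i v * windowCost φ (h k) (r k) v i := by
  have := (l2Null_weighted_winAvg h1 hr hh hem he0 he1 he hφm hφ).add
    (l2Null_weighted_log_spacing h1 hr hh hem he0 he1 he)
  convert this using 3 with k v
  rw [← mul_add, ← Finset.sum_add_distrib]
  simp only [windowCost, mul_add]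

/-- The lower bounds for a single logarithm: the main terms of the regular windows, and in
parentheses the cost of the others, compared with half of the upper window where it fits before the
last observation and with half of the lower window otherwise. -/
theorem QuantileData.logSpacing_ge (D : QuantileData Q φ) {m r N : ℕ} {v : Fin N → ℝ} (hm : 2 ≤ m)
    (hmr : 2 * m < r) (hr : r ≤ N) (hv : ∀ a, v a ∈ Set.Ioo (0 : ℝ) 1)
    (hinj : Function.Injective v) {i : ℤ} (hi : i ∈ Finset.Icc (1 : ℤ) r) :
    (1 - badWeight m r i v) * kerAvg m φ (censoredStat v r) i
      + (1 - badWeight m r i v) * Real.log (Q (censoredStat v r i))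
      + (1 - badWeight m r i v) * Real.log (Q (censoredStat v r (i - 1 - m)))
      - 2 * defect m r v i
      - (2 * (badWeight m r i v * |Real.log (Q (censoredStat v r i))|)
        + Real.log 6 * badWeight m r i v
        + (if i ≤ r - (m / 2 : ℕ) then badWeight m r i v * windowCost φ (m / 2) r v i else 0)
        + (if i ≤ r - (m / 2 : ℕ) then 0 else |Real.log (Q (censoredStat v r (i - 1 - m)))|)
        + (if i ≤ r - (m / 2 : ℕ) then 0 else windowCost φ (m / 2) r v (i - (m / 2 : ℕ))))
      ≤ logSpacing m r (fun a => Q (v a)) i := by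
  have h1 : 1 ≤ r := by omega
  have hW := windowCost_nonneg φ (m / 2) v h1 hr (i - (m / 2 : ℕ))
  have hd := defect_nonneg m r v i
  have hi' := Finset.mem_Icc.1 hi
  have hcase : badWeight m r i v = 0 ∨ badWeight m r i v = 1 := by
    unfold badWeight; split_ifs <;> simp
  have a1 := neg_abs_le (Real.log (Q (censoredStat v r i)))
  have a2 := neg_abs_le (Real.log (Q (censoredStat v r (i - 1 - m))))
  rcases hcase with hb | hb
  · have := D.logSpacing_ge_of_regular hm hmr hr hv hinj hi (by rw [hb]; norm_num)
    rw [hb]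
    split_ifs <;> linarith [abs_nonneg (Real.log (Q (censoredStat v r (i - 1 - m))))]
  · rw [hb]
    split_ifs with h
    · have := D.logSpacing_ge_right hm hmr hr hv hinj hi'.1 (by omega)
      linarith
    · have := D.logSpacing_ge_left hm hmr hr hv hinj (show 1 ≤ i - (m / 2 : ℕ) by omega) hi'.2
      linarith [abs_nonneg (Real.log (Q (censoredStat v r i)))]

theorem l2Null_tail_weight {h : ℕ → ℕ}
    (hhn : Tendsto (fun k => (h k : ℝ) / n k) atTop (𝓝 0)) :
    L2Null n fun k _ => (1 / (n k : ℝ)) * ∑ i ∈ Finset.Icc (1 : ℤ) (r k - h k),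
      if (r k : ℤ) - h k - h k < i then (1 : ℝ) else 0 := by
  refine (L2Null.of_const hhn).mono (fun k => measurable_const)
    (.of_forall fun k => .of_forall fun v => ?_)
  rw [← Finset.sum_filter, Finset.sum_const, nsmul_eq_mul, mul_one, abs_of_nonneg (by positivity),
    abs_of_nonneg (by positivity), one_div, inv_mul_eq_div]
  gcongr
  refine (Finset.card_le_card (t := Finset.Icc ((r k : ℤ) - h k - h k + 1) (r k - h k))
    fun i hi => ?_).trans (le_of_eq ?_)
  · simp only [Finset.mem_filter, Finset.mem_Icc] at hi ⊢; omega
  · rw [Int.card_Icc]; omega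

/-- The lower bound: up to errors that vanish in mean square, the sum of the logarithms in the
estimator is at least the integral of the logarithm of the derivative of the quantile function. -/
theorem QuantileData.exists_l2Null_lower (D : QuantileData Q φ)
    (hmr : ∀ k, 2 * m k < r k) (hr : ∀ k, r k ≤ n k)
    (hm : Tendsto m atTop atTop) (hn : Tendsto n atTop atTop)
    (hmn : Tendsto (fun k => (m k : ℝ) / n k) atTop (𝓝 0)) :
    ∃ Y : (k : ℕ) → (Fin (n k) → ℝ) → ℝ, L2Null n Y ∧
      ∀ᶠ k in atTop, ∀ᵐ v ∂(uniformSample (n k)), -|Y k v| ≤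
        (1 / (n k : ℝ)) * ∑ i ∈ Finset.Icc (1 : ℤ) (r k),
          logSpacing (m k) (r k) (fun a => Q (v a)) i
        - (∫ p in (0 : ℝ)..((r k : ℝ) / n k), φ p)
        - 2 * ∫ p in (0 : ℝ)..((r k : ℝ) / n k), Real.log (Q p) := by
  have h1 : ∀ k, 1 ≤ r k := fun k => by have := hmr k; omega
  have hlQ : Measurable fun p => Real.log (Q p) := D.measurable.log
  have hbm := fun k i => measurable_badWeight (m k) (r k) (n k) i
  have hb0 := fun k i (v : Fin (n k) → ℝ) => badWeight_nonneg (m k) (r k) i v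
  have hb1 := fun k i (v : Fin (n k) → ℝ) => badWeight_le_one (m k) (r k) i v
  have hb := l2Null_badWeight hn h1 hr hm hmn
  have hhn : Tendsto (fun k => ((m k / 2 : ℕ) : ℝ) / n k) atTop (𝓝 0) := by
    refine squeeze_zero (fun k => by positivity) (fun k => ?_) hmn
    gcongr; exact Nat.div_le_self _ _
  have hh5 : ∀ᶠ k in atTop, 5 ≤ m k / 2 := by
    filter_upwards [hm.eventually_ge_atTop 10] with k hk; omega
  -- the main terms, over the regular windows
  have T1 := l2Null_kerAvg hn h1 hr hm hmn D.integrable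
  have T2 := l2Null_shifted_avg hn h1 hr (e := fun k i v => badWeight (m k) (r k) i v)
    hbm hb0 hb1 hb (s := fun _ => 0) (by simp)
    (fun k i hi hi' => absurd hi (by simpa using hi')) hlQ D.memLp_log
  have T3 := l2Null_shifted_avg hn h1 hr (e := fun k i v => badWeight (m k) (r k) i v)
    hbm hb0 hb1 hb (s := fun k => -1 - m k) (by
      have := (hmn.add ((tendsto_one_div_atTop_nhds_zero_nat (𝕜 := ℝ)).comp hn))
      rw [add_zero] at this
      refine this.congr fun k => ?_
      rw [abs_of_nonpos (by push_cast; linarith [(m k).cast_nonneg (α := ℝ)])]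
      push_cast [Function.comp]; ring)
    (fun k i hi hi' v => by
      unfold badWeight
      rw [if_neg]
      rintro ⟨h2, -⟩
      simp only [Finset.mem_Icc] at hi hi'
      omega) hlQ D.memLp_log
  have T4 := l2Null_defect h1 hr hm
  -- the costs of the other windows: those that are compared with half of the upper window, and
  -- those among the last `m / 2` indices, which are compared with half of the lower window
  have T5 := l2Null_weighted h1 hr (I := fun k => Finset.Icc (1 : ℤ) (r k)) hbm hb0 hb1 hb
    (σ := fun _ i => i) (fun k i hi => hi)
    (fun k j _ => by
      refine (Finset.card_le_card (t := {j}) fun i hi => ?_).trans (by simp)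
      simp only [Finset.mem_filter] at hi; simp [hi.2]) hlQ D.memLp_log
  have T6 := l2Null_weighted_windowCost h1 hr hh5 (e := fun k i v => badWeight (m k) (r k) i v)
    hbm hb0 hb1 (by
      refine hb.mono (fun k => (Finset.measurable_fun_sum _ fun i _ => hbm k i).const_mul _)
        (.of_forall fun k => .of_forall fun v => ?_)
      rw [abs_of_nonneg (mul_nonneg (by positivity) (Finset.sum_nonneg fun i _ => hb0 k i v)),
        abs_of_nonneg (mul_nonneg (by positivity) (Finset.sum_nonneg fun i _ => hb0 k i v))]
      refine mul_le_mul_of_nonneg_left ?_ (by positivity)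
      exact Finset.sum_le_sum_of_subset_of_nonneg (Finset.Icc_subset_Icc le_rfl (by omega))
        fun i _ _ => hb0 k i v) D.measurable_log_deriv D.integrable
  have T7 := l2Null_weighted h1 hr
    (I := fun k => Finset.Icc ((r k : ℤ) - (m k / 2 : ℕ) + 1) (r k)) (e := fun _ _ _ => 1)
    (fun _ _ => measurable_const) (fun _ _ _ => zero_le_one) (fun _ _ _ => le_rfl)
    (by
      refine (L2Null.of_const hhn).mono (fun k => measurable_const)
        (.of_forall fun k => .of_forall fun v => le_of_eq ?_)
      rw [Finset.sum_const, Int.card_Icc, nsmul_eq_mul, mul_one, one_div, inv_mul_eq_div]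
      congr 3; omega)
    (σ := fun k i => i - 1 - m k)
    (fun k i hi => by
      have := hmr k
      simp only [Finset.mem_Icc] at hi ⊢; omega)
    (fun k j _ => by
      refine (Finset.card_le_card (t := {j + 1 + m k}) fun i hi => ?_).trans (by simp)
      simp only [Finset.mem_filter] at hi
      simp only [Finset.mem_singleton]; omega) hlQ D.memLp_log
  have T8 := l2Null_weighted_windowCost h1 hr hh5
    (e := fun k i _ => if (r k : ℤ) - (m k / 2 : ℕ) - (m k / 2 : ℕ) < i then (1 : ℝ) else 0)
    (fun _ _ => measurable_const) (fun _ _ _ => by split_ifs <;> norm_num)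
    (fun _ _ _ => by split_ifs <;> norm_num) (l2Null_tail_weight hhn)
    D.measurable_log_deriv D.integrable
  have A := (T1.add (T2.add T3)).add ((T4.const_mul (-2)).add ((T5.const_mul (-2)).add
    ((hb.const_mul (-Real.log 6)).add ((T6.const_mul (-1)).add
      ((T7.const_mul (-1)).add (T8.const_mul (-1)))))))
  refine ⟨_, A, ?_⟩
  filter_upwards [hm.eventually_ge_atTop 2] with k hk
  filter_upwards [ae_uniformSample_mem (n k), ae_uniformSample_injective (n k)] with v hv hinj
  refine (neg_abs_le _).trans ?_
  have key := Finset.sum_le_sum fun i hi => D.logSpacing_ge hk (hmr k) (hr k) hv hinj (i := i) hi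
  have S1 : ∀ F : ℤ → ℝ, ∑ i ∈ Finset.Icc (1 : ℤ) (r k),
      (if i ≤ r k - (m k / 2 : ℕ) then F i else 0)
      = ∑ i ∈ Finset.Icc (1 : ℤ) (r k - (m k / 2 : ℕ)), F i := by
    intro F
    rw [← Finset.sum_filter]
    congr 1; ext i
    simp only [Finset.mem_filter, Finset.mem_Icc]; omega
  have S2 : ∀ F : ℤ → ℝ, ∑ i ∈ Finset.Icc (1 : ℤ) (r k),
      (if i ≤ r k - (m k / 2 : ℕ) then 0 else F i)
      = ∑ i ∈ Finset.Icc ((r k : ℤ) - (m k / 2 : ℕ) + 1) (r k), F i := by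
    intro F
    have := hmr k
    rw [Finset.sum_ite, Finset.sum_const_zero, zero_add]
    congr 1; ext i
    simp only [Finset.mem_filter, Finset.mem_Icc]; omega
  have S3 : ∀ F : ℤ → ℝ, ∑ i ∈ Finset.Icc ((r k : ℤ) - (m k / 2 : ℕ) + 1) (r k),
      F (i - (m k / 2 : ℕ)) = ∑ i ∈ Finset.Icc (1 : ℤ) (r k - (m k / 2 : ℕ)),
        (if (r k : ℤ) - (m k / 2 : ℕ) - (m k / 2 : ℕ) < i then (1 : ℝ) else 0) * F i := by
    intro F
    have := hmr k
    simp only [ite_mul, one_mul, zero_mul]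
    rw [← Finset.sum_filter]
    refine Finset.sum_nbij' (fun i => i - (m k / 2 : ℕ)) (fun i => i + (m k / 2 : ℕ)) ?_ ?_ ?_ ?_ ?_
    · intro i hi; simp only [Finset.mem_filter, Finset.mem_Icc] at hi ⊢; omega
    · intro i hi; simp only [Finset.mem_filter, Finset.mem_Icc] at hi ⊢; omega
    · intro i _; ring
    · intro i _; ring
    · intro i _; rfl
  simp only [Finset.sum_add_distrib, Finset.sum_sub_distrib, ← Finset.mul_sum] at key
  rw [S1, S2, S2, S3 fun i => windowCost φ (m k / 2) (r k) v i] at key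
  have h0 : (0 : ℝ) ≤ 1 / n k := by positivity
  have key2 := mul_le_mul_of_nonneg_left key h0
  have e1 : ∀ i : ℤ, i + (-1 - (m k : ℤ)) = i - 1 - m k := fun i => by ring
  simp only [e1, add_zero, one_mul]
  linarith

end

end

noncomputable section

/-! ### Approximation of the density -/

/-- The number `u` clamped to the interval `[1 / M, M]`. -/
def clampInv (M u : ℝ) : ℝ := max (1 / M) (min M u)

theorem continuous_clampInv (M : ℝ) : Continuous (clampInv M) := by
  unfold clampInv; fun_prop

theorem one_div_le_clampInv (M u : ℝ) : 1 / M ≤ clampInv M u := le_max_left _ _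

theorem clampInv_le {M : ℝ} (hM : 1 ≤ M) (u : ℝ) : clampInv M u ≤ M :=
  max_le ((div_le_one (by linarith)).2 hM |>.trans hM) (min_le_left _ _)

theorem clampInv_pos {M : ℝ} (hM : 1 ≤ M) (u : ℝ) : 0 < clampInv M u :=
  lt_of_lt_of_le (by positivity) (one_div_le_clampInv M u)

theorem clampInv_of_mem {M u : ℝ} (h1 : 1 / M ≤ u) (h2 : u ≤ M) : clampInv M u = u := by
  rw [clampInv, min_eq_right h2, max_eq_right h1]

theorem abs_clampInv_sub_clampInv_le (M u v : ℝ) : |clampInv M u - clampInv M v| ≤ |u - v| := by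
  unfold clampInv
  refine (abs_max_sub_max_le_max _ _ _ _).trans ?_
  rw [sub_self, abs_zero, max_eq_right (abs_nonneg _)]
  refine (abs_min_sub_min_le_max _ _ _ _).trans ?_
  rw [sub_self, abs_zero, max_eq_right (abs_nonneg _)]

theorem abs_log_sub_log_le {M u v : ℝ} (hM : 1 ≤ M) (hu : 1 / M ≤ u) (hv : 1 / M ≤ v) :
    |Real.log u - Real.log v| ≤ M * |u - v| := by
  have hM0 : 0 < M := by linarith
  have key : ∀ a b : ℝ, 1 / M ≤ a → 1 / M ≤ b → Real.log a - Real.log b ≤ M * |a - b| := by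
    intro a b ha hb
    have ha0 : 0 < a := lt_of_lt_of_le (by positivity) ha
    have hb0 : 0 < b := lt_of_lt_of_le (by positivity) hb
    rw [← Real.log_div ha0.ne' hb0.ne']
    refine (Real.log_le_sub_one_of_pos (by positivity)).trans ?_
    have e : a / b - 1 = (a - b) / b := by field_simp
    rw [e, div_le_iff₀ hb0]
    have h1 : 1 ≤ M * b := by rw [div_le_iff₀ hM0] at hb; linarith
    nlinarith [le_abs_self (a - b), abs_nonneg (a - b)]
  refine abs_le.2 ⟨?_, key u v hu hv⟩
  have := key v u hv hu
  rw [abs_sub_comm] at this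
  linarith

theorem abs_clampInv_sub_le {M u : ℝ} (hM : 1 ≤ M) (hu : 0 ≤ u) : |clampInv M u - u| ≤ u + 1 := by
  have h1 : 1 / M ≤ 1 := (div_le_one (by linarith)).2 hM
  have h0 : 0 < 1 / M := by positivity
  unfold clampInv
  rcases le_total M u with h | h
  · rw [min_eq_left h, max_eq_right (by linarith)]
    rw [abs_of_nonpos (by linarith)]; linarith
  · rw [min_eq_right h, abs_of_nonneg (by linarith [le_max_right (1 / M) u])]
    have : max (1 / M) u ≤ u + 1 := max_le (by linarith) (by linarith)
    linarith

theorem abs_log_clampInv_sub_le {M u : ℝ} (hM : 1 ≤ M) (hu : 0 < u) :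
    |Real.log (clampInv M u) - Real.log u| ≤ |Real.log u| := by
  have hM0 : 0 < M := by linarith
  have h1 : 1 / M ≤ 1 := (div_le_one (by linarith)).2 hM
  have h0 : 0 < 1 / M := by positivity
  unfold clampInv
  rcases le_total M u with h | h
  · rw [min_eq_left h, max_eq_right (by linarith)]
    have a1 := Real.log_nonneg hM
    have a2 := Real.log_le_log hM0 h
    rw [abs_of_nonpos (by linarith), abs_of_nonneg (by linarith)]; linarith
  · rw [min_eq_right h]
    rcases le_total (1 / M) u with h2 | h2
    · rw [max_eq_right h2]; simp
    · rw [max_eq_left h2]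
      have a1 := Real.log_nonpos h0.le h1
      have a2 := Real.log_le_log hu h2
      rw [abs_of_nonneg (by linarith), abs_of_nonpos (by linarith)]; linarith

theorem tendsto_clampInv {u : ℝ} (hu : 0 ≤ u) :
    Tendsto (fun N : ℕ => clampInv (N + 1) u) atTop (𝓝 u) := by
  have h1 : Tendsto (fun N : ℕ => 1 / ((N : ℝ) + 1)) atTop (𝓝 0) :=
    tendsto_one_div_add_atTop_nhds_zero_nat
  have h2 : Tendsto (fun N : ℕ => min ((N : ℝ) + 1) u) atTop (𝓝 u) := by
    refine tendsto_const_nhds.congr' ?_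
    filter_upwards [eventually_ge_atTop ⌈u⌉₊] with N hN
    rw [min_eq_right]
    have := (Nat.le_ceil u).trans (by exact_mod_cast hN : ((⌈u⌉₊ : ℕ) : ℝ) ≤ N)
    linarith
  have := h1.max h2
  rwa [max_eq_right hu] at this

/-- The coordinate `x / (1 + x)`, a bijection from `(0, ∞)` onto `(0, 1)`. -/
def toIoo (x : ℝ) : ℝ := x / (1 + x)

theorem measurable_toIoo : Measurable toIoo := by unfold toIoo; fun_prop

theorem toIoo_mem {x : ℝ} (hx : 0 < x) : toIoo x ∈ Set.Ioo (0 : ℝ) 1 :=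
  ⟨by unfold toIoo; positivity, by unfold toIoo; rw [div_lt_one (by positivity)]; linarith⟩

theorem hasDerivAt_toIoo {x : ℝ} (hx : 0 < x) : HasDerivAt toIoo (1 / (1 + x) ^ 2) x := by
  have := (hasDerivAt_id x).div ((hasDerivAt_id x).const_add 1) (by simp; linarith)
  have e : (1 * (1 + id x) - id x * 1) / (1 + id x) ^ 2 = 1 / (1 + x) ^ 2 := by simp
  rw [e] at this
  exact this

theorem toIoo_inv {x : ℝ} (hx : 0 < x) : toIoo x / (1 - toIoo x) = x := by
  unfold toIoo
  field_simp
  ring_nf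

variable {μ : Measure ℝ} {f : ℝ → ℝ}

theorem integrable_density [IsProbabilityMeasure μ] (hf_meas : Measurable f)
    (hf_nonneg : ∀ x, 0 ≤ f x) (hf : μ = volume.withDensity (fun x => ENNReal.ofReal (f x))) :
    Integrable f := by
  refine ⟨hf_meas.aestronglyMeasurable, ?_⟩
  rw [hasFiniteIntegral_iff_ofReal (.of_forall hf_nonneg)]
  have h1 : μ Set.univ = 1 := measure_univ
  rw [hf, withDensity_apply _ MeasurableSet.univ, Measure.restrict_univ] at h1
  rw [h1]; simp

theorem setIntegral_density [IsProbabilityMeasure μ] (hf_meas : Measurable f)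
    (hf_nonneg : ∀ x, 0 ≤ f x) (hf : μ = volume.withDensity (fun x => ENNReal.ofReal (f x)))
    {a b : ℝ} (hab : a ≤ b) : ∫ x in Set.Ioc a b, f x = cdf μ b - cdf μ a := by
  have h1 : μ.real (Set.Ioc a b) = cdf μ b - cdf μ a := by
    have h2 := (cdf μ).measure_Ioc a b
    rw [measure_cdf] at h2
    rw [measureReal_def, h2, ENNReal.toReal_ofReal (sub_nonneg.2 ((cdf μ).mono hab))]
  rw [← h1, measureReal_def]
  conv_rhs => rw [hf]
  rw [withDensity_apply _ measurableSet_Ioc,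
    integral_eq_lintegral_of_nonneg_ae (.of_forall hf_nonneg) hf_meas.aestronglyMeasurable]

/-- The density, expressed in the coordinate `toIoo x`, can be approximated by a continuous function
bounded away from `0` and `∞`, both in `L¹` and, for the logarithms, in `L¹ μ`. -/
theorem exists_clampInv_approx [IsProbabilityMeasure μ] (hf_meas : Measurable f)
    (hf_nonneg : ∀ x, 0 ≤ f x) (hf : μ = volume.withDensity (fun x => ENNReal.ofReal (f x)))
    (hpos : ∀ᵐ x ∂μ, 0 < x)
    (hlogb : Integrable (fun x => Real.log (f x * (1 + x) ^ 2)) μ) {ε : ℝ} (hε : 0 < ε) :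
    ∃ (M : ℝ) (g : ℝ → ℝ), 1 ≤ M ∧ Continuous g ∧ HasCompactSupport g ∧
      ∫ x in Set.Ioi (0 : ℝ), |clampInv M (g (toIoo x)) - f x * (1 + x) ^ 2| * (1 + x ^ 2)⁻¹ ≤ ε ∧
      ∫ x, |Real.log (clampInv M (g (toIoo x))) - Real.log (f x * (1 + x) ^ 2)| ∂μ ≤ ε := by
  set b : ℝ → ℝ := fun x => f x * (1 + x) ^ 2 with hb
  have hbm : Measurable b := by fun_prop
  have hb0 : ∀ x, 0 ≤ b x := fun x => mul_nonneg (hf_nonneg x) (sq_nonneg _)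
  have hfi := integrable_density hf_meas hf_nonneg hf
  have hki := integrable_inv_one_add_sq
  have hfpos : ∀ᵐ x ∂μ, 0 < f x := by
    rw [hf, ae_withDensity_iff (by fun_prop)]
    refine .of_forall fun x hx => ?_
    simpa using hx
  have hbpos : ∀ᵐ x ∂μ, 0 < b x := by
    filter_upwards [hpos, hfpos] with x h1 h2
    positivity
  have hb1 : ∀ x, b x * (1 + x ^ 2)⁻¹ ≤ 2 * f x := fun x => by
    rw [← div_eq_mul_inv, div_le_iff₀ (by positivity)]
    have := hf_nonneg x
    simp only [hb]
    nlinarith [sq_nonneg (1 - x), mul_nonneg this (sq_nonneg (1 - x))]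
  have hbi : Integrable fun x => b x * (1 + x ^ 2)⁻¹ := by
    refine (hfi.const_mul 2).mono' (by fun_prop) (.of_forall fun x => ?_)
    rw [Real.norm_eq_abs, abs_of_nonneg (mul_nonneg (hb0 x) (by positivity))]
    exact hb1 x
  -- truncation of the density
  have lim1 : Tendsto (fun N : ℕ => ∫ x in Set.Ioi (0 : ℝ),
      |clampInv (N + 1) (b x) - b x| * (1 + x ^ 2)⁻¹) atTop (𝓝 0) := by
    have := tendsto_integral_of_dominated_convergence (μ := volume.restrict (Set.Ioi (0 : ℝ)))
      (F := fun (N : ℕ) x => |clampInv (N + 1) (b x) - b x| * (1 + x ^ 2)⁻¹) (f := fun _ => 0)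
      (fun x => b x * (1 + x ^ 2)⁻¹ + (1 + x ^ 2)⁻¹)
      (fun N => by
        have h1 := (continuous_clampInv (N + 1)).measurable.comp hbm
        have h2 : Measurable fun x => |clampInv (N + 1) (b x) - b x| * (1 + x ^ 2)⁻¹ :=
          ((h1.sub hbm).abs).mul (by fun_prop)
        exact h2.aestronglyMeasurable)
      (hbi.add hki).integrableOn
      (fun N => .of_forall fun x => by
        rw [Real.norm_eq_abs, abs_of_nonneg (by positivity)]
        have := abs_clampInv_sub_le (M := (N : ℝ) + 1) (by linarith [N.cast_nonneg (α := ℝ)])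
            (hb0 x)
        calc _ ≤ (b x + 1) * (1 + x ^ 2)⁻¹ := by gcongr
          _ = _ := by ring)
      (.of_forall fun x => by
        have := (((tendsto_clampInv (hb0 x)).sub_const (b x)).abs).mul_const ((1 + x ^ 2)⁻¹)
        simpa using this)
    simpa using this
  have lim2 : Tendsto (fun N : ℕ => ∫ x,
      |Real.log (clampInv (N + 1) (b x)) - Real.log (b x)| ∂μ) atTop (𝓝 0) := by
    have := tendsto_integral_of_dominated_convergence (μ := μ)
      (F := fun (N : ℕ) x => |Real.log (clampInv (N + 1) (b x)) - Real.log (b x)|) (f := fun _ => 0)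
      (fun x => |Real.log (b x)|)
      (fun N => by
        have h1 := (continuous_clampInv (N + 1)).measurable.comp hbm
        have h2 : Measurable fun x => |Real.log (clampInv (N + 1) (b x)) - Real.log (b x)| :=
          (h1.log.sub hbm.log).abs
        exact h2.aestronglyMeasurable)
      hlogb.abs
      (fun N => by
        filter_upwards [hbpos] with x hx
        rw [Real.norm_eq_abs, abs_abs]
        exact abs_log_clampInv_sub_le (by linarith [N.cast_nonneg (α := ℝ)]) hx)
      (by
        filter_upwards [hbpos] with x hx
        have := (((Real.continuousAt_log hx.ne').tendsto.comp (tendsto_clampInv hx.le)).sub_const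
          (Real.log (b x))).abs
        simpa using this)
    simpa using this
  obtain ⟨N, hN1, hN2⟩ := ((lim1.eventually (gt_mem_nhds (half_pos hε))).and
    (lim2.eventually (gt_mem_nhds (half_pos hε)))).exists
  set M : ℝ := (N : ℝ) + 1 with hM
  have hM1 : 1 ≤ M := by simp [hM]
  have hM0 : 0 < M := by linarith
  -- continuous approximation of the truncated density, in the new coordinate
  let κ : Measure ℝ := (volume.restrict (Set.Ioi (0 : ℝ))).withDensity
    fun x => ENNReal.ofReal ((1 + x ^ 2)⁻¹)
  have hκ : IsFiniteMeasure κ := isFiniteMeasure_withDensity_ofReal hki.integrableOn.2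
  have hκm : Measurable fun x : ℝ => ENNReal.ofReal ((1 + x ^ 2)⁻¹) := by fun_prop
  let ρ : Measure ℝ := (κ + μ).map toIoo
  have hρ : IsFiniteMeasure ρ := by dsimp only [ρ]; infer_instance
  let b' : ℝ → ℝ := fun s => clampInv M (b (s / (1 - s)))
  have hb'm : Measurable b' := (continuous_clampInv M).measurable.comp (hbm.comp (by fun_prop))
  have hb'i : Integrable b' ρ := by
    refine Integrable.of_bound hb'm.aestronglyMeasurable M (.of_forall fun s => ?_)
    rw [Real.norm_eq_abs, abs_of_pos (clampInv_pos hM1 _)]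
    exact clampInv_le hM1 _
  obtain ⟨g, hgc, hgb, hg, hgi⟩ :=
    hb'i.exists_hasCompactSupport_integral_sub_le (by positivity : 0 < ε / (2 * M))
  refine ⟨M, g, hM1, hg, hgc, ?_⟩
  have hdi : Integrable (fun x => |b' (toIoo x) - g (toIoo x)|) (κ + μ) := by
    have := (hb'i.sub hgi).abs
    exact (integrable_map_measure this.aestronglyMeasurable measurable_toIoo.aemeasurable).1 this
  have hgb' : ∫ x, |b' (toIoo x) - g (toIoo x)| ∂(κ + μ) ≤ ε / (2 * M) := by
    have h1 := integral_map (μ := κ + μ) measurable_toIoo.aemeasurable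
      (f := fun x => ‖b' x - g x‖) (hb'i.sub hgi).norm.aestronglyMeasurable
    exact h1.symm.le.trans hgb
  rw [integral_add_measure hdi.left_of_add_measure hdi.right_of_add_measure] at hgb'
  have n1 : 0 ≤ ∫ x, |b' (toIoo x) - g (toIoo x)| ∂κ := integral_nonneg fun _ => abs_nonneg _
  have n2 : 0 ≤ ∫ x, |b' (toIoo x) - g (toIoo x)| ∂μ := integral_nonneg fun _ => abs_nonneg _
  have hδ : ε / (2 * M) ≤ ε / 2 := by
    apply div_le_div_of_nonneg_left hε.le (by norm_num); linarith
  have hb'o : ∀ x, 0 < x → b' (toIoo x) = clampInv M (b x) := fun x hx => by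
    simp only [b', toIoo_inv hx]
  have hclose : ∀ x, 0 < x → |clampInv M (g (toIoo x)) - clampInv M (b x)|
      ≤ |b' (toIoo x) - g (toIoo x)| := fun x hx => by
    have h1 := abs_clampInv_sub_clampInv_le M (g (toIoo x)) (clampInv M (b x))
    rw [clampInv_of_mem (one_div_le_clampInv M _) (clampInv_le hM1 _)] at h1
    rwa [hb'o x hx, abs_sub_comm _ (g (toIoo x))]
  have hgom : Measurable fun x => clampInv M (g (toIoo x)) :=
    (continuous_clampInv M).measurable.comp (hg.measurable.comp measurable_toIoo)
  have hTb : Measurable fun x => clampInv M (b x) := (continuous_clampInv M).measurable.comp hbm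
  constructor
  · have e1 : ∫ x, |b' (toIoo x) - g (toIoo x)| ∂κ
        = ∫ x in Set.Ioi (0 : ℝ), |b' (toIoo x) - g (toIoo x)| * (1 + x ^ 2)⁻¹ := by
      dsimp only [κ]
      rw [integral_withDensity_eq_integral_toReal_smul hκm (by simp)]
      refine integral_congr_ae (.of_forall fun x => ?_)
      simp only [smul_eq_mul]
      rw [ENNReal.toReal_ofReal (by positivity), mul_comm]
    have i1 : Integrable (fun x => |b' (toIoo x) - g (toIoo x)| * (1 + x ^ 2)⁻¹)
        (volume.restrict (Set.Ioi (0 : ℝ))) := by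
      have := hdi.left_of_add_measure
      dsimp only [κ] at this
      rw [integrable_withDensity_iff_integrable_smul' hκm (by simp)] at this
      refine this.congr (.of_forall fun x => ?_)
      simp only [smul_eq_mul]
      rw [ENNReal.toReal_ofReal (by positivity), mul_comm]
    have i2 : Integrable (fun x => |clampInv M (b x) - b x| * (1 + x ^ 2)⁻¹)
        (volume.restrict (Set.Ioi (0 : ℝ))) := by
      refine Integrable.mono' (hbi.add hki).integrableOn
        (((hTb.sub hbm).abs.mul (by fun_prop)).aestronglyMeasurable) (.of_forall fun x => ?_)
      rw [Real.norm_eq_abs, abs_of_nonneg (by positivity)]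
      have := abs_clampInv_sub_le hM1 (hb0 x)
      calc _ ≤ (b x + 1) * (1 + x ^ 2)⁻¹ := by gcongr
        _ = _ := by simp only [Pi.add_apply]; ring
    have h2 : ∫ x in Set.Ioi (0 : ℝ), |clampInv M (g (toIoo x)) - b x| * (1 + x ^ 2)⁻¹
        ≤ ∫ x in Set.Ioi (0 : ℝ), (|b' (toIoo x) - g (toIoo x)| * (1 + x ^ 2)⁻¹
          + |clampInv M (b x) - b x| * (1 + x ^ 2)⁻¹) := by
      refine integral_mono_of_nonneg (.of_forall fun x => by positivity) (i1.add i2) ?_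
      filter_upwards [ae_restrict_mem measurableSet_Ioi] with x hx
      have h3 := abs_sub_le (clampInv M (g (toIoo x))) (clampInv M (b x)) (b x)
      have h4 := hclose x hx
      calc _ ≤ (|b' (toIoo x) - g (toIoo x)| + |clampInv M (b x) - b x|) * (1 + x ^ 2)⁻¹ := by
            gcongr; linarith
        _ = _ := by ring
    rw [integral_add i1 i2, ← e1] at h2
    linarith
  · have i1 := hdi.right_of_add_measure
    have i2 : Integrable (fun x => |Real.log (clampInv M (b x)) - Real.log (b x)|) μ := by
      refine Integrable.mono' hlogb.abs (hTb.log.sub hbm.log).abs.aestronglyMeasurable ?_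
      filter_upwards [hbpos] with x hx
      rw [Real.norm_eq_abs, abs_abs]
      exact abs_log_clampInv_sub_le hM1 hx
    have h2 : ∫ x, |Real.log (clampInv M (g (toIoo x))) - Real.log (b x)| ∂μ
        ≤ ∫ x, (M * |b' (toIoo x) - g (toIoo x)|
          + |Real.log (clampInv M (b x)) - Real.log (b x)|) ∂μ := by
      refine integral_mono_of_nonneg (.of_forall fun x => abs_nonneg _) ((i1.const_mul M).add i2) ?_
      filter_upwards [hpos] with x hx
      have h3 := abs_sub_le (Real.log (clampInv M (g (toIoo x)))) (Real.log (clampInv M (b x)))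
        (Real.log (b x))
      have h4 := abs_log_sub_log_le hM1 (one_div_le_clampInv M (g (toIoo x)))
        (one_div_le_clampInv M (b x))
      have h5 := mul_le_mul_of_nonneg_left (hclose x hx) hM0.le
      linarith
    rw [integral_add (i1.const_mul M) i2, integral_const_mul] at h2
    have h6 : M * ∫ x, |b' (toIoo x) - g (toIoo x)| ∂μ ≤ M * (ε / (2 * M)) := by
      gcongr; linarith
    have e : M * (ε / (2 * M)) = ε / 2 := by field_simp
    linarith

end

noncomputable section

variable {μ : Measure ℝ} {f : ℝ → ℝ}

/-- A continuous positive function `β` that approximates the density of `toIoo X`, for `X` with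
density `f`: its integrals and the integral of its logarithm are almost those of the density, and
its logarithm is almost Lipschitz. -/
structure IsDensityApprox (Q φ : ℝ → ℝ) (ε C L : ℝ) (β : ℝ → ℝ) : Prop where
  continuous : Continuous β
  pos : ∀ t, 0 < β t
  abs_log_le : ∀ t, |Real.log (β t)| ≤ L
  nonneg : 0 ≤ C
  abs_log_sub_le : ∀ s t, |Real.log (β s) - Real.log (β t)| ≤ ε + C * |s - t|
  integral_le : ∀ p ∈ Set.Ioo (0 : ℝ) 1, ∀ q ∈ Set.Ioo (0 : ℝ) 1, p ≤ q →
    ∫ t in toIoo (Q p)..toIoo (Q q), β t ≤ q - p + ε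
  abs_integral_log_sub_le : ∀ u ∈ Set.Icc (0 : ℝ) 1,
    |(∫ p in (0 : ℝ)..u, (-Real.log (β (toIoo (Q p))) - 2 * Real.log (toIoo (Q p))))
      - ∫ p in (0 : ℝ)..u, φ p| ≤ ε

theorem integral_comp_toIoo {β : ℝ → ℝ} (hβ : Continuous β) {a b : ℝ} (ha : 0 < a) (hab : a ≤ b) :
    ∫ t in toIoo a..toIoo b, β t = ∫ x in Set.Ioc a b, β (toIoo x) * (1 / (1 + x) ^ 2) := by
  have hpos : ∀ x ∈ Set.uIcc a b, 0 < x := fun x hx => by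
    rw [Set.uIcc_of_le hab] at hx; exact ha.trans_le hx.1
  rw [← intervalIntegral.integral_of_le hab]
  refine (intervalIntegral.integral_comp_mul_deriv (f := toIoo)
    (f' := fun x => 1 / (1 + x) ^ 2) (g := β) (fun x hx => hasDerivAt_toIoo (hpos x hx)) ?_ hβ).symm
  refine ContinuousOn.div continuousOn_const (by fun_prop) fun x hx => ?_
  have := hpos x hx
  positivity

theorem integrable_log_one_add [IsProbabilityMeasure μ] (hpos : ∀ᵐ x ∂μ, 0 < x)
    (hlog : Integrable (fun x => Real.log x ^ 2) μ) :
    Integrable (fun x => Real.log (1 + x)) μ := by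
  have h1 := (memLp_log_quantile hlog).integrable (by norm_num)
  have h2 := (memLp_log_toIoo_quantile hpos hlog).integrable (by norm_num)
  have hm : Measurable fun x : ℝ => Real.log (1 + x) := by fun_prop
  have h3 := (measurePreserving_quantile (μ := μ)).integrable_comp
    (g := fun x : ℝ => Real.log (1 + x)) hm.aestronglyMeasurable
  refine h3.1 ((h1.sub h2).congr ?_)
  filter_upwards [ae_mem_Ioo] with p hp
  have hq := quantile_pos hpos hp
  simp only [Pi.sub_apply, Function.comp]
  rw [Real.log_div (by positivity) (by positivity)]
  ring

theorem ae_density_pos (hf_meas : Measurable f)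
    (hf : μ = volume.withDensity (fun x => ENNReal.ofReal (f x))) : ∀ᵐ x ∂μ, 0 < f x := by
  rw [hf, ae_withDensity_iff (by fun_prop)]
  refine .of_forall fun x hx => ?_
  simpa using hx

theorem exists_isDensityApprox [IsProbabilityMeasure μ] (hf_meas : Measurable f)
    (hf_nonneg : ∀ x, 0 ≤ f x) (hf : μ = volume.withDensity (fun x => ENNReal.ofReal (f x)))
    (hpos : ∀ᵐ x ∂μ, 0 < x)
    (hent : Integrable (fun x => f x * Real.log (f x)) volume)
    (hlog : Integrable (fun x => Real.log x ^ 2) μ) {ε : ℝ} (hε : 0 < ε) :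
    ∃ (C L : ℝ) (β : ℝ → ℝ), IsDensityApprox (quantile μ) (logDerivInv μ f) ε C L β := by
  have hac := absolutelyContinuous_of_density hf
  have hfi := integrable_density hf_meas hf_nonneg hf
  have hl1 := integrable_log_density_quantile hf_meas hf_nonneg hf hent
  have hl2 := integrable_log_one_add hpos hlog
  have hlogb : Integrable (fun x => Real.log (f x * (1 + x) ^ 2)) μ := by
    refine (hl1.add (hl2.const_mul 2)).congr ?_
    filter_upwards [hpos, ae_density_pos hf_meas hf] with x h1 h2
    simp only [Pi.add_apply]
    rw [Real.log_mul (by positivity) (by positivity), Real.log_pow]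
    push_cast; ring
  obtain ⟨M, g, hM, hg, hgc, h1, h2⟩ :=
    exists_clampInv_approx hf_meas hf_nonneg hf hpos hlogb hε
  have hM0 : 0 < M := by linarith
  obtain ⟨C, hC, hgC⟩ := exists_abs_sub_le_add_mul hg hgc (by positivity : 0 < ε / M)
  have hβ : Continuous fun t => clampInv M (g t) := (continuous_clampInv M).comp hg
  have hβb : ∀ t, |Real.log (clampInv M (g t))| ≤ M * (M + 1) := fun t => by
    have h3 := abs_log_sub_log_le hM (one_div_le_clampInv M (g t)) ((div_le_one hM0).2 hM)
    rw [Real.log_one, sub_zero] at h3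
    refine h3.trans ?_
    gcongr
    have := clampInv_pos hM (g t)
    have := clampInv_le hM (g t)
    rw [abs_le]; constructor <;> linarith
  refine ⟨M * C, M * (M + 1), fun t => clampInv M (g t),
    ⟨hβ, fun t => clampInv_pos hM _, hβb, by positivity, fun s t => ?_, fun p hp q hq hpq => ?_,
      fun u hu => ?_⟩⟩
  · refine (abs_log_sub_log_le hM (one_div_le_clampInv M _) (one_div_le_clampInv M _)).trans ?_
    have h3 := (abs_clampInv_sub_clampInv_le M (g s) (g t)).trans (hgC s t)
    calc _ ≤ M * (ε / M + C * |s - t|) := by gcongr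
      _ = _ := by field_simp
  · have ha := quantile_pos hpos hp
    have hab := (quantile_strictMonoOn hac).monotoneOn hp hq hpq
    rw [integral_comp_toIoo hβ ha hab]
    have hsub : Set.Ioc (quantile μ p) (quantile μ q) ⊆ Set.Ioi 0 := fun x hx => ha.trans hx.1
    have hi1 : IntegrableOn f (Set.Ioc (quantile μ p) (quantile μ q)) := hfi.integrableOn
    have hgom : Measurable fun x => clampInv M (g (toIoo x)) :=
      hβ.measurable.comp measurable_toIoo
    have hi2 : IntegrableOn (fun x => |clampInv M (g (toIoo x)) - f x * (1 + x) ^ 2|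
        * (1 + x ^ 2)⁻¹) (Set.Ioi 0) := by
      refine Integrable.mono' (((integrable_inv_one_add_sq.const_mul M).add
        (hfi.const_mul 2)).integrableOn) (((hgom.sub (by fun_prop)).abs.mul
          (by fun_prop)).aestronglyMeasurable) (.of_forall fun x => ?_)
      rw [Real.norm_eq_abs, abs_of_nonneg (by positivity)]
      have h3 := abs_sub (clampInv M (g (toIoo x))) (f x * (1 + x) ^ 2)
      rw [abs_of_pos (clampInv_pos hM _), abs_of_nonneg (mul_nonneg (hf_nonneg x) (sq_nonneg _))]
        at h3
      have h4 := clampInv_le hM (g (toIoo x))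
      rw [← div_eq_mul_inv, div_le_iff₀ (by positivity)]
      simp only [Pi.add_apply]
      have e : (M * (1 + x ^ 2)⁻¹ + 2 * f x) * (1 + x ^ 2) = M + 2 * f x * (1 + x ^ 2) := by
        field_simp
      rw [e]
      nlinarith [mul_nonneg (hf_nonneg x) (sq_nonneg (1 - x))]
    have h3 : ∫ x in Set.Ioc (quantile μ p) (quantile μ q),
        clampInv M (g (toIoo x)) * (1 / (1 + x) ^ 2)
        ≤ ∫ x in Set.Ioc (quantile μ p) (quantile μ q), (f x
          + |clampInv M (g (toIoo x)) - f x * (1 + x) ^ 2| * (1 + x ^ 2)⁻¹) := by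
      refine integral_mono_of_nonneg (.of_forall fun x => mul_nonneg (clampInv_pos hM _).le
        (by positivity)) (hi1.add (hi2.mono_set hsub)) ?_
      filter_upwards [ae_restrict_mem measurableSet_Ioc] with x hx
      have hx0 : 0 < x := hsub hx
      have h4 : clampInv M (g (toIoo x)) * (1 / (1 + x) ^ 2)
          = f x + (clampInv M (g (toIoo x)) - f x * (1 + x) ^ 2) * (1 / (1 + x) ^ 2) := by
        field_simp; ring
      rw [h4]
      gcongr
      · exact le_abs_self _
      · rw [← one_div]
        exact one_div_le_one_div_of_le (by positivity) (by nlinarith)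
    refine h3.trans ?_
    rw [integral_add hi1 (hi2.mono_set hsub), setIntegral_density hf_meas hf_nonneg hf hab,
      cdf_quantile hac hp, cdf_quantile hac hq]
    have h5 := setIntegral_mono_set hi2 (.of_forall fun x => by positivity)
      (LE.le.eventuallyLE hsub)
    linarith
  -- `log f - log β` is transported to `(0, 1)` by the quantile function; `- 2 log (x / (1 + x))`
  -- turns `- log (f x (1 + x) ^ 2)` into `- log (f x) - 2 log x`
  · have hφi := integrable_logDerivInv hf_meas hf_nonneg hf hent hlog
    have hQ := measurable_quantile (μ := μ)
    have hlm : Measurable fun x => Real.log (clampInv M (g (toIoo x))) :=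
      (hβ.measurable.comp measurable_toIoo).log
    have hi1 : Integrable (fun p => Real.log (clampInv M (g (toIoo (quantile μ p)))))
        (volume.restrict (Set.Icc (0 : ℝ) 1)) :=
      Integrable.of_bound (hlm.comp hQ).aestronglyMeasurable (M * (M + 1))
        (.of_forall fun p => hβb _)
    have hi2 : Integrable (fun p => Real.log (toIoo (quantile μ p)))
        (volume.restrict (Set.Icc (0 : ℝ) 1)) :=
      (memLp_log_toIoo_quantile hpos hlog).integrable (by norm_num)
    have hi3 := hi1.neg.sub (hi2.const_mul 2)
    have hsub : Set.Ioc 0 u ⊆ Set.Icc (0 : ℝ) 1 := fun x hx => ⟨hx.1.le, hx.2.trans hu.2⟩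
    have hii : ∀ {F : ℝ → ℝ}, Integrable F (volume.restrict (Set.Icc (0 : ℝ) 1)) →
        IntervalIntegrable F volume 0 u := fun hF => by
      rw [intervalIntegrable_iff_integrableOn_Ioc_of_le hu.1]
      exact IntegrableOn.mono_set hF hsub
    have hsubi := intervalIntegral.integral_sub (hii hi3) (hφi.intervalIntegrable (a := 0) (b := u))
    have e0 : ∀ p, ((-fun p => Real.log (clampInv M (g (toIoo (quantile μ p)))))
      - fun p => 2 * Real.log (toIoo (quantile μ p))) p =
      -Real.log (clampInv M (g (toIoo (quantile μ p)))) - 2 * Real.log (toIoo (quantile μ p)) :=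
      fun p => rfl
    simp only [e0] at hsubi
    rw [← hsubi]
    refine (intervalIntegral.abs_integral_le_integral_abs hu.1).trans ?_
    rw [intervalIntegral.integral_of_le hu.1]
    have hi4 : Integrable (fun p => |-Real.log (clampInv M (g (toIoo (quantile μ p))))
        - 2 * Real.log (toIoo (quantile μ p)) - logDerivInv μ f p|)
        (volume.restrict (Set.Icc (0 : ℝ) 1)) := (hi3.sub hφi.restrict).abs
    refine (setIntegral_mono_set hi4 (.of_forall fun x => abs_nonneg _)
      (LE.le.eventuallyLE hsub)).trans ?_
    have hfm : Measurable fun x : ℝ => Real.log (f x * (1 + x) ^ 2) := by fun_prop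
    have h6 := integral_map (μ := volume.restrict (Set.Icc (0 : ℝ) 1)) hQ.aemeasurable
      (f := fun x => |Real.log (clampInv M (g (toIoo x))) - Real.log (f x * (1 + x) ^ 2)|)
      (hlm.sub hfm).abs.aestronglyMeasurable
    rw [(measurePreserving_quantile (μ := μ)).map_eq] at h6
    rw [h6] at h2
    refine le_trans (le_of_eq (integral_congr_ae ?_)) h2
    filter_upwards [ae_mem_Ioo,
      (measurePreserving_quantile (μ := μ)).quasiMeasurePreserving.ae
        (ae_density_pos hf_meas hf)] with p hp hfp
    have hq := quantile_pos hpos hp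
    rw [logDerivInv, Set.indicator_of_mem hp, ← abs_neg]
    congr 1
    rw [Real.log_mul hfp.ne' (by positivity), Real.log_pow, toIoo,
      Real.log_div (by positivity) (by positivity)]
    push_cast; ring

end

noncomputable section

/-! ### The upper bound -/

variable {Q φ β : ℝ → ℝ} {ε C L : ℝ}

section pointwise

variable {m r N : ℕ} {v : Fin N → ℝ}

theorem toIoo_mono {x y : ℝ} (hx : 0 < x) (hxy : x ≤ y) : toIoo x ≤ toIoo y := by
  unfold toIoo
  rw [div_le_div_iff₀ (by linarith) (by linarith)]
  nlinarith

theorem QuantileData.toIoo_mem (D : QuantileData Q φ) (hv : ∀ a, v a ∈ Set.Ioo (0 : ℝ) 1)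
    (h1 : 1 ≤ r) (hr : r ≤ N) (j : ℤ) : toIoo (Q (censoredStat v r j)) ∈ Set.Ioo (0 : ℝ) 1 :=
  _root_.toIoo_mem (D.pos _ (censoredStat_mem_Ioo hv h1 hr j))

theorem QuantileData.toIoo_mono (D : QuantileData Q φ) (hv : ∀ a, v a ∈ Set.Ioo (0 : ℝ) 1)
    (h1 : 1 ≤ r) (hr : r ≤ N) : Monotone fun j => toIoo (Q (censoredStat v r j)) := by
  intro i j hij
  have hp := censoredStat_mem_Ioo hv h1 hr i
  have hq := censoredStat_mem_Ioo hv h1 hr j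
  exact _root_.toIoo_mono (D.pos _ hp)
    (D.strictMonoOn.monotoneOn hp hq (censoredStat_mono v h1 hr hij))

/-- Over the window of a regular index, the increments of `1 / Q` are controlled by those of the
primitive of `β`, with a factor that is almost constant on the window. -/
theorem IsDensityApprox.mul_gap_le (A : IsDensityApprox Q φ ε C L β) (D : QuantileData Q φ)
    (hv : ∀ a, v a ∈ Set.Ioo (0 : ℝ) 1) (hm : 0 < m) (h1 : 1 ≤ r) (hr : r ≤ N) (i : ℤ) :
    Real.exp (Real.log (β (toIoo (Q (censoredStat v r i)))) - ε
        - C * (toIoo (Q (censoredStat v r (i - 1 + m))) - toIoo (Q (censoredStat v r (i - 1 - m)))))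
        * toIoo (Q (censoredStat v r (i - 1 - m))) ^ 2
      * gap m (fun j => (Q (censoredStat v r j))⁻¹) i
      ≤ gap m (fun j => -∫ t in (0 : ℝ)..toIoo (Q (censoredStat v r j)), β t) i := by
  have hτ := D.toIoo_mem hv h1 hr
  have hmono := D.toIoo_mono hv h1 hr
  have hyτ : ∀ j, (Q (censoredStat v r j))⁻¹ = (toIoo (Q (censoredStat v r j)))⁻¹ - 1 := fun j => by
    have := D.pos _ (censoredStat_mem_Ioo hv h1 hr j)
    unfold toIoo; field_simp; ring
  simp only [hyτ]
  set τ := fun j => toIoo (Q (censoredStat v r j))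
  change Real.exp (Real.log (β (τ i)) - ε - C * (τ (i - 1 + m) - τ (i - 1 - m)))
    * τ (i - 1 - m) ^ 2 * gap m (fun j => (τ j)⁻¹ - 1) i ≤ gap m (fun j => -∫ t in
        (0 : ℝ)..τ j, β t) i
  set K := Real.exp (Real.log (β (τ i)) - ε - C * (τ (i - 1 + m) - τ (i - 1 - m))) with hK
  refine _root_.mul_gap_le hm fun k l hk hkl hl => ?_
  have hk0 := (hτ k).1
  have hl0 := (hτ l).1
  have hm0 := (hτ (i - 1 - m)).1
  have hkl' : τ k ≤ τ l := hmono hkl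
  have hmk : τ (i - 1 - m) ≤ τ k := hmono hk
  have hlm : τ l ≤ τ (i - 1 + m) := hmono hl
  have h2 : (-∫ t in (0 : ℝ)..τ k, β t) - (-∫ t in (0 : ℝ)..τ l, β t) = ∫ t in τ k..τ l, β t := by
    have := intervalIntegral.integral_interval_sub_left (a := 0) (b := τ l) (c := τ k) (μ := volume)
      (A.continuous.intervalIntegrable _ _) (A.continuous.intervalIntegrable _ _)
    linarith
  rw [h2]
  have h3 : K * (τ l - τ k) ≤ ∫ t in τ k..τ l, β t := by
    have e : K * (τ l - τ k) = ∫ _ in τ k..τ l, K := by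
      rw [intervalIntegral.integral_const, smul_eq_mul, mul_comm]
    rw [e]
    refine intervalIntegral.integral_mono_on hkl' (by simp) (A.continuous.intervalIntegrable _ _)
      fun u hu => ?_
    rw [hK, ← Real.le_log_iff_exp_le (A.pos u)]
    have h4 := (abs_le.1 (A.abs_log_sub_le (τ i) u)).2
    have h5 : |τ i - u| ≤ τ (i - 1 + m) - τ (i - 1 - m) := by
      have a1 : τ i ≤ τ (i - 1 + m) := hmono (by omega)
      have a2 : τ (i - 1 - m) ≤ τ i := hmono (by omega)
      rw [abs_le]; constructor <;> linarith [hu.1, hu.2]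
    have h6 := mul_le_mul_of_nonneg_left h5 A.nonneg
    linarith
  refine le_trans ?_ h3
  rw [mul_assoc]
  refine mul_le_mul_of_nonneg_left ?_ (Real.exp_pos _).le
  have e : (τ k)⁻¹ - 1 - ((τ l)⁻¹ - 1) = (τ l - τ k) / (τ k * τ l) := by
    change 0 < τ k at hk0
    change 0 < τ l at hl0
    field_simp; ring
  rw [e, ← mul_div_assoc, div_le_iff₀ (mul_pos hk0 hl0)]
  have h7 : τ (i - 1 - m) ^ 2 ≤ τ k * τ l := by
    rw [sq]; exact mul_le_mul hmk (hmk.trans hkl') hm0.le hk0.le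
  have h8 : 0 ≤ τ l - τ k := by linarith
  nlinarith

/-- This is `log w ≤ w * γ - 1 - log γ` for the rescaled drop `w` of `1 / Q`, where `γ` is the
factor in `IsDensityApprox.mul_gap_le`, which bounds `w * γ`. -/
theorem IsDensityApprox.logSpacing_le (A : IsDensityApprox Q φ ε C L β) (D : QuantileData Q φ)
    (hm : 2 ≤ m) (hmr : 2 * m < r) (hr : r ≤ N) (hv : ∀ a, v a ∈ Set.Ioo (0 : ℝ) 1)
    (hinj : Function.Injective v) {i : ℤ} (hi : i ∈ Finset.Icc (1 : ℤ) r) :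
    logSpacing m r (fun a => Q (v a)) i
      ≤ (N / m : ℝ) * gap m (fun j => -∫ t in (0 : ℝ)..toIoo (Q (censoredStat v r j)), β t) i - 1
        - Real.log (β (toIoo (Q (censoredStat v r i)))) + ε
        + C * (toIoo (Q (censoredStat v r (i - 1 + m))) - toIoo (Q (censoredStat v r (i - 1 - m))))
        - 2 * Real.log (toIoo (Q (censoredStat v r (i - 1 - m))))
        + Real.log (Q (censoredStat v r (i - 1 + m))) + Real.log (Q (censoredStat v r i)) := by
  have h1 : 1 ≤ r := by omega
  have hm0 : 0 < m := by omega
  have hN : 0 < N := by omega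
  have hg := D.gap_pos hm hmr hr hv hinj hi
  have hanti := D.antitone_inv hv h1 hr
  have hpos := D.inv_pos hv h1 hr
  rw [D.logSpacing_eq hm hmr hr hv hinj hi, log_inv_upAvg_sub_eq hm0 hpos hg]
  have h2 := Real.log_le_log (hpos (i - 1 + m)) (le_upAvg hm0 hanti i)
  have h3 := Real.log_le_log (hpos i) (le_loAvg (m := m) hanti i)
  rw [Real.log_inv] at h2 h3
  have h4 := A.mul_gap_le D hv hm0 h1 hr i
  have ht := (D.toIoo_mem hv h1 hr (i - 1 - m)).1
  set G := gap m (fun j => (Q (censoredStat v r j))⁻¹) i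
  set s := Real.log (β (toIoo (Q (censoredStat v r i)))) - ε
    - C * (toIoo (Q (censoredStat v r (i - 1 + m))) - toIoo (Q (censoredStat v r (i - 1 - m))))
    with hs
  set t := toIoo (Q (censoredStat v r (i - 1 - m)))
  have hNm : (0 : ℝ) < N / m := by positivity
  have h5 := Real.log_le_sub_one_of_pos (mul_pos hNm (mul_pos (mul_pos (Real.exp_pos s)
    (pow_pos ht 2)) hg))
  rw [Real.log_mul hNm.ne' (by positivity), Real.log_mul (by positivity) hg.ne',
    Real.log_mul (Real.exp_pos _).ne' (by positivity), Real.log_exp, Real.log_pow] at h5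
  have h6 := mul_le_mul_of_nonneg_left h4 hNm.le
  have h7 : Real.log ((N : ℝ) / m) = -Real.log (m / N) := by rw [← Real.log_inv, inv_div]
  push_cast at h5
  linarith

/-- A crude bound: the lower mean is dropped, and of the upper window only the first `d + 1` terms
are kept. -/
theorem QuantileData.logSpacing_le_left (D : QuantileData Q φ)
    (hm : 2 ≤ m) (hmr : 2 * m < r) (hr : r ≤ N) (hv : ∀ a, v a ∈ Set.Ioo (0 : ℝ) 1)
    (hinj : Function.Injective v) {i : ℤ} (hi : i ∈ Finset.Icc (1 : ℤ) r) {d : ℕ} (hd : d < m) :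
    logSpacing m r (fun a => Q (v a)) i
      ≤ Real.log (N / m) + Real.log (m / (d + 1)) + |Real.log (Q (censoredStat v r (i + d)))| := by
  have h1 : 1 ≤ r := by omega
  have hm0 : 0 < m := by omega
  have hg := D.gap_pos hm hmr hr hv hinj hi
  have hanti := D.antitone_inv hv h1 hr
  have hpos := D.inv_pos hv h1 hr
  have hA := upAvg_pos hm0 hpos i
  have hB := loAvg_pos m hpos i
  rw [D.logSpacing_eq hm hmr hr hv hinj hi]
  have h2 : Real.log ((upAvg m (fun j => (Q (censoredStat v r j))⁻¹) i)⁻¹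
      - (loAvg m (fun j => (Q (censoredStat v r j))⁻¹) i)⁻¹)
      ≤ -Real.log (upAvg m (fun j => (Q (censoredStat v r j))⁻¹) i) := by
    rw [← Real.log_inv]
    refine Real.log_le_log (sub_pos.2 (inv_strictAnti₀ hA ?_)) ?_
    · rw [gap] at hg; linarith
    · have := _root_.inv_pos.2 hB; linarith
  have h3 := mul_le_upAvg hanti (fun j => (hpos j).le) i hd
  have h4 := hpos (i + d)
  have h5 := Real.log_le_log (by positivity) h3
  rw [Real.log_mul (by positivity) h4.ne', Real.log_inv] at h5
  have h6 : Real.log ((d + 1 : ℝ) / m) = -Real.log (m / (d + 1)) := by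
    rw [← Real.log_inv, inv_div]
  have h7 : Real.log ((N : ℝ) / m) = -Real.log (m / N) := by rw [← Real.log_inv, inv_div]
  have h8 := le_abs_self (Real.log (Q (censoredStat v r (i + d))))
  linarith

/-- The upper bounds for a single logarithm. For windows that reach beyond the last observation
the upper mean is compared with an order statistic half way to the last one, which costs the
logarithm of the ratio of `m` to the number of remaining observations. -/
theorem IsDensityApprox.logSpacing_le_sum (A : IsDensityApprox Q φ ε C L β) (D : QuantileData Q φ)
    (hm : 2 ≤ m) (hmr : 2 * m < r) (hr : r ≤ N) (hv : ∀ a, v a ∈ Set.Ioo (0 : ℝ) 1)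
    (hinj : Function.Injective v) {i : ℤ} (hi : i ∈ Finset.Icc (1 : ℤ) r) :
    logSpacing m r (fun a => Q (v a)) i
      ≤ (N / m : ℝ) * gap m (fun j => -∫ t in (0 : ℝ)..toIoo (Q (censoredStat v r j)), β t) i
        + (ε - 1) * (1 - edgeWeight m r i)
        - (1 - edgeWeight m r i) * Real.log (β (toIoo (Q (censoredStat v r i))))
        + C * (toIoo (Q (censoredStat v r (i - 1 + m))) - toIoo (Q (censoredStat v r (i - 1 - m))))
        - 2 * ((1 - edgeWeight m r i) * Real.log (toIoo (Q (censoredStat v r (i - 1 - m)))))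
        + (1 - edgeWeight m r i) * Real.log (Q (censoredStat v r (i - 1 + m)))
        + (1 - edgeWeight m r i) * Real.log (Q (censoredStat v r i))
        + Real.log (N / m) * edgeWeight m r i
        + (if i ≤ m + 1 then |Real.log (Q (censoredStat v r (i - 1 + m)))| else 0)
        + (if r - m + 2 ≤ i then Real.log (2 * m / (r - i + 1)) else 0)
        + (if r - m + 2 ≤ i then |Real.log (Q (censoredStat v r ((i + r) / 2)))| else 0) := by
  have h1 : 1 ≤ r := by omega
  have hm0 : 0 < m := by omega
  have hi' := Finset.mem_Icc.1 hi
  have hmono := D.toIoo_mono hv h1 hr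
  by_cases h : (m : ℤ) + 2 ≤ i ∧ i - 1 + m ≤ r
  · have := A.logSpacing_le D hm hmr hr hv hinj hi
    rw [edgeWeight, if_pos h, if_neg (by omega), if_neg (by omega), if_neg (by omega)]
    linarith
  · have hgap : 0 ≤ gap m (fun j => -∫ t in (0 : ℝ)..toIoo (Q (censoredStat v r j)), β t) i := by
      refine gap_nonneg hm0 (fun k l hkl => neg_le_neg ?_) i
      have h2 := intervalIntegral.integral_interval_sub_left (a := 0)
        (b := toIoo (Q (censoredStat v r l))) (c := toIoo (Q (censoredStat v r k))) (μ := volume)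
        (A.continuous.intervalIntegrable _ _) (A.continuous.intervalIntegrable _ _)
      have h3 := intervalIntegral.integral_nonneg (μ := volume) (hmono hkl)
        fun t _ => (A.pos t).le
      simp only at h3
      linarith
    have hgap' : (0 : ℝ) ≤ N / m *
      gap m (fun j => -∫ t in (0 : ℝ)..toIoo (Q (censoredStat v r j)), β t) i := by positivity
    have hW : 0 ≤ C * (toIoo (Q (censoredStat v r (i - 1 + m)))
        - toIoo (Q (censoredStat v r (i - 1 - m)))) :=
      mul_nonneg A.nonneg (sub_nonneg.2 (hmono (by omega)))
    rw [edgeWeight, if_neg h]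
    by_cases h2 : i ≤ m + 1
    · have h3 := D.logSpacing_le_left hm hmr hr hv hinj hi (show m - 1 < m by omega)
      have e : (m : ℝ) / ((m - 1 : ℕ) + 1) = 1 := by
        rw [Nat.cast_sub (by omega)]; push_cast; rw [sub_add_cancel]; exact div_self (by positivity)
      rw [e, Real.log_one, show i + ((m - 1 : ℕ) : ℤ) = i - 1 + m by omega] at h3
      rw [if_pos h2, if_neg (by omega), if_neg (by omega)]
      linarith
    · have h3 := D.logSpacing_le_left hm hmr hr hv hinj hi
        (show ((r - i) / 2).toNat < m by omega)
      rw [show i + (((r - i) / 2).toNat : ℤ) = (i + r) / 2 by omega] at h3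
      rw [if_neg h2, if_pos (by omega), if_pos (by omega)]
      have h4 : (r : ℝ) - i + 1 ≤ 2 * ((((r - i) / 2).toNat : ℝ) + 1) := by
        have : (r : ℤ) - i + 1 ≤ 2 * ((((r - i) / 2).toNat : ℤ) + 1) := by omega
        exact_mod_cast this
      have h5 : (0 : ℝ) < (r : ℝ) - i + 1 := by
        have : (0 : ℤ) < (r : ℤ) - i + 1 := by omega
        exact_mod_cast this
      have h6 : Real.log (m / ((((r - i) / 2).toNat : ℝ) + 1)) ≤ Real.log (2 * m / (r - i
          + 1)) := by
        refine Real.log_le_log (by positivity) ?_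
        rw [div_le_div_iff₀ (by positivity) h5]
        have : (0 : ℝ) < m := by positivity
        nlinarith
      linarith

end pointwise

/-- This is `m ^ m / m ! ≤ exp m`. -/
theorem sum_log_div_le (m : ℕ) :
    ∑ s ∈ Finset.range m, Real.log (2 * m / (s + 1)) ≤ m * (1 + Real.log 2) := by
  rcases Nat.eq_zero_or_pos m with rfl | hm
  · simp
  have hm' : (0 : ℝ) < m := by exact_mod_cast hm
  have h1 : ∀ s ∈ Finset.range m, Real.log (2 * m / (s + 1))
      = Real.log 2 + (Real.log m - Real.log ((s + 1 : ℕ) : ℝ)) := fun s _ => by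
    rw [Real.log_div (by positivity) (by positivity), Real.log_mul (by norm_num) hm'.ne']
    push_cast; ring
  rw [Finset.sum_congr rfl h1, Finset.sum_add_distrib, Finset.sum_sub_distrib]
  have h2 : ∏ i ∈ Finset.range m, ((i + 1 : ℕ) : ℝ) = (m.factorial : ℝ) := by
    rw [← Nat.cast_prod, Finset.prod_range_add_one_eq_factorial]
  have h3 := Real.pow_div_factorial_le_exp (m : ℝ) hm'.le m
  have hf : (0 : ℝ) < m.factorial := by exact_mod_cast m.factorial_pos
  have h4 := Real.log_le_log (by positivity) h3
  rw [Real.log_exp, Real.log_div (by positivity) hf.ne', Real.log_pow] at h4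
  have h5 : ∑ s ∈ Finset.range m, Real.log ((s + 1 : ℕ) : ℝ) = Real.log m.factorial := by
    rw [← h2, Real.log_prod (fun i _ => by positivity)]
  rw [h5]
  simp only [Finset.sum_const, Finset.card_range, nsmul_eq_mul]
  linarith

theorem sum_tail_log_le {m r : ℕ} (hmr : 2 * m < r) :
    ∑ i ∈ Finset.Icc (1 : ℤ) r, (if (r : ℤ) - m + 2 ≤ i then Real.log (2 * m / (r - i + 1)) else 0)
      ≤ m * (1 + Real.log 2) := by
  refine le_trans ?_ (sum_log_div_le m)
  rw [← Finset.sum_filter]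
  have e : ∑ s ∈ Finset.range (m - 1), Real.log (2 * m / (s + 1))
      = ∑ i ∈ (Finset.Icc (1 : ℤ) r).filter (fun i => (r : ℤ) - m + 2 ≤ i),
        Real.log (2 * m / (r - i + 1)) := by
    refine Finset.sum_nbij' (fun s => (r : ℤ) - s) (fun i => (r - i).toNat) ?_ ?_ ?_ ?_ ?_
    · intro s hs; simp only [Finset.mem_range, Finset.mem_filter, Finset.mem_Icc] at hs ⊢; omega
    · intro s hs; simp only [Finset.mem_range, Finset.mem_filter, Finset.mem_Icc] at hs ⊢; omega
    · intro s hs; simp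
    · intro i hi; simp only [Finset.mem_filter, Finset.mem_Icc] at hi; omega
    · intro s hs; push_cast; ring_nf
  rw [← e]
  refine Finset.sum_le_sum_of_subset_of_nonneg (Finset.range_subset_range.2 (by omega))
    fun s hs _ => Real.log_nonneg ?_
  have hs' : (s : ℝ) + 1 ≤ m := by exact_mod_cast Finset.mem_range.1 hs
  rw [le_div_iff₀ (by positivity)]
  linarith [s.cast_nonneg (α := ℝ)]

end

noncomputable section

variable {Q φ β : ℝ → ℝ} {ε C L : ℝ} {n r m : ℕ → ℕ}

/-- The drops of the primitive of `β` add up to at most `m` times its total drop, which is almost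
the distribution function of the data at the last observation. -/
theorem sum_gap_primitive_le {m r N : ℕ} (A : IsDensityApprox Q φ ε C L β) (D : QuantileData Q φ)
    (hm : 0 < m) (h1 : 1 ≤ r) (hr : r ≤ N) {v : Fin N → ℝ}
    (hv : ∀ a, v a ∈ Set.Ioo (0 : ℝ) 1) :
    ∑ i ∈ Finset.Icc (1 : ℤ) r,
      gap m (fun j => -∫ t in (0 : ℝ)..toIoo (Q (censoredStat v r j)), β t) i
      ≤ m * (orderStat v r + ε) := by
  have hmono := D.toIoo_mono hv h1 hr
  have hsub : ∀ i j : ℤ, (-∫ t in (0 : ℝ)..toIoo (Q (censoredStat v r i)), β t)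
      - (-∫ t in (0 : ℝ)..toIoo (Q (censoredStat v r j)), β t)
      = ∫ t in toIoo (Q (censoredStat v r i))..toIoo (Q (censoredStat v r j)), β t := fun i j => by
    have := intervalIntegral.integral_interval_sub_left (a := 0)
        (b := toIoo (Q (censoredStat v r j))) (c := toIoo (Q (censoredStat v r i))) (μ := volume)
        (A.continuous.intervalIntegrable _ _) (A.continuous.intervalIntegrable _ _)
    linarith
  have h2 := sum_gap_le hm (r := r)
    (a := fun j => -∫ t in (0 : ℝ)..toIoo (Q (censoredStat v r j)), β t)
    (fun i => by
      rw [← sub_nonneg, hsub]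
      refine intervalIntegral.integral_nonneg ?_ fun t _ => (A.pos t).le
      have h3 := censoredStat_one_le v h1 hr i
      exact toIoo_mono (D.pos _ (censoredStat_mem_Ioo hv h1 hr 1)) (D.strictMonoOn.monotoneOn
        (censoredStat_mem_Ioo hv h1 hr 1) (censoredStat_mem_Ioo hv h1 hr i) h3))
    (fun i => by
      rw [← sub_nonneg, hsub]
      refine intervalIntegral.integral_nonneg ?_ fun t _ => (A.pos t).le
      have h3 := censoredStat_le_last v h1 hr i
      exact toIoo_mono (D.pos _ (censoredStat_mem_Ioo hv h1 hr i)) (D.strictMonoOn.monotoneOn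
        (censoredStat_mem_Ioo hv h1 hr i) (censoredStat_mem_Ioo hv h1 hr r) h3))
  refine h2.trans ?_
  rw [hsub]
  have h3 := A.integral_le _ (censoredStat_mem_Ioo hv h1 hr 1) _ (censoredStat_mem_Ioo hv h1 hr r)
    (censoredStat_one_le v h1 hr r)
  have h4 := (censoredStat_mem_Ioo hv h1 hr 1).1
  have h5 : censoredStat v r r = orderStat v r := by
    rw [censoredStat_of_mem v (by exact_mod_cast h1) le_rfl, Int.toNat_natCast]
  rw [← h5]
  gcongr
  linarith

/-- The terms come from the oscillation of `log β` over the windows, from the at most `3 m` windows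
that reach over an end, and from `sum_tail_log_le`. -/
theorem tendsto_boundary_cost (C : ℝ)
    (hmn : Tendsto (fun k => (m k : ℝ) / n k) atTop (𝓝 0)) :
    Tendsto (fun k => 2 * C * ((m k : ℝ) / n k) + 3 * Real.negMulLog ((m k : ℝ) / n k)
      + (1 + Real.log 2) * ((m k : ℝ) / n k)) atTop (𝓝 0) := by
  have h1 : Tendsto (fun k => Real.negMulLog ((m k : ℝ) / n k)) atTop (𝓝 0) := by
    have := (Real.continuous_negMulLog.tendsto 0).comp hmn
    simpa [Function.comp_def] using this
  simpa using ((hmn.const_mul (2 * C)).add (h1.const_mul 3)).add (hmn.const_mul (1 + Real.log 2))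

/-- The upper bound: up to errors that vanish in mean square and a small constant, the sum of the
logarithms in the estimator is at most the integral of the logarithm of the derivative of the
quantile function. -/
theorem QuantileData.exists_l2Null_upper (D : QuantileData Q φ)
    (hcoord : MemLp (fun p => Real.log (toIoo (Q p))) 2 (volume.restrict (Set.Icc (0 : ℝ) 1)))
    (hmr : ∀ k, 2 * m k < r k) (hr : ∀ k, r k ≤ n k)
    (hm : Tendsto m atTop atTop) (hn : Tendsto n atTop atTop)
    (hmn : Tendsto (fun k => (m k : ℝ) / n k) atTop (𝓝 0))
    (hε : 0 < ε) (A : IsDensityApprox Q φ ε C L β) :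
    ∃ Y : (k : ℕ) → (Fin (n k) → ℝ) → ℝ, L2Null n Y ∧
      ∀ᶠ k in atTop, ∀ᵐ v ∂(uniformSample (n k)),
        (1 / (n k : ℝ)) * ∑ i ∈ Finset.Icc (1 : ℤ) (r k),
          logSpacing (m k) (r k) (fun a => Q (v a)) i
        - (∫ p in (0 : ℝ)..((r k : ℝ) / n k), φ p)
        - 2 * (∫ p in (0 : ℝ)..((r k : ℝ) / n k), Real.log (Q p)) ≤ |Y k v| + 3 * ε := by
  have h1 : ∀ k, 1 ≤ r k := fun k => by have := hmr k; omega
  have hlQ : Measurable fun p => Real.log (Q p) := D.measurable.log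
  have hlO : Measurable fun p => Real.log (toIoo (Q p)) := (measurable_toIoo.comp D.measurable).log
  have hlβ : Measurable fun p => Real.log (β (toIoo (Q p))) :=
    (A.continuous.measurable.comp (measurable_toIoo.comp D.measurable)).log
  have hβ2 : MemLp (fun p => Real.log (β (toIoo (Q p)))) 2 (volume.restrict (Set.Icc (0 : ℝ) 1)) :=
    MemLp.of_bound hlβ.aestronglyMeasurable L (.of_forall fun p => A.abs_log_le _)
  have hem : ∀ k (i : ℤ), Measurable fun _ : Fin (n k) → ℝ => edgeWeight (m k) (r k) i :=
    fun _ _ => measurable_const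
  have he0 := fun k i (_ : Fin (n k) → ℝ) => edgeWeight_nonneg (m k) (r k) i
  have he1 := fun k i (_ : Fin (n k) → ℝ) => edgeWeight_le_one (m k) (r k) i
  have he := l2Null_edgeWeight (r := r) hn hmn
  have h1n : Tendsto (fun k => 1 / (n k : ℝ)) atTop (𝓝 0) :=
    (tendsto_one_div_atTop_nhds_zero_nat (𝕜 := ℝ)).comp hn
  have hm1n : Tendsto (fun k => ((m k : ℝ) + 1) / n k) atTop (𝓝 0) := by
    have := hmn.add h1n
    rw [add_zero] at this
    refine this.congr fun k => ?_
    ring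
  -- the telescoping sum and the averages over the windows inside the sample
  have U1 := l2Null_orderStat_sub hn h1 hr
  have U3 := l2Null_shifted_avg hn h1 hr (e := fun k i _ => edgeWeight (m k) (r k) i)
    hem he0 he1 he (s := fun _ => 0) (by simp)
    (fun k i hi hi' => absurd hi (by simpa using hi')) hlβ hβ2
  have U4 := l2Null_shifted_avg hn h1 hr (e := fun k i _ => edgeWeight (m k) (r k) i)
    hem he0 he1 he (s := fun k => -1 - m k) (by
      refine hm1n.congr fun k => ?_
      rw [abs_of_nonpos (by push_cast; linarith [(m k).cast_nonneg (α := ℝ)])]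
      push_cast; ring)
    (fun k i hi hi' v => by
      rw [edgeWeight, if_neg]
      rintro ⟨h2, -⟩
      simp only [Finset.mem_Icc] at hi hi'
      omega) hlO hcoord
  have U5 := l2Null_shifted_avg hn h1 hr (e := fun k i _ => edgeWeight (m k) (r k) i)
    hem he0 he1 he (s := fun k => -1 + m k) (by
      refine squeeze_zero (fun k => by positivity) (fun k => ?_) hm1n
      gcongr
      push_cast
      rw [abs_le]; constructor <;> linarith [(m k).cast_nonneg (α := ℝ)])
    (fun k i hi hi' v => by
      rw [edgeWeight, if_neg]
      rintro ⟨h2, h3⟩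
      simp only [Finset.mem_Icc] at hi hi'
      omega) hlQ D.memLp_log
  have U6 := l2Null_shifted_avg hn h1 hr (e := fun k i _ => edgeWeight (m k) (r k) i)
    hem he0 he1 he (s := fun _ => 0) (by simp)
    (fun k i hi hi' => absurd hi (by simpa using hi')) hlQ D.memLp_log
  -- the windows that reach over an end; there are at most `m + 1` on each side, and no order
  -- statistic is used more than twice
  have U8 := L2Null.of_const (n := n) (tendsto_boundary_cost (m := m) (n := n) C hmn)
  have U9 := l2Null_weighted h1 hr
    (I := fun k => (Finset.Icc (1 : ℤ) (r k)).filter fun i : ℤ => i ≤ m k + 1) (e := fun _ _ _ => 1)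
    (fun _ _ => measurable_const) (fun _ _ _ => zero_le_one) (fun _ _ _ => le_rfl)
    (by
      refine (L2Null.of_const hm1n).mono (fun k => measurable_const)
        (.of_forall fun k => .of_forall fun v => ?_)
      rw [Finset.sum_const, nsmul_eq_mul, mul_one, abs_of_nonneg (by positivity),
        abs_of_nonneg (by positivity), one_div, inv_mul_eq_div]
      gcongr
      have : ((Finset.Icc (1 : ℤ) (r k)).filter fun i : ℤ => i ≤ m k + 1).card ≤ m k + 1 := by
        refine (Finset.card_le_card (t := Finset.Icc (1 : ℤ) (m k + 1)) fun i hi => ?_).trans ?_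
        · simp only [Finset.mem_filter, Finset.mem_Icc] at hi ⊢; omega
        · rw [Int.card_Icc]; omega
      exact_mod_cast this)
    (σ := fun k i => max 1 (i - 1 + m k))
    (fun k i hi => by
      have := hmr k
      simp only [Finset.mem_filter, Finset.mem_Icc] at hi ⊢; omega)
    (fun k j _ => by
      refine (Finset.card_le_card (t := {j + 1 - m k, 1}) fun i hi => ?_).trans Finset.card_le_two
      simp only [Finset.mem_filter, Finset.mem_Icc] at hi
      simp only [Finset.mem_insert, Finset.mem_singleton]; omega) hlQ D.memLp_log
  have U11 := l2Null_weighted h1 hr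
    (I := fun k => (Finset.Icc (1 : ℤ) (r k)).filter fun i : ℤ => (r k : ℤ) - m k + 2 ≤ i)
    (e := fun _ _ _ => 1)
    (fun _ _ => measurable_const) (fun _ _ _ => zero_le_one) (fun _ _ _ => le_rfl)
    (by
      refine (L2Null.of_const hm1n).mono (fun k => measurable_const)
        (.of_forall fun k => .of_forall fun v => ?_)
      rw [Finset.sum_const, nsmul_eq_mul, mul_one, abs_of_nonneg (by positivity),
        abs_of_nonneg (by positivity), one_div, inv_mul_eq_div]
      gcongr
      have : ((Finset.Icc (1 : ℤ) (r k)).filter fun i : ℤ => (r k : ℤ) - m k + 2 ≤ i).card ≤ m k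
          + 1 := by
        refine (Finset.card_le_card (t := Finset.Icc ((r k : ℤ) - m k + 2) (r k))
          fun i hi => ?_).trans ?_
        · simp only [Finset.mem_filter, Finset.mem_Icc] at hi ⊢; omega
        · rw [Int.card_Icc]; omega
      exact_mod_cast this)
    (σ := fun k i => (i + r k) / 2)
    (fun k i hi => by
      have := hmr k
      simp only [Finset.mem_filter, Finset.mem_Icc] at hi ⊢; omega)
    (fun k j _ => by
      refine (Finset.card_le_card (t := {2 * j - r k, 2 * j + 1 - r k}) fun i hi => ?_).trans
        Finset.card_le_two
      simp only [Finset.mem_filter, Finset.mem_Icc] at hi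
      simp only [Finset.mem_insert, Finset.mem_singleton]; omega) hlQ D.memLp_log
  have B := (U1.add ((he.const_mul (1 - ε)).add ((U3.const_mul (-1)).add
    ((U4.const_mul (-2)).add (U5.add U6))))).add (U8.add (U9.add U11))
  refine ⟨_, B, ?_⟩
  filter_upwards [hm.eventually_ge_atTop 2] with k hk
  filter_upwards [ae_uniformSample_mem (n k), ae_uniformSample_injective (n k)] with v hv hinj
  have hN : 0 < n k := (h1 k).trans (hr k)
  have hN' : (0 : ℝ) < n k := by exact_mod_cast hN
  have hm' : (0 : ℝ) < m k := by exact_mod_cast (by omega : 0 < m k)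
  have h0 : (0 : ℝ) ≤ 1 / n k := by positivity
  have hrn1 : (r k : ℝ) / n k ≤ 1 := (div_le_one hN').2 (by exact_mod_cast hr k)
  have hrn0 : (0 : ℝ) ≤ (r k : ℝ) / n k := by positivity
  have key := Finset.sum_le_sum fun i hi => A.logSpacing_le_sum D hk (hmr k) (hr k) hv hinj
    (i := i) hi
  -- it remains to sum the bounds of `logSpacing_le_sum` term by term
  have S1 := sum_gap_primitive_le A D (by omega : 0 < m k) (h1 k) (hr k) hv
  have hO := fun j => D.toIoo_mem hv (h1 k) (hr k) j
  have hOm := D.toIoo_mono hv (h1 k) (hr k)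
  have S2 := sum_window_le (by omega : 0 < m k) (r := r k)
    (c := fun j => toIoo (Q (censoredStat v (r k) j)))
    (fun i => _root_.toIoo_mono (D.pos _ (censoredStat_mem_Ioo hv (h1 k) (hr k) 1))
      (D.strictMonoOn.monotoneOn (censoredStat_mem_Ioo hv (h1 k) (hr k) 1)
        (censoredStat_mem_Ioo hv (h1 k) (hr k) i) (censoredStat_one_le v (h1 k) (hr k) i)))
    (fun i => _root_.toIoo_mono (D.pos _ (censoredStat_mem_Ioo hv (h1 k) (hr k) i))
      (D.strictMonoOn.monotoneOn (censoredStat_mem_Ioo hv (h1 k) (hr k) i)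
        (censoredStat_mem_Ioo hv (h1 k) (hr k) (r k)) (censoredStat_le_last v (h1 k) (hr k) i)))
  have S2' : ∑ i ∈ Finset.Icc (1 : ℤ) (r k), (toIoo (Q (censoredStat v (r k) (i - 1 + m k)))
      - toIoo (Q (censoredStat v (r k) (i - 1 - m k)))) ≤ 2 * m k := by
    refine S2.trans (mul_le_of_le_one_right (by positivity) ?_)
    linarith [(hO (r k)).2, (hO 1).1]
  have S3 := sum_tail_log_le (hmr k)
  have S4 := sum_edgeWeight_le (m k) (r k)
  have S5 : ∑ i ∈ Finset.Icc (1 : ℤ) (r k), (1 - edgeWeight (m k) (r k) i)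
      = r k - ∑ i ∈ Finset.Icc (1 : ℤ) (r k), edgeWeight (m k) (r k) i := by
    rw [Finset.sum_sub_distrib]; simp
  have hlog : Real.negMulLog ((m k : ℝ) / n k) = (m k / n k) * Real.log (n k / m k) := by
    rw [Real.negMulLog, ← inv_div, Real.log_inv]; simp
  have hlog0 : 0 ≤ Real.log ((n k : ℝ) / m k) := by
    refine Real.log_nonneg ((one_le_div hm').2 ?_)
    have := hmr k; have := hr k
    exact_mod_cast (by omega : m k ≤ n k)
  have P1 : (1 / (n k : ℝ)) * ((n k / m k : ℝ) * ∑ i ∈ Finset.Icc (1 : ℤ) (r k),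
      gap (m k) (fun j => -∫ t in (0 : ℝ)..toIoo (Q (censoredStat v (r k) j)), β t) i)
      ≤ orderStat v (r k) + ε := by
    calc _ ≤ (1 / (n k : ℝ)) * ((n k / m k : ℝ) * (m k * (orderStat v (r k) + ε))) := by gcongr
      _ = _ := by field_simp
  have P2 : (1 / (n k : ℝ)) * (C * ∑ i ∈ Finset.Icc (1 : ℤ) (r k),
      (toIoo (Q (censoredStat v (r k) (i - 1 + m k)))
        - toIoo (Q (censoredStat v (r k) (i - 1 - m k))))) ≤ 2 * C * (m k / n k) := by
    have hC := A.nonneg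
    calc _ ≤ (1 / (n k : ℝ)) * (C * (2 * m k)) := by gcongr
      _ = _ := by ring
  have P3 : (1 / (n k : ℝ)) * (Real.log (n k / m k) * ∑ i ∈ Finset.Icc (1 : ℤ) (r k),
      edgeWeight (m k) (r k) i) ≤ 3 * Real.negMulLog ((m k : ℝ) / n k) := by
    have hm1 : (1 : ℝ) ≤ m k := by exact_mod_cast (by omega : 1 ≤ m k)
    calc _ ≤ (1 / (n k : ℝ)) * (Real.log (n k / m k) * (3 * m k)) := by
          gcongr; linarith
      _ = _ := by rw [hlog]; ring
  have P4 : (1 / (n k : ℝ)) * (∑ i ∈ Finset.Icc (1 : ℤ) (r k),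
      (if (r k : ℤ) - m k + 2 ≤ i then Real.log (2 * m k / (r k - i + 1)) else 0))
      ≤ (1 + Real.log 2) * (m k / n k) := by
    calc _ ≤ (1 / (n k : ℝ)) * (m k * (1 + Real.log 2)) := by gcongr
      _ = _ := by ring
  have P5 := (abs_le.1 (A.abs_integral_log_sub_le _ ⟨hrn0, hrn1⟩)).2
  have hsub : Set.Ioc 0 ((r k : ℝ) / n k) ⊆ Set.Icc (0 : ℝ) 1 :=
    fun x hx => ⟨hx.1.le, hx.2.trans hrn1⟩
  have hii : ∀ {F : ℝ → ℝ}, MemLp F 2 (volume.restrict (Set.Icc (0 : ℝ) 1)) →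
      IntervalIntegrable F volume 0 ((r k : ℝ) / n k) := fun hF => by
    rw [intervalIntegrable_iff_integrableOn_Ioc_of_le hrn0]
    exact IntegrableOn.mono_set (hF.integrable (by norm_num)) hsub
  have P6 : ∫ p in (0 : ℝ)..((r k : ℝ) / n k),
      (-Real.log (β (toIoo (Q p))) - 2 * Real.log (toIoo (Q p)))
      = -(∫ p in (0 : ℝ)..((r k : ℝ) / n k), Real.log (β (toIoo (Q p))))
        - 2 * ∫ p in (0 : ℝ)..((r k : ℝ) / n k), Real.log (toIoo (Q p)) := by
    rw [← intervalIntegral.integral_neg, ← intervalIntegral.integral_const_mul]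
    exact intervalIntegral.integral_sub (hii hβ2).neg ((hii hcoord).const_mul 2)
  rw [P6] at P5
  simp only [Finset.sum_add_distrib, Finset.sum_sub_distrib, ← Finset.mul_sum] at key S5
  have key2 := mul_le_mul_of_nonneg_left key h0
  have e1 : ∀ i : ℤ, i + (-1 - (m k : ℤ)) = i - 1 - m k := fun i => by ring
  have e2 : ∀ i : ℤ, i + (-1 + (m k : ℤ)) = i - 1 + m k := fun i => by ring
  have e3 : ∑ i ∈ (Finset.Icc (1 : ℤ) (r k)).filter (fun i : ℤ => i ≤ m k + 1),
      |Real.log (Q (censoredStat v (r k) (max 1 (i - 1 + m k))))|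
      = ∑ i ∈ Finset.Icc (1 : ℤ) (r k),
        if i ≤ m k + 1 then |Real.log (Q (censoredStat v (r k) (i - 1 + m k)))| else 0 := by
    rw [Finset.sum_filter]
    refine Finset.sum_congr rfl fun i hi => ?_
    rw [Finset.mem_Icc] at hi
    rw [max_eq_right (by omega)]
  refine le_trans ?_ (add_le_add_left (le_abs_self _) _)
  simp only [e1, e2, add_zero, one_mul]
  rw [e3, Finset.sum_filter (fun i : ℤ => (r k : ℤ) - m k + 2 ≤ i)]
  simp only [Finset.sum_sub_distrib] at P2
  rw [S5] at key2
  have S7 : ε * ((r k : ℝ) / n k) ≤ ε := mul_le_of_le_one_right hε.le hrn1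
  have S6 : (1 / (n k : ℝ)) * r k = r k / n k := by ring
  have S8 : ε * ((1 / (n k : ℝ)) * r k) = ε * (r k / n k) := by rw [S6]
  linarith

end

noncomputable section

/-! ### Consistency of the estimator -/

section L2Null

variable {n : ℕ → ℕ} {Y : (k : ℕ) → (Fin (n k) → ℝ) → ℝ}

theorem L2Null.eventually_memLp (hY : L2Null n Y) :
    ∀ᶠ k in atTop, MemLp (Y k) 2 (uniformSample (n k)) := by
  filter_upwards [hY.2.eventually (gt_mem_nhds ENNReal.zero_lt_top)] with k hk
  exact ⟨(hY.1 k).aestronglyMeasurable, hk⟩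

theorem L2Null.tendsto_integral_abs (hY : L2Null n Y) :
    Tendsto (fun k => ∫ v, |Y k v| ∂(uniformSample (n k))) atTop (𝓝 0) := by
  have h1 := (ENNReal.tendsto_toReal ENNReal.zero_ne_top).comp hY.2
  rw [ENNReal.toReal_zero] at h1
  refine tendsto_of_tendsto_of_tendsto_of_le_of_le' tendsto_const_nhds h1
    (.of_forall fun k => integral_nonneg fun _ => abs_nonneg _) ?_
  filter_upwards [hY.2.eventually (gt_mem_nhds ENNReal.zero_lt_top)] with k hk
  have h2 := integral_norm_eq_lintegral_enorm
    (hY.1 k).aestronglyMeasurable (μ := uniformSample (n k))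
  rw [← eLpNorm_one_eq_lintegral_enorm] at h2
  refine (show _ = _ from h2).le.trans (ENNReal.toReal_mono hk.ne ?_)
  exact eLpNorm_le_eLpNorm_of_exponent_le (by norm_num) (hY.1 k).aestronglyMeasurable

theorem L2Null.tendsto_integral (hY : L2Null n Y) :
    Tendsto (fun k => ∫ v, Y k v ∂(uniformSample (n k))) atTop (𝓝 0) :=
  squeeze_zero_norm (fun _ => norm_integral_le_integral_norm _) hY.tendsto_integral_abs

theorem L2Null.tendsto_integral_sq (hY : L2Null n Y) :
    Tendsto (fun k => ∫ v, Y k v ^ 2 ∂(uniformSample (n k))) atTop (𝓝 0) := by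
  have h1 := (ENNReal.tendsto_toReal ENNReal.zero_ne_top).comp hY.2
  rw [ENNReal.toReal_zero] at h1
  have h2 := h1.pow 2
  rw [zero_pow two_ne_zero] at h2
  refine h2.congr fun k => ?_
  rw [integral_eq_lintegral_of_nonneg_ae (.of_forall fun _ => sq_nonneg _)
    ((hY.1 k).pow_const 2).aestronglyMeasurable, lintegral_sq_eq_eLpNorm, ENNReal.toReal_pow]
  rfl

end L2Null

theorem measurable_logSpacing (m r N : ℕ) (i : ℤ) :
    Measurable fun x : Fin N → ℝ => logSpacing m r x i := by
  have h : ∀ s : Finset ℤ, Measurable fun x : Fin N → ℝ => harmonicMean s (censoredStat x r) :=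
    fun s => measurable_const.div
      (Finset.measurable_fun_sum _ fun j _ => (measurable_censoredStat r j).inv)
  exact (((h _).sub (h _)).div_const _).log

theorem entropyEstimator_eq {N : ℕ} (x : Fin N → ℝ) (m r : ℕ) :
    entropyEstimator x m r = (1 / (N : ℝ)) * ∑ i ∈ Finset.Icc (1 : ℤ) r, logSpacing m r x i
      - (1 - (r : ℝ) / N) * Real.log (1 - (r : ℝ) / N) := rfl

theorem measurable_entropyEstimator (m r N : ℕ) :
    Measurable fun x : Fin N → ℝ => entropyEstimator x m r := by
  simp only [entropyEstimator_eq]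
  exact ((Finset.measurable_fun_sum _ fun i _ =>
    measurable_logSpacing m r N i).const_mul _).sub_const _

variable {μ : Measure ℝ} {f : ℝ → ℝ}

theorem quantileData [IsProbabilityMeasure μ] (hf_meas : Measurable f)
    (hf_nonneg : ∀ x, 0 ≤ f x) (hf : μ = volume.withDensity (fun x => ENNReal.ofReal (f x)))
    (hpos : ∀ᵐ x ∂μ, 0 < x)
    (hent : Integrable (fun x => f x * Real.log (f x)) volume)
    (hlog : Integrable (fun x => Real.log x ^ 2) μ) :
    QuantileData (quantile μ) (logDerivInv μ f) where
  pos _ hp := quantile_pos hpos hp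
  strictMonoOn := quantile_strictMonoOn (absolutelyContinuous_of_density hf)
  measurable := measurable_quantile
  memLp_log := memLp_log_quantile hlog
  measurable_log_deriv := measurable_logDerivInv hf_meas
  integrable := integrable_logDerivInv hf_meas hf_nonneg hf hent hlog
  exp_mul_le _ hp _ hq hpq := exp_mul_le_sub_inv_quantile hf_meas hf_nonneg hf hpos
    (integrable_logDerivInv hf_meas hf_nonneg hf hent hlog) hp hq hpq

theorem integral_log_deriv_quantile_eq [IsProbabilityMeasure μ] (hf_meas : Measurable f)
    (hf_nonneg : ∀ x, 0 ≤ f x) (hf : μ = volume.withDensity (fun x => ENNReal.ofReal (f x)))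
    (hent : Integrable (fun x => f x * Real.log (f x)) volume)
    (hlog : Integrable (fun x => Real.log x ^ 2) μ) {u : ℝ} (hu : u ∈ Set.Icc (0 : ℝ) 1) :
    ∫ p in (0 : ℝ)..u, Real.log (deriv (quantile μ) p)
      = (∫ p in (0 : ℝ)..u, logDerivInv μ f p)
        + 2 * ∫ p in (0 : ℝ)..u, Real.log (quantile μ p) := by
  have hsub : Set.Ioc 0 u ⊆ Set.Icc (0 : ℝ) 1 := fun x hx => ⟨hx.1.le, hx.2.trans hu.2⟩
  have hφ := integrable_logDerivInv hf_meas hf_nonneg hf hent hlog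
  have hl : IntegrableOn (fun p => Real.log (quantile μ p)) (Set.Ioc 0 u) :=
    IntegrableOn.mono_set ((memLp_log_quantile hlog).integrable (by norm_num)) hsub
  simp only [intervalIntegral.integral_of_le hu.1]
  rw [← integral_const_mul, ← integral_add hφ.integrableOn (hl.const_mul 2)]
  refine integral_congr_ae ?_
  filter_upwards [ae_restrict_of_ae_restrict_of_subset hsub
    (ae_log_deriv_quantile hf_meas hf_nonneg hf),
    ae_restrict_of_ae_restrict_of_subset hsub ae_mem_Ioo] with p h1 h2
  rw [h1, logDerivInv, Set.indicator_of_mem h2]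
  ring

/-- The estimator, computed from the quantile transforms of uniform samples, is close in mean
square to the integral of the logarithm of the derivative of the quantile function. -/
theorem l2Null_entropyEstimator_sub [IsProbabilityMeasure μ] (hf_meas : Measurable f)
    (hf_nonneg : ∀ x, 0 ≤ f x) (hf : μ = volume.withDensity (fun x => ENNReal.ofReal (f x)))
    (hpos : ∀ᵐ x ∂μ, 0 < x)
    (hent : Integrable (fun x => f x * Real.log (f x)) volume)
    (hlog : Integrable (fun x => Real.log x ^ 2) μ)
    {m n r : ℕ → ℕ} (hmr : ∀ k, 2 * m k < r k) (hr : ∀ k, r k ≤ n k)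
    (hm : Tendsto m atTop atTop) (hn : Tendsto n atTop atTop)
    (hmn : Tendsto (fun k => (m k : ℝ) / (n k : ℝ)) atTop (𝓝 0)) :
    L2Null n fun k v => entropyEstimator (fun i => quantile μ (v i)) (m k) (r k)
      - ((∫ p in (0 : ℝ)..((r k : ℝ) / n k), Real.log (deriv (quantile μ) p))
        - (1 - (r k : ℝ) / n k) * Real.log (1 - (r k : ℝ) / n k)) := by
  have D := quantileData hf_meas hf_nonneg hf hpos hent hlog
  have hQ : ∀ N : ℕ, Measurable fun (v : Fin N → ℝ) i => quantile μ (v i) := fun N =>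
    measurable_pi_lambda _ fun i => measurable_quantile.comp (measurable_pi_apply i)
  refine L2Null.of_approx
    (fun k => ((measurable_entropyEstimator (m k) (r k) (n k)).comp (hQ _)).sub_const _)
    fun ε hε => ?_
  obtain ⟨Y₁, hY₁, hle₁⟩ := D.exists_l2Null_lower hmr hr hm hn hmn
  obtain ⟨C, L, β, A⟩ := exists_isDensityApprox hf_meas hf_nonneg hf hpos hent hlog
    (by positivity : 0 < ε / 3)
  obtain ⟨Y₂, hY₂, hle₂⟩ := D.exists_l2Null_upper (memLp_log_toIoo_quantile hpos hlog) hmr hr hm hn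
    hmn (by positivity) A
  refine ⟨_, fun _ _ => ε, hY₁.abs.add hY₂.abs, fun k => measurable_const,
    .of_forall fun k => ?_, ?_⟩
  · rw [eLpNorm_const _ (by norm_num) (IsProbabilityMeasure.ne_zero _)]
    simp [Real.enorm_eq_ofReal_abs, abs_of_pos hε]
  filter_upwards [hle₁, hle₂] with k h1 h2
  filter_upwards [h1, h2] with v h3 h4
  have hN : (0 : ℝ) < n k := by
    have := hmr k; have := hr k
    exact_mod_cast (by omega : 0 < n k)
  rw [integral_log_deriv_quantile_eq hf_meas hf_nonneg hf hent hlog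
    ⟨by positivity, (div_le_one hN).2 (by exact_mod_cast hr k)⟩, entropyEstimator_eq,
    abs_of_pos hε, abs_of_nonneg (by positivity : 0 ≤ |Y₁ k v| + |Y₂ k v|), abs_le]
  have a1 := abs_nonneg (Y₁ k v)
  have a2 := abs_nonneg (Y₂ k v)
  constructor <;> linarith

theorem tendsto_integral_comp_orderStat_sub {n r : ℕ → ℕ} (hr1 : ∀ k, 1 ≤ r k)
    (hrn : ∀ k, r k < n k) (hn : Tendsto n atTop atTop) {g : ℝ → ℝ} (hg : Continuous g) :
    Tendsto (fun k => ∫ u, g (orderStat u (r k)) ∂(uniformSample (n k - 1)) - g ((r k : ℝ) / n k))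
      atTop (𝓝 0) := by
  have hn1 : Tendsto (fun k => n k - 1) atTop atTop := (tendsto_sub_atTop_nat 1).comp hn
  have hY := (l2Null_orderStat_sub hn1 hr1 (fun k => by have := hrn k; omega)).tendsto_integral_abs
  have h1n : Tendsto (fun k => 1 / ((n k - 1 : ℕ) : ℝ)) atTop (𝓝 0) :=
    (tendsto_one_div_atTop_nhds_zero_nat (𝕜 := ℝ)).comp hn1
  obtain ⟨M, hM⟩ := isCompact_Icc.exists_bound_of_continuousOn
    (hg.continuousOn (s := Set.Icc (0 : ℝ) 1))
  have hM0 : 0 ≤ M := (norm_nonneg _).trans (hM 0 (by simp))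
  have huc := Metric.uniformContinuousOn_iff.1
    (isCompact_Icc.uniformContinuousOn_of_continuous (hg.continuousOn (s := Set.Icc (0 : ℝ) 1)))
  rw [Metric.tendsto_atTop']
  intro ε hε
  obtain ⟨δ, hδ, h⟩ := huc (ε / 2) (by positivity)
  have hmod : ∀ x ∈ Set.Icc (0 : ℝ) 1, ∀ y ∈ Set.Icc (0 : ℝ) 1,
      |g x - g y| ≤ ε / 2 + 2 * M / δ * |x - y| := by
    intro x hx y hy
    by_cases hxy : |x - y| < δ
    · have := h x hx y hy hxy
      rw [Real.dist_eq] at this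
      have h2 : 0 ≤ 2 * M / δ * |x - y| := by positivity
      linarith
    · have h1 := abs_sub (g x) (g y)
      have h2 := hM x hx
      have h3 := hM y hy
      rw [Real.norm_eq_abs] at h2 h3
      have h4 : 2 * M / δ * δ ≤ 2 * M / δ * |x - y| := by gcongr; exact not_lt.1 hxy
      rw [div_mul_cancel₀ _ hδ.ne'] at h4
      linarith
  have hlim : Tendsto (fun k => 2 * M / δ * (∫ u, |orderStat u (r k) - (r k : ℝ) / (n k - 1 : ℕ)|
      ∂(uniformSample (n k - 1)) + 1 / ((n k - 1 : ℕ) : ℝ))) atTop (𝓝 0) := by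
    simpa using (hY.add h1n).const_mul (2 * M / δ)
  obtain ⟨K, hK⟩ := eventually_atTop.1 (hlim.eventually (gt_mem_nhds (half_pos hε)))
  refine ⟨K, fun k hk => ?_⟩
  have hKk := hK k hk.le
  have hrk := hrn k
  have hr1k := hr1 k
  have hN1 : (0 : ℝ) < (n k - 1 : ℕ) := by exact_mod_cast (by omega : 0 < n k - 1)
  have hN : (0 : ℝ) < n k := by exact_mod_cast (by omega : 0 < n k)
  have hNN : (n k : ℝ) = (n k - 1 : ℕ) + 1 := by rw [Nat.cast_sub (by omega)]; simp
  have hrN : (r k : ℝ) ≤ (n k - 1 : ℕ) := by exact_mod_cast (by omega : r k ≤ n k - 1)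
  have hshift : |(r k : ℝ) / (n k - 1 : ℕ) - (r k : ℝ) / n k| ≤ 1 / ((n k - 1 : ℕ) : ℝ) := by
    have e : (r k : ℝ) / (n k - 1 : ℕ) - (r k : ℝ) / n k = r k / ((n k - 1 : ℕ) * n k) := by
      rw [hNN]; field_simp; ring
    rw [e, abs_of_nonneg (by positivity), div_le_div_iff₀ (by positivity) hN1]
    nlinarith
  have hmem : ∀ᵐ u ∂(uniformSample (n k - 1)), orderStat u (r k) ∈ Set.Icc (0 : ℝ) 1 := by
    filter_upwards [ae_uniformSample_mem (n k - 1)] with u hu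
    obtain ⟨a, ha⟩ := orderStat_mem u hr1k (by omega : r k ≤ n k - 1)
    rw [ha]; exact Set.Ioo_subset_Icc_self (hu a)
  have hos : Measurable fun u : Fin (n k - 1) → ℝ => orderStat u (r k) := measurable_orderStat _
  have hgi : Integrable (fun u => g (orderStat u (r k))) (uniformSample (n k - 1)) := by
    refine Integrable.of_bound (hg.measurable.comp hos).aestronglyMeasurable M ?_
    filter_upwards [hmem] with u hu using hM _ hu
  have hYi : Integrable (fun u => |orderStat u (r k) - (r k : ℝ) / (n k - 1 : ℕ)|)
      (uniformSample (n k - 1)) := by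
    refine Integrable.of_bound (hos.sub_const _).abs.aestronglyMeasurable 1 ?_
    filter_upwards [hmem] with u hu
    have h5 : (r k : ℝ) / (n k - 1 : ℕ) ≤ 1 := (div_le_one hN1).2 hrN
    have h6 : 0 ≤ (r k : ℝ) / (n k - 1 : ℕ) := by positivity
    rw [Real.norm_eq_abs, abs_abs, abs_le]
    constructor <;> linarith [hu.1, hu.2]
  have hc : (r k : ℝ) / n k ∈ Set.Icc (0 : ℝ) 1 :=
    ⟨by positivity, (div_le_one hN).2 (by linarith)⟩
  have e : ∫ u, g (orderStat u (r k)) ∂(uniformSample (n k - 1)) - g ((r k : ℝ) / n k)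
      = ∫ u, (g (orderStat u (r k)) - g ((r k : ℝ) / n k)) ∂(uniformSample (n k - 1)) := by
    rw [integral_sub hgi (integrable_const _)]; simp
  rw [Real.dist_eq, sub_zero, e]
  refine (abs_integral_le_integral_abs).trans_lt ?_
  have hle : ∫ u, |g (orderStat u (r k)) - g ((r k : ℝ) / n k)| ∂(uniformSample (n k - 1))
      ≤ ∫ u, (ε / 2 + 2 * M / δ * (|orderStat u (r k) - (r k : ℝ) / (n k - 1 : ℕ)|
        + 1 / ((n k - 1 : ℕ) : ℝ))) ∂(uniformSample (n k - 1)) := by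
    refine integral_mono_ae (hgi.sub (integrable_const _)).abs
      ((integrable_const _).add ((hYi.add (integrable_const _)).const_mul _)) ?_
    filter_upwards [hmem] with u hu
    refine (hmod _ hu _ hc).trans ?_
    gcongr
    exact (abs_sub_le _ ((r k : ℝ) / (n k - 1 : ℕ)) _).trans (by gcongr)
  refine hle.trans_lt ?_
  have hYi' : Integrable (fun u => 2 * M / δ * (|orderStat u (r k) - (r k : ℝ) / (n k - 1 : ℕ)|
      + 1 / ((n k - 1 : ℕ) : ℝ))) (uniformSample (n k - 1)) :=
    (hYi.add (integrable_const _)).const_mul _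
  rw [integral_add (integrable_const _) hYi', integral_const_mul, integral_add hYi
      (integrable_const _)]
  simp only [integral_const, probReal_univ, one_smul]
  linarith

/-- By concentration of order statistics `U_(r:n-1)` may be replaced by `r / n`. -/
theorem tendsto_normalizedEntropy_sub [IsProbabilityMeasure μ]
    (hint : Integrable (fun p => Real.log (deriv (quantile μ) p))
      (volume.restrict (Set.Icc (0 : ℝ) 1)))
    {n r : ℕ → ℕ} (hr1 : ∀ k, 1 ≤ r k) (hrn : ∀ k, r k < n k) (hn : Tendsto n atTop atTop) :
    Tendsto (fun k => normalizedEntropy μ (r k) (n k)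
      - ((∫ p in (0 : ℝ)..((r k : ℝ) / n k), Real.log (deriv (quantile μ) p))
        - (1 - (r k : ℝ) / n k) * Real.log (1 - (r k : ℝ) / n k))) atTop (𝓝 0) := by
  set ψ : ℝ → ℝ := (Set.Icc (0 : ℝ) 1).indicator fun p => Real.log (deriv (quantile μ) p) with hψ
  have hψi : Integrable ψ := (integrable_indicator_iff measurableSet_Icc).2 hint
  have hH : Continuous fun u => ∫ p in (0 : ℝ)..u, ψ p :=
    intervalIntegral.continuous_primitive (fun a b => hψi.intervalIntegrable) 0
  have hL : Continuous fun u : ℝ => (1 - u) * Real.log (1 - u) :=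
    Real.continuous_mul_log.comp (by fun_prop : Continuous fun u : ℝ => 1 - u)
  have hHeq : ∀ u ∈ Set.Icc (0 : ℝ) 1,
      ∫ p in (0 : ℝ)..u, Real.log (deriv (quantile μ) p) = ∫ p in (0 : ℝ)..u, ψ p := fun u hu => by
    refine intervalIntegral.integral_congr fun p hp => ?_
    rw [Set.uIcc_of_le hu.1] at hp
    rw [hψ, Set.indicator_of_mem (show p ∈ Set.Icc (0 : ℝ) 1 from ⟨hp.1, hp.2.trans hu.2⟩)]
  have := (tendsto_integral_comp_orderStat_sub hr1 hrn hn hH).sub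
    (tendsto_integral_comp_orderStat_sub hr1 hrn hn hL)
  rw [sub_zero] at this
  refine this.congr fun k => ?_
  have hN : (0 : ℝ) < n k := by
    have := hrn k
    exact_mod_cast (by omega : 0 < n k)
  rw [normalizedEntropy, hHeq _ ⟨by positivity, (div_le_one hN).2 (by exact_mod_cast (hrn k).le)⟩]
  have e : ∫ u, (∫ p in (0 : ℝ)..(orderStat u (r k)), Real.log (deriv (quantile μ) p))
      ∂(uniformSample (n k - 1))
      = ∫ u, (∫ p in (0 : ℝ)..(orderStat u (r k)), ψ p) ∂(uniformSample (n k - 1)) := by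
    refine integral_congr_ae ?_
    filter_upwards [ae_uniformSample_mem (n k - 1)] with u hu
    obtain ⟨a, ha⟩ := orderStat_mem u (hr1 k) (by have := hrn k; omega : r k ≤ n k - 1)
    exact hHeq _ (by rw [ha]; exact Set.Ioo_subset_Icc_self (hu a))
  rw [e]
  ring

/-- A sample from `μ` is the quantile transform of a uniform sample. -/
theorem map_sample_eq {Ω : Type*} [MeasurableSpace Ω] {P : Measure Ω} [IsProbabilityMeasure P]
    [IsProbabilityMeasure μ] {X : ℕ → Ω → ℝ} (hX_meas : ∀ i, Measurable (X i))
    (hX_indep : iIndepFun X P) (hX_law : ∀ i, P.map (X i) = μ) (N : ℕ) :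
    P.map (fun ω (i : Fin N) => X i ω)
      = (uniformSample N).map fun v i => quantile μ (v i) := by
  have h1 := (iIndepFun_iff_map_fun_eq_pi_map (f := fun (i : Fin N) => X i)
    (fun i => (hX_meas i).aemeasurable)).1 (hX_indep.precomp Fin.val_injective)
  have h2 : (volume.restrict (Set.Icc (0 : ℝ) 1)).map (quantile μ) = μ :=
    measurePreserving_quantile.map_eq
  have : ∀ i : Fin N, SigmaFinite ((volume.restrict (Set.Icc (0 : ℝ) 1)).map (quantile μ)) :=
    fun _ => by rw [h2]; infer_instance
  have h3 := Measure.pi_map_pi (μ := fun _ : Fin N => volume.restrict (Set.Icc (0 : ℝ) 1))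
    (f := fun _ => quantile μ) (fun _ => measurable_quantile.aemeasurable)
  rw [h1, uniformSample, h3]
  simp only [hX_law, h2]

end

theorem theorem2p1 {Ω : Type*} [MeasurableSpace Ω] (P : Measure Ω) [IsProbabilityMeasure P]
    (μ : Measure ℝ) [IsProbabilityMeasure μ]
    (f : ℝ → ℝ) (hf_meas : Measurable f) (hf_nonneg : ∀ x, 0 ≤ f x)
    (hf : μ = volume.withDensity (fun x => ENNReal.ofReal (f x)))
    (hpos : ∀ᵐ x ∂μ, 0 < x)
    (hent : Integrable (fun x => f x * Real.log (f x)) volume)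
    (hlog : Integrable (fun x => Real.log x ^ 2) μ)
    (X : ℕ → Ω → ℝ) (hX_meas : ∀ i, Measurable (X i)) (hX_indep : iIndepFun X P)
    (hX_law : ∀ i, P.map (X i) = μ)
    (m n r : ℕ → ℕ) (hmr : ∀ k, 2 * m k < r k) (hrn : ∀ k, r k < n k)
    (hm : Tendsto m atTop atTop) (hn : Tendsto n atTop atTop)
    (hmn : Tendsto (fun k => (m k : ℝ) / (n k : ℝ)) atTop (𝓝 0)) :
    IntegrableOn (fun p => Real.log (deriv (quantile μ) p)) (Set.Ioo 0 1) volume ∧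
    (∀ᶠ k in atTop,
      MemLp (fun ω => entropyEstimator (fun i : Fin (n k) => X i ω) (m k) (r k)) 2 P) ∧
    Tendsto (fun k =>
        (∫ ω, entropyEstimator (fun i : Fin (n k) => X i ω) (m k) (r k) ∂P)
          - normalizedEntropy μ (r k) (n k)) atTop (𝓝 0) ∧
    Tendsto (fun k =>
        variance (fun ω => entropyEstimator (fun i : Fin (n k) => X i ω) (m k) (r k)) P)
      atTop (𝓝 0) := by
  have hr : ∀ k, r k ≤ n k := fun k => (hrn k).le
  have hr1 : ∀ k, 1 ≤ r k := fun k => by have := hmr k; omega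
  have hint := integrable_log_deriv_quantile hf_meas hf_nonneg hf hent
  have hD := l2Null_entropyEstimator_sub hf_meas hf_nonneg hf hpos hent hlog hmr hr hm hn hmn
  have hQ : ∀ N : ℕ, Measurable fun (v : Fin N → ℝ) i => quantile μ (v i) := fun N =>
    measurable_pi_lambda _ fun i => measurable_quantile.comp (measurable_pi_apply i)
  have hX : ∀ N : ℕ, Measurable fun ω (i : Fin N) => X i ω := fun N =>
    measurable_pi_lambda _ fun i => hX_meas i
  have hest := fun k => measurable_entropyEstimator (m k) (r k) (n k)
  have hlaw := fun N => map_sample_eq hX_meas hX_indep hX_law N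
  set c : ℕ → ℝ := fun k => (∫ p in (0 : ℝ)..((r k : ℝ) / n k), Real.log (deriv (quantile μ) p))
    - (1 - (r k : ℝ) / n k) * Real.log (1 - (r k : ℝ) / n k) with hc
  have hmem : ∀ᶠ k in atTop, MemLp (fun v : Fin (n k) → ℝ =>
      entropyEstimator (fun i => quantile μ (v i)) (m k) (r k)) 2 (uniformSample (n k)) := by
    filter_upwards [hD.eventually_memLp] with k hk
    have := hk.add (memLp_const (c k))
    refine this.ae_eq (.of_forall fun v => ?_)
    simp [hc]
  refine ⟨?_, ?_, ?_, ?_⟩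
  · rw [IntegrableOn, restrict_Ioo_eq_restrict_Icc]; exact hint
  · filter_upwards [hmem] with k hk
    have h1 := (memLp_map_measure_iff (hest k).aestronglyMeasurable
      (hQ (n k)).aemeasurable (p := 2) (μ := uniformSample (n k))).2 hk
    rw [← hlaw] at h1
    exact (memLp_map_measure_iff (hest k).aestronglyMeasurable (hX (n k)).aemeasurable).1 h1
  · have h1 := hD.tendsto_integral.sub (tendsto_normalizedEntropy_sub hint hr1 hrn hn)
    rw [sub_zero] at h1
    refine h1.congr' ?_
    filter_upwards [hmem] with k hk
    have h2 := integral_map (hX (n k)).aemeasurable (hest k).aestronglyMeasurable (μ := P)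
    rw [hlaw, integral_map (hQ (n k)).aemeasurable (hest k).aestronglyMeasurable] at h2
    rw [← h2, integral_sub (hk.integrable (by norm_num)) (integrable_const _)]
    simp only [integral_const, probReal_univ, one_smul]
    ring
  · refine squeeze_zero (fun k => variance_nonneg _ _) (fun k => ?_) hD.tendsto_integral_sq
    have h2 := variance_map (hest k).aemeasurable (hX (n k)).aemeasurable (μ := P)
    rw [hlaw, variance_map (hest k).aemeasurable (hQ (n k)).aemeasurable] at h2
    have h3 := variance_sub_const ((hest k).comp (hQ (n k))).aestronglyMeasurable (c k)
      (μ := uniformSample (n k))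
    have h4 := variance_le_expectation_sq (hD.1 k).aestronglyMeasurable (μ := uniformSample (n k))
    exact (h2.symm.trans h3.symm).le.trans h4
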